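/- Let $\mathbf M$ be a complete and cocomplete closed symmetric monoidal category with unit object $I$, and write $S\otimes I:=\coprod_{s\in S} I$ for a set $S$. For a small category $\mathbf C$ with set of objects $\mathbf C_0$, let $\mathcal O_{\mathbf C}$ be the $\mathbf C_0$-colored symmetric operad in sets with operations $$\mathcal O_{\mathbf C}\big(\substack{t\\ \underline c}\big)=\Sigma_n\times\prod_{i=1}^n\mathbf C(c_i,t),\qquad \underline c=(c_1,\dots,c_n),\ n\ge 0,$$ right permutation action $(\sigma,\underline f)\mapsto(\sigma\sigma',(f_{\sigma'(1)},\dots,f_{\sigma'(n)}))$ for $\sigma'\in\Sigma_n$, composition $$\gamma\big((\sigma,\underline f);(\sigma_1,\underline g_1),\dots,(\sigma_m,\underline g_m)\big)=\Big(\sigma\langle k_{\sigma^{-1}(1)},\dots,k_{\sigma^{-1}(m)}\rangle\,(\sigma_1\oplus\cdots\oplus\sigma_m),\ (f_1g_{11},\dots,f_1g_{1k_1},\dots,f_mg_{m1},\dots,f_mg_{mk_m})\Big),$$ where $k_i$ is the length of $\underline g_i=(g_{i1},\dots,g_{ik_i})$, $\sigma\langle\cdots\rangle$ is the block permutation induced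 by $\sigma$ and $\sigma_1\oplus\cdots\oplus\sigma_m$ is the block sum permutation, and unit $(e,\mathrm{id}_t)$ for each $t\in\mathbf C_0$. Applying $S\mapsto S\otimes I$ to all sets of operations gives a $\mathbf C_0$-colored operad with values in $\mathbf M$, which is again denoted by $\mathcal O_{\mathbf C}$. A functor $F:\mathbf C\to\mathbf D$ between small categories induces a morphism of operads $\mathcal O_{\mathbf C}\to\mathcal O_{\mathbf D}$ over the map of colors $F:\mathbf C_0\to\mathbf D_0$, by $(\sigma,\underline f)\mapsto(\sigma,F(\underline f))$, and hence a pullback functor $\mathbf{Alg}(\mathcal O_{\mathbf D})\to\mathbf{Alg}(\mathcal O_{\mathbf C})$ between the categories of algebras in $\mathbf M$. Then there exists, for every small category $\mathbf C$, an isomorphism of categories $$\mathbf{Alg}(\mathcal O_{\mathbf C})\;\cong\;\mathbf{Mon}_{\mathbf M}^{\mathbf C}$$ between the category of $\mathcal O_{\mathbf C}$-algebras and the category of functors from $\mathbf C$ to the category $\mathbf{Mon}_{\mathbf M}$ of monoids in $\mathbf M$. These isomorphisms can be chosen natural in $\mathbf C\in\mathbf{Cat}$: for every functor $F:\mathbf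 C\to\mathbf D$ between small categories, they intertwine the pullback functor $\mathbf{Alg}(\mathcal O_{\mathbf D})\to\mathbf{Alg}(\mathcal O_{\mathbf C})$ with the precomposition functor $\mathbf{Mon}_{\mathbf M}^{\mathbf D}\to\mathbf{Mon}_{\mathbf M}^{\mathbf C}$, $\mathfrak A\mapsto\mathfrak A\circ F$ (strictly). -/

import Mathlib

open CategoryTheory MonoidalCategory Limits Opposite

universe v u w

namespace ColOp

noncomputable section

/-! ### Profiles -/

/-- A profile: a finite sequence of colours. -/
structure Profile (K : Type w) : Type w where
  len : ℕ
  color : Fin len → K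

namespace Profile

variable {K : Type w}

/-- A morphism `c ⟶ d` of profiles is a right permutation `σ`, i.e. `d = c σ`,
`d = (c_{σ(1)}, …, c_{σ(n)})`. (A bijection between the index sets forces the lengths to agree.) -/
@[ext]
structure Hom (c d : Profile K) : Type where
  perm : Fin d.len ≃ Fin c.len
  color_eq : ∀ j, d.color j = c.color (perm j)

/-- The groupoid of profiles; the composite of `σ : c ⟶ c σ` and `τ : c σ ⟶ c σ τ` is `σ τ`. -/
instance : Category (Profile K) where
  Hom := Hom
  id c := ⟨Equiv.refl _, fun _ => rfl⟩
  comp f g := ⟨g.perm.trans f.perm, fun j => (g.color_eq j).trans (f.color_eq _)⟩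

@[ext]
theorem hom_ext {c d : Profile K} {f g : c ⟶ d} (h : ∀ j, f.perm j = g.perm j) : f = g :=
  Hom.ext (Equiv.ext h)

@[simp] theorem id_perm (c : Profile K) : Hom.perm (𝟙 c) = Equiv.refl _ := rfl

@[simp] theorem comp_perm {c d e : Profile K} (f : c ⟶ d) (g : d ⟶ e) :
    Hom.perm (f ≫ g) = g.perm.trans f.perm := rfl

/-- The profile `c σ = (c_{σ(1)}, …, c_{σ(n)})`. -/
abbrev permute (c : Profile K) (σ : Equiv.Perm (Fin c.len)) : Profile K :=
  ⟨c.len, fun j => c.color (σ j)⟩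

/-- The morphism `σ : c ⟶ c σ`. -/
def toPermute (c : Profile K) (σ : Equiv.Perm (Fin c.len)) : c ⟶ c.permute σ :=
  Hom.mk σ fun _ => rfl

/-- The profile `(t)` of length one. -/
abbrev single (t : K) : Profile K := ⟨1, fun _ => t⟩

/-- The concatenation `b_1 ⊗ ⋯ ⊗ b_m`. The positions in it are identified with pairs
`(i, x)`, where `x` is a position in `b_i`, in lexicographic order, by `finSigmaFinEquiv`. -/
def concat {m : ℕ} (b : Fin m → Profile K) : Profile K where
  len := ∑ i, (b i).len
  color p := (b (finSigmaFinEquiv.symm p).1).color (finSigmaFinEquiv.symm p).2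

/-- The position in `b_1 ⊗ ⋯ ⊗ b_m` of the `x`-th entry of `b_i`. -/
def slot {m : ℕ} (b : Fin m → Profile K) : (Σ i, Fin (b i).len) ≃ Fin (concat b).len :=
  finSigmaFinEquiv

theorem concat_color_slot {m : ℕ} (b : Fin m → Profile K) (x : Σ i, Fin (b i).len) :
    (concat b).color (slot b x) = (b x.1).color x.2 :=
  congrArg (fun y : Σ i, Fin (b i).len => (b y.1).color y.2) (finSigmaFinEquiv.symm_apply_apply x)

/-- A morphism between concatenations, from a bijection of the sets of pairs `(i, x)`. -/
def concatHom {m n : ℕ} {b : Fin m → Profile K} {b' : Fin n → Profile K}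
    (e : (Σ j, Fin (b' j).len) ≃ Σ i, Fin (b i).len)
    (he : ∀ x, (b' x.1).color x.2 = (b (e x).1).color (e x).2) : concat b ⟶ concat b' :=
  Hom.mk ((slot b').symm.trans (e.trans (slot b))) fun j => by
    obtain ⟨x, rfl⟩ := (slot b').surjective j
    simp only [Equiv.trans_apply, Equiv.symm_apply_apply, concat_color_slot, he]

@[simp]
theorem concatHom_perm_slot {m n : ℕ} {b : Fin m → Profile K} {b' : Fin n → Profile K}
    (e : (Σ j, Fin (b' j).len) ≃ Σ i, Fin (b i).len)
    (he : ∀ x, (b' x.1).color x.2 = (b (e x).1).color (e x).2) (x : Σ j, Fin (b' j).len) :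
    (concatHom e he).perm (slot b' x) = slot b (e x) := by
  simp [concatHom]

/-- The block permutation `σ⟨k_1, …, k_m⟩ : b_1 ⊗ ⋯ ⊗ b_m ⟶ b_{σ(1)} ⊗ ⋯ ⊗ b_{σ(m)}`. -/
def blockPerm {m : ℕ} (σ : Equiv.Perm (Fin m)) (b : Fin m → Profile K) :
    concat b ⟶ concat fun j => b (σ j) :=
  concatHom (Equiv.sigmaCongrLeft (β := fun i => Fin (b i).len) σ) fun _ => rfl

/-- The block sum permutation `σ_1 ⊕ ⋯ ⊕ σ_m : b_1 ⊗ ⋯ ⊗ b_m ⟶ b_1 σ_1 ⊗ ⋯ ⊗ b_m σ_m`. -/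
def blockSum {m : ℕ} {b b' : Fin m → Profile K} (f : ∀ i, b i ⟶ b' i) :
    concat b ⟶ concat b' :=
  concatHom (Equiv.sigmaCongrRight fun i => (f i).perm) fun _ => (f _).color_eq _

theorem blockPerm_perm_slot {m : ℕ} (σ : Equiv.Perm (Fin m)) (b : Fin m → Profile K)
    (x : Σ j, Fin (b (σ j)).len) :
    (blockPerm σ b).perm (slot (fun j => b (σ j)) x) = slot b ⟨σ x.1, x.2⟩ :=
  concatHom_perm_slot _ _ _

theorem blockSum_perm_slot {m : ℕ} {b b' : Fin m → Profile K} (f : ∀ i, b i ⟶ b' i)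
    (x : Σ i, Fin (b' i).len) :
    (blockSum f).perm (slot b' x) = slot b ⟨x.1, (f x.1).perm x.2⟩ :=
  concatHom_perm_slot _ _ _

/-- The family `(c_{11}, …, c_{1 k_1}, …, c_{m1}, …, c_{m k_m})`, indexed by the positions in
`b_1 ⊗ ⋯ ⊗ b_m`, where `k_i` is the length of `b_i`. -/
abbrev flat {m : ℕ} {X : Type*} (b : Fin m → Profile K) (c : ∀ i, Fin (b i).len → X) :
    Fin (concat b).len → X :=
  fun p => c ((slot b).symm p).1 ((slot b).symm p).2

/-- The position in the concatenation of the `c_i j` (taken over all pairs `(i, j)`) of the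
`y`-th entry of `c_i j`. -/
def flatSlot {m : ℕ} (b : Fin m → Profile K) (c : ∀ i, Fin (b i).len → Profile K) :
    (Σ i, Σ j, Fin (c i j).len) ≃ Σ p, Fin (flat b c p).len :=
  (Equiv.sigmaAssoc fun i j => Fin (c i j).len).symm.trans
    (Equiv.sigmaCongrLeft (β := fun y : Σ i, Fin (b i).len => Fin (c y.1 y.2).len)
      (slot b).symm).symm

/-- The identification of the concatenation of `(c_{11}, …, c_{1 k_1}, …, c_{m1}, …, c_{m k_m})`
with the concatenation over `i` of the concatenations over `j` of the `c_{ij}`. Both profiles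
are the same finite sequence, and this is the identity permutation: see `concatAssoc_val`. -/
def concatAssoc {m : ℕ} (b : Fin m → Profile K) (c : ∀ i, Fin (b i).len → Profile K) :
    concat (flat b c) ⟶ concat fun i => concat (c i) :=
  concatHom
    ((Equiv.sigmaCongrRight fun i => (slot (c i)).symm).trans (flatSlot b c))
    fun x => by
      obtain ⟨z, rfl⟩ :=
        ((flatSlot b c).symm.trans (Equiv.sigmaCongrRight fun i => slot (c i))).surjective x
      have h : ((Equiv.sigmaCongrRight fun i => (slot (c i)).symm).trans (flatSlot b c))
          (((flatSlot b c).symm.trans (Equiv.sigmaCongrRight fun i => slot (c i))) z) = z := by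
        simp [Equiv.sigmaCongrRight]
      rw [h]
      exact concat_color_slot _ _

/-- The identification of the concatenation of the single profile `a` with `a`. -/
def concatSingle (a : Profile K) : concat (fun _ : Fin 1 => a) ⟶ a :=
  Hom.mk ((Equiv.uniqueSigma fun _ : Fin 1 => Fin a.len).symm.trans (slot _)) fun j => by
    simp only [Equiv.trans_apply]
    rw [concat_color_slot]
    rfl

theorem concatSingle_perm (t : K) (a : Profile K) (i : Fin a.len) :
    (concatSingle a).perm i = slot (fun _ : Fin (single t).len => a) ⟨(0 : Fin 1), i⟩ := rfl

/-- The identification of `(a_1) ⊗ ⋯ ⊗ (a_m)` with `a = (a_1, …, a_m)`. -/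
def concatSingles (a : Profile K) : concat (fun i => single (a.color i)) ⟶ a :=
  Hom.mk ((Equiv.sigmaUnique (Fin a.len) fun _ => Fin 1).symm.trans
    (slot fun i => single (a.color i))) fun j => by
    simp only [Equiv.trans_apply]
    rw [concat_color_slot]
    rfl

theorem concatSingles_perm (a : Profile K) (i : Fin a.len) :
    (concatSingles a).perm i = slot (fun i => single (a.color i)) ⟨i, 0⟩ := rfl

/-- The action of a map of colours on profiles. -/
abbrev mapColor {L : Type*} (f : K → L) (c : Profile K) : Profile L := ⟨c.len, fun i => f (c.color i)⟩

/-- The action of a map of colours on permutations of profiles. -/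
def mapColorHom {L : Type*} (f : K → L) {c d : Profile K} (σ : c ⟶ d) :
    c.mapColor f ⟶ d.mapColor f :=
  Hom.mk σ.perm fun j => congrArg f (σ.color_eq j)

/-- The bijection `finSigmaFinEquiv` is the enumeration in lexicographic order. -/
theorem finSigma_lt_iff {m : ℕ} {n : Fin m → ℕ} (x y : Σ i, Fin (n i)) :
    finSigmaFinEquiv x < finSigmaFinEquiv y ↔
      x.1 < y.1 ∨ (x.1 = y.1 ∧ (x.2 : ℕ) < y.2) := by
  have key : ∀ x y : Σ i, Fin (n i), x.1 < y.1 → finSigmaFinEquiv x < finSigmaFinEquiv y := by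
    intro x y h
    rw [Fin.lt_def, finSigmaFinEquiv_apply, finSigmaFinEquiv_apply]
    have e : ∀ z : Fin m, ∑ i : Fin z, n (Fin.castLE z.2.le i) =
        ∑ i ∈ Finset.range z, if h : i < m then n ⟨i, h⟩ else 0 := by
      intro z
      rw [Finset.sum_range]
      refine Finset.sum_congr rfl fun i _ => ?_
      rw [dif_pos (i.2.trans z.2)]
      rfl
    rw [e, e]
    have h1 : ∑ i ∈ Finset.range (x.1 + 1), (if h : i < m then n ⟨i, h⟩ else 0) ≤
        ∑ i ∈ Finset.range y.1, if h : i < m then n ⟨i, h⟩ else 0 :=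
      Finset.sum_le_sum_of_subset (Finset.range_subset_range.2 h)
    rw [Finset.sum_range_succ, dif_pos x.1.2] at h1
    have := x.2.2
    simp only [Fin.eta] at h1
    omega
  have key2 : ∀ x y : Σ i, Fin (n i), x.1 = y.1 →
      (finSigmaFinEquiv x < finSigmaFinEquiv y ↔ (x.2 : ℕ) < y.2) := by
    rintro ⟨i, x⟩ ⟨j, y⟩ (rfl : i = j)
    rw [Fin.lt_def, finSigmaFinEquiv_apply, finSigmaFinEquiv_apply]
    simp
  rcases lt_trichotomy x.1 y.1 with h | h | h
  · simp [key x y h, h]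
  · simp [key2 x y h, h]
  · have := key y x h
    simp [this.le, h.ne', h.not_gt]

/-- A strictly monotone bijection between finite ordinals is the identity. -/
theorem val_eq_of_lt_iff {m n : ℕ} (e : Fin m ≃ Fin n) (h : ∀ i j, e i < e j ↔ i < j) (i : Fin m) :
    (e i : ℕ) = i :=
  Fin.coe_orderIso_apply ⟨e, by intro a b; rw [← not_lt, ← not_lt]; exact (h _ _).not⟩ i

theorem slot_lt_iff {m : ℕ} (b : Fin m → Profile K) (x y : Σ i, Fin (b i).len) :
    slot b x < slot b y ↔ x.1 < y.1 ∨ (x.1 = y.1 ∧ (x.2 : ℕ) < y.2) :=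
  finSigma_lt_iff x y

theorem flatSlot_symm_mk {m : ℕ} (b : Fin m → Profile K) (c : ∀ i, Fin (b i).len → Profile K)
    (p : Fin (concat b).len) (z : Fin (flat b c p).len) :
    (flatSlot b c).symm ⟨p, z⟩ = ⟨((slot b).symm p).1, ((slot b).symm p).2, z⟩ := rfl

theorem concatAssoc_perm_slot {m : ℕ} (b : Fin m → Profile K)
    (c : ∀ i, Fin (b i).len → Profile K) (x : Σ i, Σ j, Fin (c i j).len) :
    (concatAssoc b c).perm (slot (fun i => concat (c i)) ⟨x.1, slot (c x.1) x.2⟩) =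
      slot (flat b c) (flatSlot b c x) := by
  simp [concatAssoc]

theorem slot_flatSlot_lt_iff {m : ℕ} (b : Fin m → Profile K)
    (c : ∀ i, Fin (b i).len → Profile K) (x y : Σ i, Σ j, Fin (c i j).len) :
    slot (flat b c) (flatSlot b c x) < slot (flat b c) (flatSlot b c y) ↔
      x.1 < y.1 ∨ (x.1 = y.1 ∧ ((x.2.1 : ℕ) < y.2.1 ∨
        ((x.2.1 : ℕ) = y.2.1 ∧ (x.2.2 : ℕ) < y.2.2))) := by
  obtain ⟨⟨p, z⟩, rfl⟩ := (flatSlot b c).symm.surjective x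
  obtain ⟨⟨p', z'⟩, rfl⟩ := (flatSlot b c).symm.surjective y
  have h1 := slot_lt_iff b ((slot b).symm p) ((slot b).symm p')
  have h2 : p = p' ↔ (slot b).symm p = (slot b).symm p' := by simp
  simp only [Equiv.apply_symm_apply] at h1
  rw [Equiv.apply_symm_apply, Equiv.apply_symm_apply, slot_lt_iff, flatSlot_symm_mk,
    flatSlot_symm_mk]
  simp only
  rw [h1, h2]
  generalize (z : ℕ) = z
  generalize (z' : ℕ) = z'
  generalize (slot b).symm p = q
  generalize (slot b).symm p' = q'
  obtain ⟨i, j⟩ := q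
  obtain ⟨i', j'⟩ := q'
  simp only [or_assoc]
  refine or_congr_right ?_
  constructor
  · rintro (⟨rfl, h⟩ | ⟨h, h'⟩)
    · exact ⟨rfl, Or.inl h⟩
    · cases h
      exact ⟨rfl, Or.inr ⟨rfl, h'⟩⟩
  · rintro ⟨rfl, h | ⟨h, h'⟩⟩
    · exact Or.inl ⟨rfl, h⟩
    · cases Fin.ext h
      exact Or.inr ⟨rfl, h'⟩

theorem concatAssoc_val {m : ℕ} (b : Fin m → Profile K) (c : ∀ i, Fin (b i).len → Profile K)
    (q : Fin (concat fun i => concat (c i)).len) : ((concatAssoc b c).perm q : ℕ) = q := by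
  refine val_eq_of_lt_iff _ (fun i j => ?_) q
  obtain ⟨⟨i, x⟩, rfl⟩ := (slot _).surjective i
  obtain ⟨x, rfl⟩ := (slot _).surjective x
  obtain ⟨⟨j, y⟩, rfl⟩ := (slot _).surjective j
  obtain ⟨y, rfl⟩ := (slot _).surjective y
  rw [concatAssoc_perm_slot b c ⟨i, x⟩, concatAssoc_perm_slot b c ⟨j, y⟩, slot_flatSlot_lt_iff,
    slot_lt_iff]
  refine or_congr_right (and_congr_right ?_)
  rintro (rfl : i = j)
  simp only [← Fin.lt_def]
  rw [slot_lt_iff, Fin.lt_def, Fin.ext_iff]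

end Profile

/-! ### Finite tensor products -/

section Tensor

variable {V : Type u} [Category.{v} V] [MonoidalCategory V]

/-- The tensor product `X_{i_1} ⊗ (X_{i_2} ⊗ (⋯ ⊗ 𝟙))` over a list `(i_1, …, i_n)` of indices. -/
@[reducible] def tensorList {ι : Type*} (X : ι → V) : List ι → V
  | [] => 𝟙_ V
  | i :: l => X i ⊗ tensorList X l

/-- The tensor product `X_1 ⊗ ⋯ ⊗ X_n`. -/
abbrev tensorFin {n : ℕ} (X : Fin n → V) : V := tensorList X (List.finRange n)

/-- The tensor product of a family of morphisms. -/
def tensorMap {ι : Type*} {X Y : ι → V} (f : ∀ i, X i ⟶ Y i) :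
    ∀ l : List ι, tensorList X l ⟶ tensorList Y l
  | [] => 𝟙 (𝟙_ V)
  | i :: l => f i ⊗ₘ tensorMap f l

/-- The tensor product of copies of the unit object is the unit object. -/
def tensorUnits {ι : Type*} : ∀ l : List ι, tensorList (fun _ => 𝟙_ V) l ⟶ 𝟙_ V
  | [] => 𝟙 (𝟙_ V)
  | _ :: l => (λ_ _).hom ≫ tensorUnits l

/-- The tensor product over the list `(f i_1, …, f i_n)` is the tensor product of the `X_{f i}`
over `(i_1, …, i_n)`. -/
def tensorRelabel {ι κ : Type*} (X : κ → V) (f : ι → κ) :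
    ∀ l : List ι, tensorList X (l.map f) ≅ tensorList (fun i => X (f i)) l
  | [] => Iso.refl (𝟙_ V)
  | i :: l => whiskerLeftIso (X (f i)) (tensorRelabel X f l)

/-- The associator `(⨂_{l} X) ⊗ (⨂_{l'} X) ⟶ ⨂_{l ++ l'} X`. -/
def tensorAppend {ι : Type*} (X : ι → V) : ∀ l l' : List ι,
    tensorList X l ⊗ tensorList X l' ⟶ tensorList X (l ++ l')
  | [], _ => (λ_ _).hom
  | i :: l, l' => (α_ _ _ _).hom ≫ X i ◁ tensorAppend X l l'

/-- The associator from an iterated tensor product to the tensor product over the concatenation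
of the lists. -/
def tensorJoin {ι κ : Type*} (X : κ → V) (g : ι → List κ) : ∀ l : List ι,
    tensorList (fun i => tensorList X (g i)) l ⟶ tensorList X (l.flatMap g)
  | [] => 𝟙 (𝟙_ V)
  | i :: l => tensorList X (g i) ◁ tensorJoin X g l ≫ tensorAppend X (g i) (l.flatMap g)

end Tensor

section SymTensor

variable {V : Type u} [Category.{v} V] [MonoidalCategory V] [SymmetricCategory V]

/-- The permutation of tensor factors `(⨂_i X_i) ⊗ (⨂_i Y_i) ⟶ ⨂_i (X_i ⊗ Y_i)`. -/
def tensorZip {ι : Type*} (X Y : ι → V) : ∀ l : List ι,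
    tensorList X l ⊗ tensorList Y l ⟶ tensorList (fun i => X i ⊗ Y i) l
  | [] => (λ_ (𝟙_ V)).hom
  | i :: l => tensorμ (X i) (tensorList X l) (Y i) (tensorList Y l) ≫ _ ◁ tensorZip X Y l

/-- Moving the (first) tensor factor with index `j` to the front, by means of the braiding. -/
def tensorExtract {ι : Type*} [DecidableEq ι] (X : ι → V) (j : ι) : ∀ l : List ι, j ∈ l →
    (tensorList X l ⟶ X j ⊗ tensorList X (l.erase j))
  | [], h => absurd h List.not_mem_nil
  | i :: l, h =>
    if hij : i = j then
      eqToHom (by subst hij; simp [tensorList])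
    else
      X i ◁ tensorExtract X j l ((List.mem_cons.1 h).resolve_left (Ne.symm hij)) ≫
        (α_ _ _ _).inv ≫ (β_ (X i) (X j)).hom ▷ _ ≫ (α_ _ _ _).hom ≫
        eqToHom (by rw [List.erase_cons_tail (by simpa using hij)])

/-- The permutation of tensor factors `⨂_{l} X ⟶ ⨂_{l'} X`, for a list `l` (without repetitions)
and a permutation `l'` of it: the factor at an index in `l` goes to the factor at the same index
in `l'`. -/
def tensorPerm {ι : Type*} [DecidableEq ι] (X : ι → V) : ∀ l l' : List ι, l.Perm l' →
    (tensorList X l ⟶ tensorList X l')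
  | l, [], h => eqToHom (by rw [h.eq_nil])
  | l, j :: l', h =>
    tensorExtract X j l (h.mem_iff.2 List.mem_cons_self) ≫
      X j ◁ tensorPerm X (l.erase j) l' (by simpa using h.erase j)

theorem finRange_perm_map {n : ℕ} (σ : Equiv.Perm (Fin n)) :
    (List.finRange n).Perm ((List.finRange n).map σ) := by
  rw [List.perm_ext_iff_of_nodup (List.nodup_finRange n)
    ((List.nodup_finRange n).map σ.injective)]
  intro a
  simp only [List.mem_finRange, true_iff, List.mem_map, true_and]
  exact σ.surjective a

/-- The permutation of tensor factors
`τ_σ : X_1 ⊗ ⋯ ⊗ X_n ⟶ X_{σ(1)} ⊗ ⋯ ⊗ X_{σ(n)}` given by the symmetric braiding. -/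
def tensorFinPerm {n : ℕ} (σ : Equiv.Perm (Fin n)) (X : Fin n → V) :
    tensorFin X ⟶ tensorFin fun j => X (σ j) :=
  tensorPerm X _ _ (finRange_perm_map σ) ≫ (tensorRelabel X σ (List.finRange n)).hom

theorem flatMap_finRange_eq {K : Type*} {m : ℕ} (b : Fin m → Profile K) :
    (List.finRange m).flatMap (fun i => (List.finRange (b i).len).map (Sigma.mk i)) =
      (List.finRange (Profile.concat b).len).map (Profile.slot b).symm := by
  refine List.Perm.eq_of_pairwise
    (le := fun x y => Profile.slot b x < Profile.slot b y) ?_ ?_ ?_ ?_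
  · intro x y _ _ h h'
    exact absurd h' h.asymm
  · rw [List.pairwise_flatMap]
    refine ⟨fun i _ => ?_, ?_⟩
    · rw [List.pairwise_map]
      refine (List.pairwise_lt_finRange _).imp fun {x y} h => ?_
      exact (Profile.slot_lt_iff b _ _).2 (Or.inr ⟨rfl, h⟩)
    · refine (List.pairwise_lt_finRange _).imp fun {i j} h => ?_
      simp only [List.mem_map]
      rintro _ ⟨x, _, rfl⟩ _ ⟨y, _, rfl⟩
      exact (Profile.slot_lt_iff b _ _).2 (Or.inl h)
  · rw [List.pairwise_map]
    refine (List.pairwise_lt_finRange _).imp fun {x y} h => ?_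
    simpa using h
  · rw [List.perm_ext_iff_of_nodup]
    · rintro ⟨i, x⟩
      simp only [List.mem_flatMap, List.mem_finRange, List.mem_map, true_and]
      exact ⟨fun _ => ⟨Profile.slot b ⟨i, x⟩, by simp⟩, fun _ => ⟨i, x, rfl⟩⟩
    · rw [List.nodup_flatMap]
      refine ⟨fun i _ => (List.nodup_finRange _).map sigma_mk_injective, ?_⟩
      refine (List.nodup_finRange m).imp fun {i j} h => ?_
      simp only [Function.onFun, List.disjoint_left, List.mem_map]
      rintro _ ⟨x, _, rfl⟩ ⟨y, _, hy⟩
      exact h (congrArg Sigma.fst hy).symm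
    · exact (List.nodup_finRange _).map (Profile.slot b).symm.injective

/-- The associator `⨂_i ⨂_j W_{ij} ⟶ W_{11} ⊗ ⋯ ⊗ W_{1 k_1} ⊗ ⋯ ⊗ W_{m1} ⊗ ⋯ ⊗ W_{m k_m}`, where
`k_i` is the length of `b_i`. -/
def tensorFlat {K : Type*} {m : ℕ} (b : Fin m → Profile K) (W : ∀ i, Fin (b i).len → V) :
    tensorFin (fun i => tensorFin (W i)) ⟶ tensorFin (Profile.flat b W) :=
  tensorMap
      (fun i => (tensorRelabel (fun y : Σ i, Fin (b i).len => W y.1 y.2) (Sigma.mk i) _).inv) _ ≫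
    tensorJoin (fun y : Σ i, Fin (b i).len => W y.1 y.2)
      (fun i => (List.finRange (b i).len).map (Sigma.mk i)) (List.finRange m) ≫
    eqToHom (congrArg (tensorList fun y : Σ i, Fin (b i).len => W y.1 y.2)
      (flatMap_finRange_eq b)) ≫
    (tensorRelabel (fun y : Σ i, Fin (b i).len => W y.1 y.2) (Profile.slot b).symm _).hom

/-- A tensor product of one factor. -/
def tensorFinOne (X : Fin 1 → V) : X 0 ⟶ tensorFin X := (ρ_ (X 0)).inv

end SymTensor

/-! ### Coloured operads and their algebras -/

/-- A coloured operad with set of colours `K` and values in a symmetric monoidal category `V`,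
in components. Here `(obj t).obj a` is the object of operations with inputs `a` and output `t`. -/
structure ColoredOperad (K : Type w) (V : Type u) [Category.{v} V] [MonoidalCategory V]
    [SymmetricCategory V] where
  /-- the underlying symmetric sequence -/
  obj : K → Profile K ⥤ V
  /-- the composition maps -/
  γ : ∀ (t : K) (a : Profile K) (b : Fin a.len → Profile K),
    (obj t).obj a ⊗ tensorFin (fun i => (obj (a.color i)).obj (b i)) ⟶
      (obj t).obj (Profile.concat b)
  /-- the operadic units -/
  one : ∀ t : K, 𝟙_ V ⟶ (obj t).obj (Profile.single t)
  /-- the first equivariance axiom -/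
  equivariance_left : ∀ (t : K) (a : Profile K) (b : Fin a.len → Profile K)
    (σ : Equiv.Perm (Fin a.len)),
    ((obj t).map (a.toPermute σ) ⊗ₘ
        tensorFinPerm σ (fun i => (obj (a.color i)).obj (b i))) ≫
      γ t (a.permute σ) (fun j => b (σ j)) =
    γ t a b ≫ (obj t).map (Profile.blockPerm σ b)
  /-- the second equivariance axiom -/
  equivariance_right : ∀ (t : K) (a : Profile K) (b b' : Fin a.len → Profile K)
    (f : ∀ i, b i ⟶ b' i),
    ((obj t).obj a ◁ tensorMap (fun i => (obj (a.color i)).map (f i)) _) ≫ γ t a b' =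
    γ t a b ≫ (obj t).map (Profile.blockSum f)
  /-- the associativity axiom -/
  assoc : ∀ (t : K) (a : Profile K) (b : Fin a.len → Profile K)
    (c : ∀ i, Fin (b i).len → Profile K),
    (α_ ((obj t).obj a) (tensorFin fun i => (obj (a.color i)).obj (b i))
        (tensorFin fun i => tensorFin fun j => (obj ((b i).color j)).obj (c i j))).inv ≫
      (γ t a b ⊗ₘ tensorFlat b fun i j => (obj ((b i).color j)).obj (c i j)) ≫
      γ t (Profile.concat b) (Profile.flat b c) ≫
      (obj t).map (Profile.concatAssoc b c) =
    (obj t).obj a ◁ (tensorZip _ _ _ ≫ tensorMap (fun i => γ (a.color i) (b i) (c i)) _) ≫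
      γ t a (fun i => Profile.concat (c i))
  /-- the unit axiom for a unit above an operation -/
  one_left : ∀ (t : K) (a : Profile K),
    (one t ⊗ₘ tensorFinOne fun _ => (obj t).obj a) ≫
      γ t (Profile.single t) (fun _ => a) ≫ (obj t).map (Profile.concatSingle a) =
    (λ_ ((obj t).obj a)).hom
  /-- the unit axiom for units below an operation -/
  one_right : ∀ (t : K) (a : Profile K),
    (obj t).obj a ◁ tensorMap (fun i => one (a.color i)) _ ≫
      γ t a (fun i => Profile.single (a.color i)) ≫ (obj t).map (Profile.concatSingles a) =
    (obj t).obj a ◁ tensorUnits _ ≫ (ρ_ ((obj t).obj a)).hom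

/-- An algebra over a coloured operad: a family of objects `A_t`, indexed by the colours, with
structure maps `O(t; a) ⊗ A_{a_1} ⊗ ⋯ ⊗ A_{a_m} ⟶ A_t`. -/
structure OperadAlgebra {K : Type w} {V : Type u} [Category.{v} V] [MonoidalCategory V]
    [SymmetricCategory V] (O : ColoredOperad K V) where
  /-- the underlying coloured object -/
  carrier : K → V
  /-- the structure maps -/
  act : ∀ (t : K) (a : Profile K),
    (O.obj t).obj a ⊗ tensorFin (fun i => carrier (a.color i)) ⟶ carrier t
  /-- equivariance -/
  equivariance : ∀ (t : K) (a : Profile K) (σ : Equiv.Perm (Fin a.len)),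
    ((O.obj t).map (a.toPermute σ) ⊗ₘ tensorFinPerm σ (fun i => carrier (a.color i))) ≫
      act t (a.permute σ) = act t a
  /-- associativity -/
  assoc : ∀ (t : K) (a : Profile K) (b : Fin a.len → Profile K),
    (α_ ((O.obj t).obj a) (tensorFin fun i => (O.obj (a.color i)).obj (b i))
        (tensorFin fun i => tensorFin fun j => carrier ((b i).color j))).inv ≫
      (O.γ t a b ⊗ₘ tensorFlat b fun i j => carrier ((b i).color j)) ≫
      act t (Profile.concat b) =
    (O.obj t).obj a ◁ (tensorZip _ _ _ ≫ tensorMap (fun i => act (a.color i) (b i)) _) ≫ act t a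
  /-- unitality -/
  unit : ∀ t : K,
    (O.one t ⊗ₘ tensorFinOne fun _ => carrier t) ≫ act t (Profile.single t) = (λ_ (carrier t)).hom

namespace OperadAlgebra

variable {K : Type w} {V : Type u} [Category.{v} V] [MonoidalCategory V] [SymmetricCategory V]
  {O : ColoredOperad K V}

/-- A morphism of algebras: a family of morphisms that commutes with the structure maps. -/
@[ext]
structure Hom (A B : OperadAlgebra O) where
  app : ∀ t, A.carrier t ⟶ B.carrier t
  comm : ∀ (t : K) (a : Profile K),
    (O.obj t).obj a ◁ tensorMap (fun i => app (a.color i)) _ ≫ B.act t a = A.act t a ≫ app t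

end OperadAlgebra

section TensorMapLemmas

variable {V : Type u} [Category.{v} V] [MonoidalCategory V]

@[simp]
theorem tensorMap_id {ι : Type*} (X : ι → V) (l : List ι) :
    tensorMap (fun i => 𝟙 (X i)) l = 𝟙 (tensorList X l) := by
  induction l with
  | nil => rfl
  | cons i l ih => simp [tensorMap, tensorList, ih]

theorem tensorMap_comp {ι : Type*} {X Y Z : ι → V} (f : ∀ i, X i ⟶ Y i) (g : ∀ i, Y i ⟶ Z i)
    (l : List ι) : tensorMap (fun i => f i ≫ g i) l = tensorMap f l ≫ tensorMap g l := by
  induction l with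
  | nil => simp [tensorMap]
  | cons i l ih => simp [tensorMap, ih]

/-- The morphism `𝟙 ⟶ ⨂_{l} X` given by a family of morphisms `𝟙 ⟶ X_i`. -/
def tensorPoint {ι : Type*} {X : ι → V} (p : ∀ i, 𝟙_ V ⟶ X i) :
    ∀ l : List ι, 𝟙_ V ⟶ tensorList X l
  | [] => 𝟙 (𝟙_ V)
  | i :: l => (λ_ (𝟙_ V)).inv ≫ (p i ⊗ₘ tensorPoint p l)

theorem tensorPoint_map {ι : Type*} {X Y : ι → V} (p : ∀ i, 𝟙_ V ⟶ X i) (f : ∀ i, X i ⟶ Y i)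
    (l : List ι) :
    tensorPoint p l ≫ tensorMap f l = tensorPoint (fun i => p i ≫ f i) l := by
  induction l with
  | nil => simp [tensorPoint, tensorMap]
  | cons i l ih => simp [tensorPoint, tensorMap, ← ih]

theorem tensorPoint_units {ι : Type*} (l : List ι) :
    tensorPoint (fun _ : ι => 𝟙 (𝟙_ V)) l ≫ tensorUnits l = 𝟙 (𝟙_ V) := by
  induction l with
  | nil => simp [tensorPoint, tensorUnits]
  | cons i l ih => simp [tensorPoint, tensorUnits, ih]

theorem tensorPoint_relabel {ι κ : Type*} {X : κ → V} (p : ∀ i, 𝟙_ V ⟶ X i) (f : ι → κ)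
    (l : List ι) :
    tensorPoint p (l.map f) ≫ (tensorRelabel X f l).hom = tensorPoint (fun i => p (f i)) l := by
  induction l with
  | nil => exact Category.comp_id _
  | cons i l ih =>
    change tensorPoint p (f i :: l.map f) ≫ _ = _
    simp only [tensorPoint, tensorRelabel, whiskerLeftIso_hom, ← ih]
    simp [MonoidalCategory.tensorHom_def]

theorem tensorPoint_append {ι : Type*} {X : ι → V} (p : ∀ i, 𝟙_ V ⟶ X i) (l l' : List ι) :
    (λ_ (𝟙_ V)).inv ≫ (tensorPoint p l ⊗ₘ tensorPoint p l') ≫ tensorAppend X l l' =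
      tensorPoint p (l ++ l') := by
  induction l with
  | nil => simp [tensorPoint, tensorAppend]
  | cons i l ih =>
    change _ = tensorPoint p (i :: (l ++ l'))
    simp only [tensorPoint, tensorAppend, ← ih]
    monoidal

theorem tensorPoint_join {ι κ : Type*} {X : κ → V} (p : ∀ i, 𝟙_ V ⟶ X i) (g : ι → List κ)
    (l : List ι) :
    tensorPoint (fun i => tensorPoint p (g i)) l ≫ tensorJoin X g l =
      tensorPoint p (l.flatMap g) := by
  induction l with
  | nil => exact Category.comp_id _
  | cons i l ih =>
    change _ = tensorPoint p (g i ++ l.flatMap g)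
    rw [← tensorPoint_append, ← ih]
    simp [tensorPoint, tensorJoin, MonoidalCategory.tensorHom_def]

theorem tensorPoint_eqToHom {ι : Type*} {X : ι → V} (p : ∀ i, 𝟙_ V ⟶ X i) {l l' : List ι}
    (h : l = l') :
    tensorPoint p l ≫ eqToHom (congrArg (tensorList X) h) = tensorPoint p l' := by
  subst h
  simp

theorem tensorPoint_flat {K : Type*} {m : ℕ} (b : Fin m → Profile K)
    {W : ∀ i, Fin (b i).len → V} (p : ∀ i j, 𝟙_ V ⟶ W i j) :
    tensorPoint (fun i => tensorPoint (p i) (List.finRange (b i).len)) (List.finRange m) ≫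
        tensorFlat b W =
      tensorPoint (fun q => p ((Profile.slot b).symm q).1 ((Profile.slot b).symm q).2) _ := by
  rw [tensorFlat, ← Category.assoc, tensorPoint_map]
  have h : ∀ i, tensorPoint (p i) (List.finRange (b i).len) ≫
      (tensorRelabel (fun y : Σ i, Fin (b i).len => W y.1 y.2) (Sigma.mk i) _).inv =
      tensorPoint (X := fun y : Σ i, Fin (b i).len => W y.1 y.2) (fun y => p y.1 y.2)
        ((List.finRange (b i).len).map (Sigma.mk i)) := by
    intro i
    rw [Iso.comp_inv_eq]
    exact (tensorPoint_relabel (X := fun y : Σ i, Fin (b i).len => W y.1 y.2)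
      (fun y => p y.1 y.2) (Sigma.mk i) _).symm
  simp only [h]
  rw [← Category.assoc, tensorPoint_join, ← Category.assoc, tensorPoint_eqToHom _ (flatMap_finRange_eq b),
    tensorPoint_relabel]

variable [SymmetricCategory V]

theorem tensorPoint_zip {ι : Type*} {X Y : ι → V} (p : ∀ i, 𝟙_ V ⟶ X i) (q : ∀ i, 𝟙_ V ⟶ Y i)
    (l : List ι) :
    (λ_ (𝟙_ V)).inv ≫ (tensorPoint p l ⊗ₘ tensorPoint q l) ≫ tensorZip X Y l =
      tensorPoint (fun i => (λ_ (𝟙_ V)).inv ≫ (p i ⊗ₘ q i)) l := by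
  induction l with
  | nil => simp [tensorPoint, tensorZip]
  | cons i l ih =>
    simp only [tensorPoint, tensorZip, ← ih]
    have h : (λ_ (𝟙_ V)).inv ≫ ((λ_ (𝟙_ V)).inv ⊗ₘ (λ_ (𝟙_ V)).inv) ≫
        tensorμ (𝟙_ V) (𝟙_ V) (𝟙_ V) (𝟙_ V) =
        (λ_ (𝟙_ V)).inv ≫ ((λ_ (𝟙_ V)).inv ⊗ₘ (λ_ (𝟙_ V)).inv) := by
      simp only [tensorμ, braiding_tensorUnit_left]
      monoidal
    calc _ = ((λ_ (𝟙_ V)).inv ≫ ((λ_ (𝟙_ V)).inv ⊗ₘ (λ_ (𝟙_ V)).inv) ≫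
        tensorμ (𝟙_ V) (𝟙_ V) (𝟙_ V) (𝟙_ V)) ≫
          ((p i ⊗ₘ q i) ⊗ₘ (tensorPoint p l ⊗ₘ tensorPoint q l)) ≫ _ ◁ tensorZip X Y l := by
          simp only [← tensorHom_comp_tensorHom, Category.assoc]
          rw [tensorμ_natural_assoc]
      _ = _ := by
        rw [h]
        simp only [← id_tensorHom, tensorHom_comp_tensorHom,
          Category.assoc, Category.comp_id]

theorem tensorPoint_extract {ι : Type*} [DecidableEq ι] {X : ι → V} (p : ∀ i, 𝟙_ V ⟶ X i)
    (j : ι) (l : List ι) (h : j ∈ l) :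
    tensorPoint p l ≫ tensorExtract X j l h =
      (λ_ (𝟙_ V)).inv ≫ (p j ⊗ₘ tensorPoint p (l.erase j)) := by
  induction l with
  | nil => exact absurd h List.not_mem_nil
  | cons i l ih =>
    rw [tensorExtract]
    split_ifs with hij
    · subst hij
      exact tensorPoint_eqToHom p (l := i :: l) (l' := i :: (i :: l).erase i) (by simp)
    · simp only [tensorPoint]
      have := ih ((List.mem_cons.1 h).resolve_left (Ne.symm hij))
      have h1 : i :: l.erase j = (i :: l).erase j := by
        rw [List.erase_cons_tail (by simpa using hij)]
      rw [← tensorPoint_eqToHom p h1]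
      simp only [tensorPoint]
      have h2 : (λ_ (𝟙_ V)).inv ≫ (𝟙 (𝟙_ V) ⊗ₘ (λ_ (𝟙_ V)).inv) ≫ (α_ _ _ _).inv ≫
          ((β_ (𝟙_ V) (𝟙_ V)).hom ⊗ₘ 𝟙 (𝟙_ V)) ≫ (α_ _ _ _).hom =
          (λ_ (𝟙_ V)).inv ≫ (𝟙 (𝟙_ V) ⊗ₘ (λ_ (𝟙_ V)).inv) := by
        simp only [braiding_tensorUnit_left]
        monoidal
      calc _ = (λ_ (𝟙_ V)).inv ≫ (p i ⊗ₘ (tensorPoint p l ≫ tensorExtract X j l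
            ((List.mem_cons.1 h).resolve_left (Ne.symm hij)))) ≫
            (α_ _ _ _).inv ≫ (β_ (X i) (X j)).hom ▷ _ ≫ (α_ _ _ _).hom ≫
            eqToHom (by rw [← h1]) := by
            simp [MonoidalCategory.tensorHom_def]
        _ = (λ_ (𝟙_ V)).inv ≫ (𝟙 (𝟙_ V) ⊗ₘ (λ_ (𝟙_ V)).inv) ≫
            (p i ⊗ₘ p j ⊗ₘ tensorPoint p (l.erase j)) ≫
            (α_ _ _ _).inv ≫ ((β_ (X i) (X j)).hom ⊗ₘ 𝟙 _) ≫
            (α_ _ _ _).hom ≫ eqToHom (by rw [← h1]) := by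
            rw [this, tensorHom_comp_tensorHom_assoc, Category.id_comp, tensorHom_id]
        _ = ((λ_ (𝟙_ V)).inv ≫ (𝟙 (𝟙_ V) ⊗ₘ (λ_ (𝟙_ V)).inv) ≫ (α_ _ _ _).inv ≫
            ((β_ (𝟙_ V) (𝟙_ V)).hom ⊗ₘ 𝟙 (𝟙_ V)) ≫ (α_ _ _ _).hom) ≫
            (p j ⊗ₘ p i ⊗ₘ tensorPoint p (l.erase j)) ≫ eqToHom (by rw [← h1]) := by
            rw [associator_inv_naturality_assoc, tensorHom_comp_tensorHom_assoc,
              BraidedCategory.braiding_naturality]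
            simp only [Category.assoc]
            rw [← associator_naturality_assoc, tensorHom_comp_tensorHom_assoc, Category.comp_id,
              Category.id_comp]
        _ = _ := by
          rw [h2]
          have h3 : ∀ {W W' Y Z Z' : V} (f : W ⟶ Y) (g : W' ⟶ Z) (e : Z = Z'),
              (f ⊗ₘ g) ≫ eqToHom (congrArg (Y ⊗ ·) e) = f ⊗ₘ (g ≫ eqToHom e) := by
            intro W W' Y Z Z' f g e
            subst e
            simp
          rw [h3 _ _ (congrArg (tensorList X) h1)]
          simp only [Category.assoc, tensorHom_comp_tensorHom, Category.id_comp]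

theorem tensorPoint_perm {ι : Type*} [DecidableEq ι] {X : ι → V} (p : ∀ i, 𝟙_ V ⟶ X i)
    (l l' : List ι) (h : l.Perm l') :
    tensorPoint p l ≫ tensorPerm X l l' h = tensorPoint p l' := by
  induction l' generalizing l with
  | nil =>
    obtain rfl := h.eq_nil
    simp [tensorPerm]
  | cons j l' ih =>
    rw [tensorPerm, ← Category.assoc, tensorPoint_extract]
    simp [tensorPoint, ← ih (l.erase j) (by simpa using h.erase j), MonoidalCategory.tensorHom_def]

theorem tensorPoint_finPerm {n : ℕ} (σ : Equiv.Perm (Fin n)) {X : Fin n → V}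
    (p : ∀ i, 𝟙_ V ⟶ X i) :
    tensorPoint p _ ≫ tensorFinPerm σ X = tensorPoint (fun j => p (σ j)) _ := by
  rw [tensorFinPerm, ← Category.assoc, tensorPoint_perm, tensorPoint_relabel]

end TensorMapLemmas

/-! ### Operads in sets -/

/-- A coloured operad in the category of sets, in components and in terms of elements. -/
structure SetOperad (K : Type w) where
  /-- the underlying symmetric sequence -/
  obj : K → Profile K ⥤ Type v
  /-- the composition maps -/
  γ : ∀ {t : K} {a : Profile K} {b : Fin a.len → Profile K},
    (obj t).obj a → (∀ i, (obj (a.color i)).obj (b i)) → (obj t).obj (Profile.concat b)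
  /-- the operadic units -/
  one : ∀ t : K, (obj t).obj (Profile.single t)
  /-- the first equivariance axiom -/
  equivariance_left : ∀ (t : K) (a : Profile K) (b : Fin a.len → Profile K)
    (σ : Equiv.Perm (Fin a.len)) (o : (obj t).obj a) (p : ∀ i, (obj (a.color i)).obj (b i)),
    γ (a := a.permute σ) (b := fun j => b (σ j)) ((obj t).map (a.toPermute σ) o)
        (fun j => p (σ j)) =
      (obj t).map (Profile.blockPerm σ b) (γ o p)
  /-- the second equivariance axiom -/
  equivariance_right : ∀ (t : K) (a : Profile K) (b b' : Fin a.len → Profile K)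
    (f : ∀ i, b i ⟶ b' i) (o : (obj t).obj a) (p : ∀ i, (obj (a.color i)).obj (b i)),
    γ o (fun i => (obj (a.color i)).map (f i) (p i)) =
      (obj t).map (Profile.blockSum f) (γ o p)
  /-- the associativity axiom -/
  assoc : ∀ (t : K) (a : Profile K) (b : Fin a.len → Profile K)
    (c : ∀ i, Fin (b i).len → Profile K)
    (o : (obj t).obj a) (p : ∀ i, (obj (a.color i)).obj (b i))
    (q : ∀ i j, (obj ((b i).color j)).obj (c i j)),
    (obj t).map (Profile.concatAssoc b c)
        (γ (b := Profile.flat b c) (γ o p)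
          fun y => q ((Profile.slot b).symm y).1 ((Profile.slot b).symm y).2) = γ o (fun i => γ (p i) (q i))
  /-- the unit axiom for a unit above an operation -/
  one_left : ∀ (t : K) (a : Profile K) (o : (obj t).obj a),
    (obj t).map (Profile.concatSingle a) (γ (b := fun _ => a) (one t) (fun _ => o)) = o
  /-- the unit axiom for units below an operation -/
  one_right : ∀ (t : K) (a : Profile K) (o : (obj t).obj a),
    (obj t).map (Profile.concatSingles a) (γ o (fun i => one (a.color i))) = o

/-! ### The operad of a category -/

/-- Two permutations that induce the same order agree. -/
theorem perm_eq_of_lt_iff {m n : ℕ} (σ τ : Fin m ≃ Fin n) (h : ∀ i j, σ i < σ j ↔ τ i < τ j) :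
    σ = τ := by
  ext i
  have := Profile.val_eq_of_lt_iff (σ.symm.trans τ) (fun i j => by simp [← h]) (σ i)
  simpa using this.symm

section OC

variable {C : Type w} [Category.{v} C]

theorem concat_len_comp {K : Type*} {m : ℕ} (b : Fin m → Profile K) (σ : Equiv.Perm (Fin m)) :
    (Profile.concat fun j => b (σ j)).len = (Profile.concat b).len :=
  Equiv.sum_comp σ fun i => (b i).len

/-- The permutation
`σ(σ_1, …, σ_m) = σ⟨k_{σ⁻¹(1)}, …, k_{σ⁻¹(m)}⟩ (σ_1 ⊕ ⋯ ⊕ σ_m)`, where `k_i` is the length of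
`b_i`. It sends the `x`-th position of the `i`-th block (of length `k_i`) to the `σ_i(x)`-th
position of the `σ(i)`-th block, with respect to the block lengths
`k_{σ⁻¹(1)}, …, k_{σ⁻¹(m)}`. -/
def blockCompose {K : Type*} {m : ℕ} (b : Fin m → Profile K) (σ : Equiv.Perm (Fin m))
    (s : ∀ i, Equiv.Perm (Fin (b i).len)) : Equiv.Perm (Fin (Profile.concat b).len) :=
  (Profile.slot b).symm.trans
    (((Equiv.sigmaCongrRight s).trans
      (Equiv.sigmaCongrLeft (β := fun i => Fin (b i).len) σ.symm).symm).trans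
      ((Profile.slot fun j => b (σ.symm j)).trans (finCongr (concat_len_comp b σ.symm))))

theorem blockCompose_lt_iff {K : Type*} {m : ℕ} (b : Fin m → Profile K) (σ : Equiv.Perm (Fin m))
    (s : ∀ i, Equiv.Perm (Fin (b i).len)) (x y : Σ i, Fin (b i).len) :
    blockCompose b σ s (Profile.slot b x) < blockCompose b σ s (Profile.slot b y) ↔
      σ x.1 < σ y.1 ∨ (x.1 = y.1 ∧ (s x.1 x.2 : ℕ) < s y.1 y.2) := by
  have h : ∀ z : Σ i, Fin (b i).len, ∃ (j : Fin m) (w : Fin (b (σ.symm j)).len), j = σ z.1 ∧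
      (w : ℕ) = s z.1 z.2 ∧
      blockCompose b σ s (Profile.slot b z) =
        finCongr (concat_len_comp b σ.symm) (Profile.slot (fun j => b (σ.symm j)) ⟨j, w⟩) := by
    intro z
    obtain ⟨⟨j, w⟩, h⟩ := (Equiv.sigmaCongrLeft (β := fun i => Fin (b i).len) σ.symm).surjective
      ((Equiv.sigmaCongrRight s) z)
    have h1 : (⟨σ.symm j, w⟩ : Σ i, Fin (b i).len) = ⟨z.1, s z.1 z.2⟩ := h
    refine ⟨j, w, ?_, ?_, ?_⟩
    · rw [← σ.symm_apply_eq]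
      exact congrArg Sigma.fst h1
    · exact congrArg (fun y : Σ i, Fin (b i).len => (y.2 : ℕ)) h1
    · simp only [blockCompose, Equiv.trans_apply, Equiv.symm_apply_apply, ← h]
  obtain ⟨j, w, hj, hw, e⟩ := h x
  obtain ⟨j', w', hj', hw', e'⟩ := h y
  rw [e, e', Fin.lt_def]
  simp only [finCongr_apply, Fin.val_cast]
  rw [← Fin.lt_def, Profile.slot_lt_iff]
  simp [hw, hw', hj, hj']

/-- The set `Σ_n × ∏_i C(c_i, t)` of operations of `O_C`. -/
structure OCOp (c : Profile C) (t : C) : Type v where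
  perm : Equiv.Perm (Fin c.len)
  hom : ∀ i, c.color i ⟶ t

namespace OCOp

variable {t : C}

theorem ext_of_lt_iff {c : Profile C} {o o' : OCOp c t}
    (h : ∀ i j, o.perm i < o.perm j ↔ o'.perm i < o'.perm j) (h' : ∀ i, o.hom i = o'.hom i) :
    o = o' := by
  cases o
  cases o'
  obtain rfl := perm_eq_of_lt_iff _ _ h
  obtain rfl := funext h'
  rfl

/-- The action `(σ, f) σ' = (σ σ', f σ')` of permutations, `f σ' = (f_{σ'(1)}, …, f_{σ'(n)})`. -/
def act {c d : Profile C} (o : OCOp c t) (e : c ⟶ d) : OCOp d t where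
  perm := e.perm.trans (o.perm.trans (finCongr (Fin.equiv_iff_eq.1 ⟨e.perm.symm⟩)))
  hom j := eqToHom (e.color_eq j) ≫ o.hom (e.perm j)

theorem act_perm_lt_iff {c d : Profile C} (o : OCOp c t) (e : c ⟶ d) (i j : Fin d.len) :
    (o.act e).perm i < (o.act e).perm j ↔ o.perm (e.perm i) < o.perm (e.perm j) := Iff.rfl

/-- The composition `((σ, f), (σ_i, g_i)) ↦ (σ(σ_1, …, σ_m), f(g_1, …, g_m))`, where
`f(g_1, …, g_m) = (f_1 g_{11}, …, f_1 g_{1 k_1}, …, f_m g_{m1}, …, f_m g_{m k_m})`. -/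
def comp {a : Profile C} {b : Fin a.len → Profile C} (o : OCOp a t)
    (p : ∀ i, OCOp (b i) (a.color i)) : OCOp (Profile.concat b) t where
  perm := blockCompose b o.perm fun i => (p i).perm
  hom y := (p ((Profile.slot b).symm y).1).hom ((Profile.slot b).symm y).2 ≫
    o.hom ((Profile.slot b).symm y).1

/-- The operadic unit `(e, id_t)`. -/
def one (t : C) : OCOp (Profile.single t) t := ⟨Equiv.refl _, fun _ => 𝟙 t⟩

theorem comp_hom_slot {a : Profile C} {b : Fin a.len → Profile C} (o : OCOp a t)
    (p : ∀ i, OCOp (b i) (a.color i)) (y : Σ i, Fin (b i).len) :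
    (comp o p).hom (Profile.slot b y) =
      eqToHom (Profile.concat_color_slot b y) ≫ (p y.1).hom y.2 ≫ o.hom y.1 := by
  have : ∀ z (h : z = y), (p z.1).hom z.2 ≫ o.hom z.1 =
      eqToHom (congrArg (fun y : Σ i, Fin (b i).len => (b y.1).color y.2) h) ≫
        (p y.1).hom y.2 ≫ o.hom y.1 := by
    rintro _ rfl
    simp
  exact this _ ((Profile.slot b).symm_apply_apply y)

theorem hom_congr {c : Profile C} (o : OCOp c t) {i j : Fin c.len} (h : i = j) :
    o.hom i = eqToHom (congrArg c.color h) ≫ o.hom j := by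
  subst h
  simp

theorem act_hom_of_eq {c d : Profile C} (o : OCOp c t) (e : c ⟶ d) {j : Fin d.len}
    {i : Fin c.len} (h : e.perm j = i) :
    (o.act e).hom j = eqToHom ((e.color_eq j).trans (congrArg c.color h)) ≫ o.hom i := by
  subst h
  rfl

theorem comp_perm_lt_iff {a : Profile C} {b : Fin a.len → Profile C} (o : OCOp a t)
    (p : ∀ i, OCOp (b i) (a.color i)) (x y : Σ i, Fin (b i).len) :
    (comp o p).perm (Profile.slot b x) < (comp o p).perm (Profile.slot b y) ↔
      o.perm x.1 < o.perm y.1 ∨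
        (x.1 = y.1 ∧ ((p x.1).perm x.2 : ℕ) < (p y.1).perm y.2) :=
  blockCompose_lt_iff _ _ _ _ _

theorem equivariance_left (a : Profile C) (b : Fin a.len → Profile C)
    (σ : Equiv.Perm (Fin a.len)) (o : OCOp a t) (p : ∀ i, OCOp (b i) (a.color i)) :
    comp (a := a.permute σ) (b := fun j => b (σ j)) (o.act (a.toPermute σ)) (fun j => p (σ j)) =
      (comp o p).act (Profile.blockPerm σ b) := by
  refine ext_of_lt_iff (fun i j => ?_) fun i => ?_
  · obtain ⟨x, rfl⟩ := (Profile.slot _).surjective i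
    obtain ⟨y, rfl⟩ := (Profile.slot _).surjective j
    rw [act_perm_lt_iff, Profile.blockPerm_perm_slot, Profile.blockPerm_perm_slot,
      comp_perm_lt_iff, comp_perm_lt_iff]
    exact or_congr Iff.rfl (and_congr_left' σ.injective.eq_iff.symm)
  · obtain ⟨x, rfl⟩ := (Profile.slot _).surjective i
    rw [comp_hom_slot, act_hom_of_eq _ _ (Profile.blockPerm_perm_slot σ b x), comp_hom_slot,
      act_hom_of_eq (i := σ x.1) _ _ rfl]
    simp

theorem equivariance_right (a : Profile C) (b b' : Fin a.len → Profile C)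
    (f : ∀ i, b i ⟶ b' i) (o : OCOp a t) (p : ∀ i, OCOp (b i) (a.color i)) :
    comp o (fun i => (p i).act (f i)) = (comp o p).act (Profile.blockSum f) := by
  refine ext_of_lt_iff (fun i j => ?_) fun i => ?_
  · obtain ⟨x, rfl⟩ := (Profile.slot _).surjective i
    obtain ⟨y, rfl⟩ := (Profile.slot _).surjective j
    rw [act_perm_lt_iff, Profile.blockSum_perm_slot, Profile.blockSum_perm_slot,
      comp_perm_lt_iff, comp_perm_lt_iff]
    rfl
  · obtain ⟨x, rfl⟩ := (Profile.slot _).surjective i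
    rw [comp_hom_slot, act_hom_of_eq _ _ (Profile.blockSum_perm_slot f x), comp_hom_slot,
      act_hom_of_eq _ _ rfl]
    simp

theorem assoc (a : Profile C) (b : Fin a.len → Profile C) (c : ∀ i, Fin (b i).len → Profile C)
    (o : OCOp a t) (p : ∀ i, OCOp (b i) (a.color i)) (q : ∀ i j, OCOp (c i j) ((b i).color j)) :
    (comp (b := Profile.flat b c) (comp o p)
        fun y => q ((Profile.slot b).symm y).1 ((Profile.slot b).symm y).2).act
          (Profile.concatAssoc b c) =
      comp o fun i => comp (p i) (q i) := by
  suffices h : ∀ P : ∀ y, OCOp (Profile.flat b c y) ((Profile.concat b).color y),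
      (∀ y, P y = q ((Profile.slot b).symm y).1 ((Profile.slot b).symm y).2) →
      (comp (comp o p) P).act (Profile.concatAssoc b c) = comp o fun i => comp (p i) (q i) from
    h _ fun _ => rfl
  intro P hP
  have key : ∀ w w' : Σ y, Fin (Profile.flat b c y).len, ∀ x x', x = (Profile.flatSlot b c).symm w →
      x' = (Profile.flatSlot b c).symm w' →
      ((comp (comp o p) P).perm (Profile.slot _ w) < (comp (comp o p) P).perm (Profile.slot _ w') ↔
        o.perm x.1 < o.perm x'.1 ∨ (x.1 = x'.1 ∧
          (((p x.1).perm x.2.1 : ℕ) < (p x'.1).perm x'.2.1 ∨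
            ((x.2.1 : ℕ) = x'.2.1 ∧
              ((q x.1 x.2.1).perm x.2.2 : ℕ) < (q x'.1 x'.2.1).perm x'.2.2)))) := by
    rintro ⟨y, w⟩ ⟨y', w'⟩ _ _ rfl rfl
    rw [comp_perm_lt_iff]
    have e := comp_perm_lt_iff o p ((Profile.slot b).symm y) ((Profile.slot b).symm y')
    rw [Equiv.apply_symm_apply, Equiv.apply_symm_apply] at e
    rw [e, Profile.flatSlot_symm_mk, Profile.flatSlot_symm_mk, hP, hP]
    have h2 : y = y' ↔ (Profile.slot b).symm y = (Profile.slot b).symm y' := by simp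
    simp only
    rw [h2, or_assoc]
    refine or_congr_right ?_
    constructor
    · rintro (⟨h, h'⟩ | ⟨h, h'⟩)
      · exact ⟨h, Or.inl h'⟩
      · exact ⟨congrArg Sigma.fst h, Or.inr ⟨congrArg (fun y => (y.2 : ℕ)) h, h'⟩⟩
    · rintro ⟨h, h' | ⟨h', h''⟩⟩
      · exact Or.inl ⟨h, h'⟩
      · exact Or.inr ⟨Sigma.ext h (by rw [Fin.heq_ext_iff (by rw [h])]; exact h'), h''⟩
  have key2 : ∀ w : Σ y, Fin (Profile.flat b c y).len, ∀ x, (Profile.flatSlot b c).symm w = x →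
      ∃ e, (comp (comp o p) P).hom (Profile.slot _ w) =
        eqToHom e ≫ (q x.1 x.2.1).hom x.2.2 ≫ (p x.1).hom x.2.1 ≫ o.hom x.1 := by
    rintro ⟨y, w⟩ _ rfl
    refine ⟨Profile.concat_color_slot _ _, ?_⟩
    rw [comp_hom_slot, hP]
    rfl
  refine ext_of_lt_iff (fun i j => ?_) fun i => ?_
  · obtain ⟨⟨i, x⟩, rfl⟩ := (Profile.slot _).surjective i
    obtain ⟨x, rfl⟩ := (Profile.slot _).surjective x
    obtain ⟨⟨j, y⟩, rfl⟩ := (Profile.slot _).surjective j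
    obtain ⟨y, rfl⟩ := (Profile.slot _).surjective y
    rw [act_perm_lt_iff, Profile.concatAssoc_perm_slot b c ⟨i, x⟩,
      Profile.concatAssoc_perm_slot b c ⟨j, y⟩,
      key _ _ ⟨i, x⟩ ⟨j, y⟩ (Equiv.symm_apply_apply _ _).symm (Equiv.symm_apply_apply _ _).symm,
      comp_perm_lt_iff]
    refine or_congr_right (and_congr_right ?_)
    rintro (rfl : i = j)
    simp only [← Fin.lt_def]
    rw [comp_perm_lt_iff, Fin.ext_iff]
  · obtain ⟨⟨i, x⟩, rfl⟩ := (Profile.slot _).surjective i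
    obtain ⟨x, rfl⟩ := (Profile.slot _).surjective x
    rw [comp_hom_slot, comp_hom_slot, act_hom_of_eq _ _ (Profile.concatAssoc_perm_slot b c ⟨i, x⟩)]
    obtain ⟨e, h⟩ := key2 (Profile.flatSlot b c ⟨i, x⟩) ⟨i, x⟩ (Equiv.symm_apply_apply _ _)
    rw [h]
    simp

theorem one_left (a : Profile C) (o : OCOp a t) :
    (comp (b := fun _ => a) (one t) fun _ => o).act (Profile.concatSingle a) = o := by
  refine ext_of_lt_iff (fun i j => ?_) fun i => ?_
  · rw [act_perm_lt_iff, Profile.concatSingle_perm t, Profile.concatSingle_perm t]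
    have h := comp_perm_lt_iff (a := Profile.single t) (b := fun _ => a) (one t) (fun _ => o)
      ⟨(0 : Fin 1), i⟩ ⟨(0 : Fin 1), j⟩
    refine h.trans ?_
    simp
  · rw [act_hom_of_eq _ _ (Profile.concatSingle_perm t a i)]
    have h := comp_hom_slot (a := Profile.single t) (b := fun _ => a) (one t) (fun _ => o)
      ⟨(0 : Fin 1), i⟩
    rw [h]
    simp [one]

theorem one_right (a : Profile C) (o : OCOp a t) :
    (comp o fun i => one (a.color i)).act (Profile.concatSingles a) = o := by
  refine ext_of_lt_iff (fun i j => ?_) fun i => ?_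
  · rw [act_perm_lt_iff, Profile.concatSingles_perm, Profile.concatSingles_perm,
      comp_perm_lt_iff o (fun i => one (a.color i)) ⟨i, 0⟩ ⟨j, 0⟩]
    simp
  · rw [act_hom_of_eq _ _ (Profile.concatSingles_perm a i),
      comp_hom_slot o (fun i => one (a.color i)) ⟨i, 0⟩]
    simp [one]

end OCOp

/-- The symmetric sequence underlying `O_C`. -/
abbrev ocObj (t : C) : Profile C ⥤ Type v where
  obj c := OCOp c t
  map {c d} e := ↾fun o : OCOp c t => o.act e
  map_id c := by
    ext o
    exact OCOp.ext_of_lt_iff (fun _ _ => Iff.rfl) fun _ => Category.id_comp _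
  map_comp e e' := by
    ext o
    refine OCOp.ext_of_lt_iff (fun _ _ => Iff.rfl) fun _ => ?_
    change _ = eqToHom _ ≫ eqToHom _ ≫ _
    rw [eqToHom_trans_assoc]
    rfl

/-- The operad `O_C` of a category `C`. -/
def OC (C : Type w) [Category.{v} C] : SetOperad.{v} C where
  obj := ocObj
  γ o p := OCOp.comp o p
  one t := OCOp.one t
  equivariance_left _ a b σ o p := OCOp.equivariance_left a b σ o p
  equivariance_right _ a b b' f o p := OCOp.equivariance_right a b b' f o p
  assoc _ a b c o p q := OCOp.assoc a b c o p q
  one_left _ a o := OCOp.one_left a o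
  one_right _ a o := OCOp.one_right a o

end OC

/-! ### Base change of operads along `S ↦ S ⊗ I` -/

section BaseChange

variable {M : Type u} [Category.{v} M] [MonoidalCategory M]

theorem tensorPoint_finOne {X : Fin 1 → M} (q : ∀ i, 𝟙_ M ⟶ X i) :
    q 0 ≫ tensorFinOne X = tensorPoint q (List.finRange 1) := by
  change q 0 ≫ (ρ_ (X 0)).inv = (λ_ (𝟙_ M)).inv ≫ (q 0 ⊗ₘ 𝟙 _)
  simp [MonoidalCategory.tensorHom_def, unitors_inv_equal]

theorem point_associator {X Y Z : M} (p : 𝟙_ M ⟶ X) (q : 𝟙_ M ⟶ Y) (r : 𝟙_ M ⟶ Z) :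
    (λ_ (𝟙_ M)).inv ≫ (p ⊗ₘ ((λ_ (𝟙_ M)).inv ≫ (q ⊗ₘ r))) ≫ (α_ X Y Z).inv =
      (λ_ (𝟙_ M)).inv ≫ (((λ_ (𝟙_ M)).inv ≫ (p ⊗ₘ q)) ⊗ₘ r) := by
  monoidal

/-- A family of points `p_s : 𝟙 ⟶ X` that separates morphisms out of `W ⊗ X`, for every `W`. -/
def SeparatingPoints {S : Type*} {X : M} (p : S → (𝟙_ M ⟶ X)) : Prop :=
  ∀ (W T : M) (g h : W ⊗ X ⟶ T), (∀ s, W ◁ p s ≫ g = W ◁ p s ≫ h) → g = h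

theorem SeparatingPoints.hom_ext {S : Type*} {X T : M} {p : S → (𝟙_ M ⟶ X)}
    (hp : SeparatingPoints p) {g h : X ⟶ T} (H : ∀ s, p s ≫ g = p s ≫ h) : g = h := by
  have := hp _ _ (𝟙_ M ◁ g) (𝟙_ M ◁ h) fun s => by
    rw [← MonoidalCategory.whiskerLeft_comp, ← MonoidalCategory.whiskerLeft_comp, H]
  simpa using this

theorem whiskerLeft_points {W X Y T : M} (p : 𝟙_ M ⟶ X) (q : 𝟙_ M ⟶ Y) (k : W ⊗ X ⊗ Y ⟶ T) :
    W ◁ p ≫ (ρ_ (W ⊗ X)).inv ≫ (W ⊗ X) ◁ q ≫ (α_ W X Y).hom ≫ k =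
      W ◁ ((λ_ (𝟙_ M)).inv ≫ (p ⊗ₘ q)) ≫ k := by
  simp [MonoidalCategory.tensorHom_def]

theorem SeparatingPoints.tensor {S S' : Type*} {X Y : M} {p : S → (𝟙_ M ⟶ X)}
    {q : S' → (𝟙_ M ⟶ Y)} (hp : SeparatingPoints p) (hq : SeparatingPoints q) :
    SeparatingPoints fun s : S × S' => (λ_ (𝟙_ M)).inv ≫ (p s.1 ⊗ₘ q s.2) := by
  intro W T g h H
  rw [← cancel_epi (α_ W X Y).hom]
  refine hq _ _ _ _ fun s' => ?_
  rw [← cancel_epi (ρ_ (W ⊗ X)).inv]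
  refine hp _ _ _ _ fun s => ?_
  rw [whiskerLeft_points, whiskerLeft_points]
  exact H (s, s')

theorem separatingPoints_unit : SeparatingPoints fun _ : Unit => 𝟙 (𝟙_ M) := by
  intro W T g h H
  simpa using H ()

/-- The point of a tensor product given by points of the factors. -/
def tensorPointMem {ι : Type*} {X : ι → M} : ∀ l : List ι, (∀ i ∈ l, 𝟙_ M ⟶ X i) →
    (𝟙_ M ⟶ tensorList X l)
  | [], _ => 𝟙 (𝟙_ M)
  | i :: l, p => (λ_ (𝟙_ M)).inv ≫
      (p i List.mem_cons_self ⊗ₘ tensorPointMem l fun k hk => p k (List.mem_cons_of_mem _ hk))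

theorem tensorPointMem_eq {ι : Type*} {X : ι → M} (p : ∀ i, 𝟙_ M ⟶ X i) (l : List ι) :
    tensorPointMem l (fun i _ => p i) = tensorPoint p l := by
  induction l with
  | nil => rfl
  | cons i l ih => simp [tensorPointMem, tensorPoint, ih]

/-- The extension of a family over `l` to a family over `i :: l`. -/
def consMem {ι : Type*} [DecidableEq ι] {S : ι → Type*} {i : ι} {l : List ι} (s : S i)
    (x : ∀ k ∈ l, S k) : ∀ k ∈ i :: l, S k :=
  fun k hk => if h : k = i then h ▸ s else x k ((List.mem_cons.1 hk).resolve_left h)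

theorem separatingPoints_tensorPointMem {ι : Type*} [DecidableEq ι] {S : ι → Type*} {X : ι → M}
    {p : ∀ i, S i → (𝟙_ M ⟶ X i)} (hp : ∀ i, SeparatingPoints (p i)) (l : List ι)
    (hl : l.Nodup) :
    SeparatingPoints fun s : ∀ i ∈ l, S i => tensorPointMem l fun i hi => p i (s i hi) := by
  induction l with
  | nil =>
    intro W T g h H
    exact separatingPoints_unit _ _ g h fun _ => H fun _ h => absurd h List.not_mem_nil
  | cons i l ih =>
    rw [List.nodup_cons] at hl
    intro W T g h H
    refine (hp i).tensor (ih hl.2) _ _ g h fun s => ?_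
    have := H (consMem s.1 s.2)
    simp only [tensorPointMem, consMem, dif_pos] at this
    have e : (fun k (hk : k ∈ l) => p k (if h : k = i then h ▸ s.1 else
      s.2 k ((List.mem_cons.1 (List.mem_cons_of_mem i hk)).resolve_left h))) =
      fun k hk => p k (s.2 k hk) := by
      funext k hk
      rw [dif_neg]
      rintro rfl
      exact hl.1 hk
    rw [e] at this
    exact this

theorem separatingPoints_tensorFin {n : ℕ} {S : Fin n → Type*} {X : Fin n → M}
    {p : ∀ i, S i → (𝟙_ M ⟶ X i)} (hp : ∀ i, SeparatingPoints (p i)) :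
    SeparatingPoints fun s : ∀ i, S i => tensorPoint (fun i => p i (s i)) (List.finRange n) := by
  intro W T g h H
  refine separatingPoints_tensorPointMem hp _ (List.nodup_finRange n) _ _ g h fun s => ?_
  have := H fun i => s i (List.mem_finRange i)
  simp only at this
  rw [← tensorPointMem_eq] at this
  exact this

variable [MonoidalClosed M]

theorem separatingPoints_ι (S : Type v) [HasCoproducts.{v} M] :
    SeparatingPoints fun s : S => Sigma.ι (fun _ : S => 𝟙_ M) s := by
  intro W T g h H
  apply MonoidalClosed.curry_injective
  refine Sigma.hom_ext _ _ fun s => ?_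
  rw [← MonoidalClosed.curry_natural_left, ← MonoidalClosed.curry_natural_left, H]

/-- The morphism `W ⊗ (S ⊗ I) ⟶ T` given by a family of morphisms `f_s : W ⟶ T`. -/
def distDesc {S : Type v} [HasCoproducts.{v} M] {W T : M} (f : S → (W ⟶ T)) :
    W ⊗ (∐ fun _ : S => 𝟙_ M) ⟶ T :=
  MonoidalClosed.uncurry (Sigma.desc fun s => MonoidalClosed.curry ((ρ_ W).hom ≫ f s))

theorem ι_distDesc {S : Type v} [HasCoproducts.{v} M] {W T : M} (f : S → (W ⟶ T)) (s : S) :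
    W ◁ Sigma.ι (fun _ : S => 𝟙_ M) s ≫ distDesc f = (ρ_ W).hom ≫ f s := by
  rw [distDesc, ← MonoidalClosed.uncurry_natural_left, Sigma.ι_desc,
    MonoidalClosed.uncurry_curry]

/-- The morphism `W ⊗ ⨂_i (S_i ⊗ I) ⟶ T` given by a family of morphisms `f_s : W ⟶ T`, indexed by
the elements `s` of the product of the sets `S_i`. -/
def tensorDesc [HasCoproducts.{v} M] {ι : Type*} [DecidableEq ι] {S : ι → Type v} {T : M} :
    ∀ (l : List ι) {W : M}, ((∀ i ∈ l, S i) → (W ⟶ T)) →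
      (W ⊗ tensorList (fun i => ∐ fun _ : S i => 𝟙_ M) l ⟶ T)
  | [], W, f => (ρ_ W).hom ≫ f fun _ h => absurd h List.not_mem_nil
  | _ :: l, _, f =>
    (α_ _ _ _).inv ≫ tensorDesc l fun x => distDesc fun s => f (consMem s x)

theorem tensorPointMem_tensorDesc [HasCoproducts.{v} M] {ι : Type*} [DecidableEq ι]
    {S : ι → Type v} {T : M} (l : List ι) (hl : l.Nodup) {W : M}
    (f : (∀ i ∈ l, S i) → (W ⟶ T)) (s : ∀ i ∈ l, S i) :
    W ◁ tensorPointMem l (fun i hi => Sigma.ι (fun _ : S i => 𝟙_ M) (s i hi)) ≫ tensorDesc l f =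
      (ρ_ W).hom ≫ f s := by
  induction l generalizing W with
  | nil =>
    have : s = fun _ h => absurd h List.not_mem_nil := by
      funext _ h
      exact absurd h List.not_mem_nil
    subst this
    simp [tensorPointMem, tensorDesc]
  | cons i l ih =>
    rw [List.nodup_cons] at hl
    rw [tensorPointMem, tensorDesc, ← whiskerLeft_points, Iso.hom_inv_id_assoc, ih hl.2]
    rw [Iso.inv_hom_id_assoc, ι_distDesc]
    congr 2
    funext k hk
    rw [consMem]
    split_ifs with h
    · subst h
      rfl
    · rfl

end BaseChange

section BaseChange

variable (M : Type u) [Category.{v} M] [MonoidalCategory M] [HasCoproducts.{v} M]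

/-- The functor `S ↦ S ⊗ I = ∐_{s ∈ S} I`. -/
abbrev copower : Type v ⥤ M := sigmaConst.obj (𝟙_ M)

variable {M}

/-- The coproduct inclusion `I ⟶ S ⊗ I` of an element of `S`. -/
def pt {S : Type v} (s : S) : 𝟙_ M ⟶ (copower M).obj S := Sigma.ι (fun _ : S => 𝟙_ M) s

theorem pt_map {S S' : Type v} (f : S ⟶ S') (s : S) : pt (M := M) s ≫ (copower M).map f = pt (f s) := by
  simp [pt]

theorem separatingPoints_pt [MonoidalClosed M] (S : Type v) :
    SeparatingPoints (pt (M := M) : S → _) :=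
  separatingPoints_ι S

variable [MonoidalClosed M] {K : Type w}

namespace SetOperad

variable (O : SetOperad.{v} K)

/-- The composition of the operad `O ⊗ I`. -/
def baseγ (t : K) (a : Profile K) (b : Fin a.len → Profile K) :
    (copower M).obj ((O.obj t).obj a) ⊗
        tensorFin (fun i => (copower M).obj ((O.obj (a.color i)).obj (b i))) ⟶
      (copower M).obj ((O.obj t).obj (Profile.concat b)) :=
  tensorDesc (List.finRange a.len) fun p =>
    (copower M).map (↾fun o => O.γ o fun i => p i (List.mem_finRange i))

theorem pt_baseγ (t : K) (a : Profile K) (b : Fin a.len → Profile K)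
    (o : (O.obj t).obj a) (p : ∀ i, (O.obj (a.color i)).obj (b i)) :
    (λ_ (𝟙_ M)).inv ≫ (pt o ⊗ₘ tensorPoint (fun i => pt (p i)) (List.finRange a.len)) ≫
      O.baseγ t a b = pt (O.γ o p) := by
  rw [← tensorPointMem_eq]
  have := tensorPointMem_tensorDesc (M := M) (List.finRange a.len) (List.nodup_finRange _)
    (fun p => (copower M).map (↾fun o => O.γ (t := t) o fun i => p i (List.mem_finRange i)))
    (fun i _ => p i)
  rw [MonoidalCategory.tensorHom_def, Category.assoc]
  change _ ≫ _ ≫ _ ◁ tensorPointMem (List.finRange a.len) (fun i hi => Sigma.ι (fun _ => 𝟙_ M) (p i)) ≫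
    tensorDesc _ _ = _
  rw [this]
  have h : (λ_ (𝟙_ M)).inv ≫ pt o ▷ 𝟙_ M ≫ (ρ_ ((copower M).obj ((O.obj t).obj a))).hom =
      pt o := by
    simp [unitors_inv_equal]
  rw [← Category.assoc, ← Category.assoc, Category.assoc _ _ (ρ_ _).hom, h, pt_map]
  rfl

variable [SymmetricCategory M]

/-- The base change `O ⊗ I` of a `Set`-valued operad `O` along the functor `S ↦ S ⊗ I`. -/
def baseChange : ColoredOperad K M where
  obj t := O.obj t ⋙ copower M
  γ t a b := O.baseγ t a b
  one t := pt (O.one t)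
  equivariance_left t a b σ := by
    refine ((separatingPoints_pt _).tensor
      (separatingPoints_tensorFin fun i => separatingPoints_pt _)).hom_ext ?_
    rintro ⟨o, p⟩
    have h := O.equivariance_left t a b σ o p
    simp only [Functor.comp_obj, Functor.comp_map, Category.assoc]
    rw [reassoc_of% (O.pt_baseγ t a b o p), pt_map, ← h, ← pt_baseγ]
    rw [tensorHom_comp_tensorHom_assoc, pt_map, tensorPoint_finPerm]
  equivariance_right t a b b' f := by
    refine ((separatingPoints_pt _).tensor
      (separatingPoints_tensorFin fun i => separatingPoints_pt _)).hom_ext ?_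
    rintro ⟨o, p⟩
    have h := O.equivariance_right t a b b' f o p
    simp only [Functor.comp_obj, Functor.comp_map, Category.assoc]
    rw [reassoc_of% (O.pt_baseγ t a b o p), pt_map, ← h, ← pt_baseγ, ← id_tensorHom]
    rw [tensorHom_comp_tensorHom_assoc, tensorPoint_map]
    simp only [Category.comp_id, pt_map]
  assoc t a b c := by
    refine ((separatingPoints_pt _).tensor
      ((separatingPoints_tensorFin fun i => separatingPoints_pt _).tensor
        (separatingPoints_tensorFin fun i =>
          separatingPoints_tensorFin fun j => separatingPoints_pt _))).hom_ext ?_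
    rintro ⟨o, p, q⟩
    have h := O.assoc t a b c o p q
    simp only [Functor.comp_obj, Functor.comp_map, Category.assoc]
    rw [reassoc_of% (point_associator (M := M)), tensorHom_comp_tensorHom_assoc, Category.assoc,
      pt_baseγ, tensorPoint_flat b fun i j => pt (q i j)]
    have h1 := O.pt_baseγ (M := M) t (Profile.concat b) (Profile.flat b c) (O.γ o p)
      fun y => q ((Profile.slot b).symm y).1 ((Profile.slot b).symm y).2
    refine ((reassoc_of% h1) ((copower M).map ((O.obj t).map (Profile.concatAssoc b c)))).trans ?_
    rw [pt_map, h, ← pt_baseγ, ← id_tensorHom, tensorHom_comp_tensorHom_assoc,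
      Category.comp_id, Category.assoc, reassoc_of% (tensorPoint_zip (V := M)), tensorPoint_map]
    simp only [Category.assoc, pt_baseγ]
  one_left t a := by
    refine (separatingPoints_unit.tensor (separatingPoints_pt _)).hom_ext ?_
    rintro ⟨_, o⟩
    have h := O.one_left t a o
    simp only [Functor.comp_obj, Functor.comp_map, Category.assoc]
    have h1 := O.pt_baseγ (M := M) t (Profile.single t) (fun _ => a) (O.one t) fun _ => o
    have h2 := tensorPoint_finOne (M := M) fun _ => pt o
    rw [tensorHom_comp_tensorHom_assoc, h2, Category.id_comp, reassoc_of% h1, pt_map, h]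
    simp
  one_right t a := by
    refine ((separatingPoints_pt _).tensor
      (separatingPoints_tensorFin fun i => separatingPoints_unit)).hom_ext ?_
    rintro ⟨o, _⟩
    have h := O.one_right t a o
    simp only [Functor.comp_obj, Functor.comp_map, Category.assoc]
    have h1 := O.pt_baseγ (M := M) t a _ o fun i => O.one (a.color i)
    rw [← id_tensorHom, ← id_tensorHom, tensorHom_comp_tensorHom_assoc, tensorPoint_map,
      tensorHom_comp_tensorHom_assoc, tensorPoint_units]
    simp only [Category.id_comp, Category.comp_id]
    rw [reassoc_of% h1, pt_map, h]
    simp [MonoidalCategory.tensorHom_def, unitors_inv_equal]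

end SetOperad

end BaseChange

/-! ### The category of algebras over an operad -/

namespace OperadAlgebra

variable {K : Type w} {V : Type u} [Category.{v} V] [MonoidalCategory V] [SymmetricCategory V]
  {O : ColoredOperad K V}

/-- The category `Alg(O)` of algebras over a coloured operad. -/
instance : Category (OperadAlgebra O) where
  Hom := Hom
  id A := ⟨fun t => 𝟙 (A.carrier t), fun t a => by simp⟩
  comp f g := ⟨fun t => f.app t ≫ g.app t, fun t a => by
    rw [tensorMap_comp, MonoidalCategory.whiskerLeft_comp, Category.assoc, g.comm,
      reassoc_of% (f.comm t a)]⟩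
  id_comp f := Hom.ext (funext fun _ => Category.id_comp _)
  comp_id f := Hom.ext (funext fun _ => Category.comp_id _)
  assoc f g h := Hom.ext (funext fun _ => Category.assoc _ _ _)

theorem hom_ext {A B : OperadAlgebra O} {f g : A ⟶ B} (h : ∀ t, f.app t = g.app t) : f = g :=
  Hom.ext (funext h)

theorem id_app (A : OperadAlgebra O) (t : K) : Hom.app (𝟙 A) t = 𝟙 (A.carrier t) := rfl

theorem comp_app {A B C : OperadAlgebra O} (f : A ⟶ B) (g : B ⟶ C) (t : K) :
    Hom.app (f ≫ g) t = f.app t ≫ g.app t := rfl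

theorem eqToHom_app {A B : OperadAlgebra O} (h : A = B) (t : K) :
    Hom.app (eqToHom h) t = eqToHom (congrArg (fun A => A.carrier t) h) := by
  subst h
  rfl

/-- Two functors to a category of algebras agree if they have the same underlying coloured
objects, structure maps and underlying morphisms. -/
theorem functor_ext {D : Type*} [Category D] {F G : D ⥤ OperadAlgebra O}
    (h : ∀ X, F.obj X = G.obj X)
    (h' : ∀ {X Y} (f : X ⟶ Y) (t : K), (F.map f).app t =
      eqToHom (congrArg (fun A => A.carrier t) (h X)) ≫ (G.map f).app t ≫
        eqToHom (congrArg (fun A => A.carrier t) (h Y).symm)) : F = G :=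
  CategoryTheory.Functor.ext h fun X Y f => hom_ext fun t => by
    rw [h', comp_app, comp_app, eqToHom_app, eqToHom_app]

theorem ext_of_act {A B : OperadAlgebra O} (h : A.carrier = B.carrier)
    (h' : ∀ t a, HEq (A.act t a) (B.act t a)) : A = B := by
  obtain ⟨c, x, _, _, _⟩ := A
  obtain ⟨c', y, _, _, _⟩ := B
  obtain rfl : c = c' := h
  obtain rfl : x = y := funext fun t => funext fun a => eq_of_heq (h' t a)
  rfl

end OperadAlgebra

/-! ### Operads with varying colours -/

/-- A morphism of operads with varying colours: a map `f` of colours and morphisms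
`O(t; a) ⟶ P(f(t); f(a))` that are compatible with the permutation actions, the compositions and
the units. -/
structure ColoredOperad.Hom {K L : Type w} {V : Type u} [Category.{v} V] [MonoidalCategory V]
    [SymmetricCategory V] (O : ColoredOperad K V) (P : ColoredOperad L V) where
  /-- the map of colours -/
  color : K → L
  /-- the morphisms of objects of operations -/
  app : ∀ (t : K) (a : Profile K), (O.obj t).obj a ⟶ (P.obj (color t)).obj (a.mapColor color)
  map_app : ∀ (t : K) {a b : Profile K} (σ : a ⟶ b),
    (O.obj t).map σ ≫ app t b = app t a ≫ (P.obj (color t)).map (Profile.mapColorHom color σ)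
  γ_app : ∀ (t : K) (a : Profile K) (b : Fin a.len → Profile K),
    O.γ t a b ≫ app t (Profile.concat b) =
      (app t a ⊗ₘ tensorMap (fun i => app (a.color i) (b i)) _) ≫
        P.γ (color t) (a.mapColor color) (fun i => (b i).mapColor color)
  one_app : ∀ t : K, O.one t ≫ app t (Profile.single t) = P.one (color t)

theorem ColoredOperad.Hom.ext_of_app {K L : Type w} {V : Type u} [Category.{v} V]
    [MonoidalCategory V] [SymmetricCategory V] {O : ColoredOperad K V} {P : ColoredOperad L V}
    {F G : Hom O P} (h : F.color = G.color) (h' : ∀ t a, HEq (F.app t a) (G.app t a)) : F = G := by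
  obtain ⟨c, x, _, _, _⟩ := F
  obtain ⟨c', y, _, _, _⟩ := G
  obtain rfl : c = c' := h
  obtain rfl : x = y := funext fun t => funext fun a => eq_of_heq (h' t a)
  rfl

/-- An operad with values in `V`, together with its set of colours. -/
structure Op (V : Type u) [Category.{v} V] [MonoidalCategory V] [SymmetricCategory V] where
  colors : Type w
  operad : ColoredOperad colors V

/-- The category `Op(V)` of operads with varying colours. -/
instance {V : Type u} [Category.{v} V] [MonoidalCategory V] [SymmetricCategory V] :
    Category (Op.{v, u, w} V) where
  Hom O P := ColoredOperad.Hom O.operad P.operad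
  id O :=
    { color := fun t => t
      app := fun t a => 𝟙 _
      map_app := fun t a b σ => (Category.comp_id _).trans (Category.id_comp _).symm
      γ_app := fun t a b => by
        rw [tensorMap_id, id_tensorHom_id, Category.id_comp]
        exact Category.comp_id _
      one_app := fun t => Category.comp_id _ }
  comp F G :=
    { color := fun t => G.color (F.color t)
      app := fun t a => F.app t a ≫ G.app (F.color t) (a.mapColor F.color)
      map_app := fun t a b σ => by
        rw [← Category.assoc, F.map_app, Category.assoc, G.map_app, Category.assoc]
        rfl
      γ_app := fun t a b => by
        refine (Category.assoc _ _ _).symm.trans ((congrArg (· ≫ G.app (F.color t)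
          ((Profile.concat b).mapColor F.color)) (F.γ_app t a b)).trans
            ((Category.assoc _ _ _).trans ((congrArg _ (G.γ_app _ _ _)).trans ?_)))
        rw [tensorMap_comp, ← tensorHom_comp_tensorHom, Category.assoc]
        rfl
      one_app := fun t => by
        rw [← Category.assoc, F.one_app]
        exact G.one_app _ }
  id_comp F := ColoredOperad.Hom.ext_of_app rfl fun t a => heq_of_eq (Category.id_comp _)
  comp_id F := ColoredOperad.Hom.ext_of_app rfl fun t a => heq_of_eq (Category.comp_id _)
  assoc F G H := ColoredOperad.Hom.ext_of_app rfl fun t a => heq_of_eq (Category.assoc _ _ _)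

section Pullback

variable {V : Type u} [Category.{v} V] [MonoidalCategory V]

theorem pullback_assoc_aux {A A' B B' C C' D E S T : V} (γ : A ⊗ B ⟶ C) (φ : C ⟶ C')
    (fl : D ⟶ E) (act : C' ⊗ E ⟶ T) (f : A ⟶ A') (g : B ⟶ B') (γ' : A' ⊗ B' ⟶ C')
    (z : B ⊗ D ⟶ S) (z' : B' ⊗ D ⟶ S) (act' : A' ⊗ S ⟶ T) (h1 : γ ≫ φ = (f ⊗ₘ g) ≫ γ')
    (h2 : (α_ A' B' D).inv ≫ (γ' ⊗ₘ fl) ≫ act = A' ◁ z' ≫ act') (h3 : z = g ▷ D ≫ z') :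
    (α_ A B D).inv ≫ (γ ⊗ₘ fl) ≫ φ ▷ E ≫ act = A ◁ z ≫ f ▷ S ≫ act' := by
  have e : (γ ⊗ₘ fl) ≫ φ ▷ E = ((f ⊗ₘ g) ⊗ₘ 𝟙 D) ≫ (γ' ⊗ₘ fl) := by
    rw [← tensorHom_id, tensorHom_comp_tensorHom, tensorHom_comp_tensorHom, h1, Category.comp_id,
      Category.id_comp]
  rw [reassoc_of% e, ← associator_inv_naturality_assoc, h2, h3, ← id_tensorHom, ← id_tensorHom,
    ← tensorHom_id, ← tensorHom_id, tensorHom_comp_tensorHom_assoc,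
    tensorHom_comp_tensorHom_assoc]
  simp

variable [SymmetricCategory V]

theorem tensorZip_natural_left {ι : Type*} {X X' : ι → V} (Y : ι → V) (f : ∀ i, X i ⟶ X' i)
    (l : List ι) :
    tensorMap f l ▷ tensorList Y l ≫ tensorZip X' Y l =
      tensorZip X Y l ≫ tensorMap (fun i => f i ▷ Y i) l := by
  induction l with
  | nil => simp [tensorMap, tensorZip]
  | cons i l ih =>
    simp only [tensorMap, tensorZip, Category.assoc]
    rw [tensorμ_natural_left_assoc, ← id_tensorHom, ← id_tensorHom, tensorHom_comp_tensorHom,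
      tensorHom_comp_tensorHom, Category.comp_id, Category.id_comp, ih]

variable {K L : Type w} {O : ColoredOperad K V} {P : ColoredOperad L V}

/-- The pullback of an algebra along a morphism of operads. -/
def ColoredOperad.Hom.pullbackObj (F : ColoredOperad.Hom O P) (B : OperadAlgebra P) :
    OperadAlgebra O where
  carrier t := B.carrier (F.color t)
  act t a := F.app t a ▷ _ ≫ B.act (F.color t) (a.mapColor F.color)
  equivariance t a σ := by
    have h := B.equivariance (F.color t) (a.mapColor F.color) σ
    rw [← tensorHom_id, tensorHom_comp_tensorHom_assoc, F.map_app, Category.comp_id]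
    rw [← h, ← tensorHom_id, tensorHom_comp_tensorHom_assoc, Category.id_comp]
    rfl
  assoc t a b := by
    refine pullback_assoc_aux _ _ _ _ _ _ _ _ _ _ (F.γ_app t a b)
      (B.assoc (F.color t) (a.mapColor F.color) fun i => (b i).mapColor F.color) ?_
    rw [tensorMap_comp, ← Category.assoc, ← tensorZip_natural_left, Category.assoc]
  unit t := by
    have h := B.unit (F.color t)
    rw [← h, ← tensorHom_id, tensorHom_comp_tensorHom_assoc, F.one_app, Category.comp_id]

/-- The pullback functor `Alg(P) ⥤ Alg(O)` along a morphism of operads `O ⟶ P`. -/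
def ColoredOperad.Hom.pullback (F : ColoredOperad.Hom O P) : OperadAlgebra P ⥤ OperadAlgebra O where
  obj B := F.pullbackObj B
  map {A B} f := OperadAlgebra.Hom.mk (fun t => f.app (F.color t)) fun t a => by
    refine Eq.trans ?_ (congrArg (F.app t a ▷ _ ≫ ·)
      (f.comm (F.color t) (a.mapColor F.color))) |>.trans (Category.assoc _ _ _).symm
    exact whisker_exchange_assoc _ _ _
  map_id B := rfl
  map_comp f g := rfl

end Pullback

/-- The functor `Op(V)ᵒᵖ ⥤ Cat`, `O ↦ Alg(O)`. -/
def algFunctor (V : Type u) [Category.{v} V] [MonoidalCategory V] [SymmetricCategory V] :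
    (Op.{v, u, v} V)ᵒᵖ ⥤ Cat.{v, max u v} where
  obj O := Cat.of (OperadAlgebra O.unop.operad)
  map F := (ColoredOperad.Hom.pullback F.unop).toCatHom
  map_id O := by
    refine Cat.ext (OperadAlgebra.functor_ext (fun B => ?_) fun f t => ?_)
    · refine OperadAlgebra.ext_of_act rfl fun t a => heq_of_eq ?_
      exact (congrArg (· ≫ _) (id_whiskerRight _ _)).trans (Category.id_comp _)
    · exact ((Category.id_comp _).trans (Category.comp_id _)).symm
  map_comp F G := by
    refine Cat.ext (OperadAlgebra.functor_ext (fun B => ?_) fun f t => ?_)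
    · refine OperadAlgebra.ext_of_act rfl fun t a => heq_of_eq ?_
      exact (congrArg (· ≫ _) (comp_whiskerRight _ _ _)).trans (Category.assoc _ _ _)
    · exact ((Category.id_comp _).trans (Category.comp_id _)).symm

/-! ### Functoriality of the operads `O_C`, and functors with values in monoids -/

/-- A morphism of `Set`-valued operads with varying colours. -/
structure SetOperad.Hom {K L : Type w} (O : SetOperad.{v} K) (P : SetOperad.{v} L) where
  /-- the map of colours -/
  color : K → L
  /-- the maps of sets of operations -/
  app : ∀ (t : K) (a : Profile K), (O.obj t).obj a → (P.obj (color t)).obj (a.mapColor color)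
  map_app : ∀ (t : K) {a b : Profile K} (σ : a ⟶ b) (o : (O.obj t).obj a),
    app t b ((O.obj t).map σ o) = (P.obj (color t)).map (Profile.mapColorHom color σ) (app t a o)
  γ_app : ∀ (t : K) (a : Profile K) (b : Fin a.len → Profile K) (o : (O.obj t).obj a)
    (p : ∀ i, (O.obj (a.color i)).obj (b i)),
    app t (Profile.concat b) (O.γ o p) =
      P.γ (b := fun i => (b i).mapColor color) (app t a o) fun i => app (a.color i) (b i) (p i)
  one_app : ∀ t : K, app t (Profile.single t) (O.one t) = P.one (color t)

section Final

variable {C D : Type w} [Category.{v} C] [Category.{v} D]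

/-- The map `(σ, f) ↦ (σ, F(f))` of sets of operations. -/
def OCOp.mapFunctor (F : C ⥤ D) {c : Profile C} {t : C} (o : OCOp c t) :
    OCOp (c.mapColor F.obj) (F.obj t) where
  perm := o.perm
  hom i := F.map (o.hom i)

/-- The morphism of operads `O_F : O_C ⟶ O_D` induced by a functor `F : C ⥤ D`. -/
def OC.map (F : C ⥤ D) : SetOperad.Hom (OC C) (OC D) where
  color := F.obj
  app _ _ o := OCOp.mapFunctor F o
  map_app t a b σ o := by
    refine OCOp.ext_of_lt_iff (fun _ _ => Iff.rfl) fun i => ?_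
    change F.map (eqToHom _ ≫ _) = eqToHom _ ≫ F.map _
    rw [F.map_comp, eqToHom_map]
    rfl
  γ_app t a b o p := by
    refine OCOp.ext_of_lt_iff (fun i j => ?_) fun i => ?_
    · exact Iff.rfl
    · exact F.map_comp _ _
  one_app t := OCOp.ext_of_lt_iff (fun _ _ => Iff.rfl) fun _ => F.map_id _

variable (M : Type u) [Category.{v} M] [MonoidalCategory M] [SymmetricCategory M]
  [MonoidalClosed M] [HasCoproducts.{v} M]

theorem points_comp_aux {M : Type u} [Category.{v} M] [MonoidalCategory M] {X X' Y Y' T : M}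
    {p : 𝟙_ M ⟶ X} {q : 𝟙_ M ⟶ Y} {p' : 𝟙_ M ⟶ X'} {q' : 𝟙_ M ⟶ Y'} {f : X ⟶ X'} {h : Y ⟶ Y'}
    (hp : p ≫ f = p') (hq : q ≫ h = q') (g : X' ⊗ Y' ⟶ T) :
    (λ_ (𝟙_ M)).inv ≫ (p' ⊗ₘ q') ≫ g = ((λ_ (𝟙_ M)).inv ≫ (p ⊗ₘ q)) ≫ (f ⊗ₘ h) ≫ g := by
  rw [Category.assoc, tensorHom_comp_tensorHom_assoc, hp, hq]

/-- The base change of a morphism of operads along the functor `S ↦ S ⊗ I`. -/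
def SetOperad.Hom.baseChange {K L : Type w} {O : SetOperad.{v} K} {P : SetOperad.{v} L}
    (F : SetOperad.Hom O P) :
    ColoredOperad.Hom (O.baseChange : ColoredOperad K M) (P.baseChange : ColoredOperad L M) where
  color := F.color
  app t a := (copower M).map (↾F.app t a)
  map_app t {a b} σ := by
    refine ((copower M).map_comp _ _).symm.trans (Eq.trans ?_ ((copower M).map_comp _ _))
    congr 1
    ext o
    exact F.map_app t σ o
  γ_app t a b := by
    refine ((separatingPoints_pt _).tensor
      (separatingPoints_tensorFin fun i => separatingPoints_pt _)).hom_ext ?_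
    rintro ⟨o, p⟩
    refine (Category.assoc _ _ _).trans ?_
    have h1 := O.pt_baseγ (M := M) t a b o p
    refine (congrArg ((λ_ (𝟙_ M)).inv ≫ ·) (Category.assoc _ _ _).symm).trans ?_
    refine (Category.assoc _ _ _).symm.trans ?_
    refine (congrArg (· ≫ (copower M).map (↾F.app t (Profile.concat b))) h1).trans ?_
    rw [pt_map]
    refine (congrArg pt (F.γ_app t a b o p)).trans ?_
    refine (P.pt_baseγ (M := M) (F.color t) (a.mapColor F.color)
      (fun i => (b i).mapColor F.color) _ _).symm.trans ?_
    refine points_comp_aux (pt_map (M := M) (↾F.app t a) o) ((tensorPoint_map _ _ _).trans ?_) _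
    simp only [pt_map]
    rfl
  one_app t := (pt_map _ _).trans (congrArg pt (F.one_app t))

/-- The functor `Cat ⥤ Op(M)`, `C ↦ O_C ⊗ I`, on the category of small categories. -/
def ocFunctor : Cat.{v, v} ⥤ Op.{v, u, v} M where
  obj C := ⟨C, (OC C).baseChange⟩
  map F := (OC.map F.toFunctor).baseChange M
  map_id _ := ColoredOperad.Hom.ext_of_app rfl fun _ _ => heq_of_eq ((copower M).map_id _)
  map_comp F G := ColoredOperad.Hom.ext_of_app rfl fun t a => heq_of_eq
    ((copower M).map_comp (↾(OC.map F.toFunctor).app t a)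
      (↾(OC.map G.toFunctor).app (F.toFunctor.obj t) (a.mapColor F.toFunctor.obj)))

end Final

/-- The functor `Catᵒᵖ ⥤ Cat`, `C ↦ Mon_M^C`, which sends a functor `F` to the precomposition
with `F`. -/
def monFunctor (M : Type u) [Category.{v} M] [MonoidalCategory M] :
    Cat.{v, v}ᵒᵖ ⥤ Cat.{v, max u v} where
  obj C := Cat.of (C.unop ⥤ Mon M)
  map F := ((Functor.whiskeringLeft _ _ (Mon M)).obj F.unop.toFunctor).toCatHom
  map_id _ := rfl
  map_comp _ _ := rfl

end

end ColOp

/-! Since `M` is closed, tensoring preserves coproducts. A structure map out of `(S ⊗ I) ⊗ Y` is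
therefore a family of morphisms out of `Y` indexed by `S`, and equations between such maps can be
tested on the inclusions `pt s` (`separatingPoints_pt`). An `O_C`-algebra thus amounts to objects
`A_t` and a morphism for each operation `(σ, f)`, compatible with permutations, composites and units
(`opAct_map`, `opAct_γ`, `opAct_one`; conversely `ofOp`).

A functor `F : C ⥤ Mon M` gives such data: `(σ, f)` applies `F(f_i)` to the `i`-th factor, reorders
the factors by `σ⁻¹` and multiplies (`monAct`). The axioms are `monAct_act`, `monAct_comp` and
`monAct_one`. The hard one is `monAct_comp`, which combines three facts. Transition maps are monoid
homomorphisms (`monAct_map`). Reordering and multiplying block by block agrees with doing so all at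
once (`tensorPerm_mulList_join`). The order so obtained is that of the composite permutation
(`OCOp.comp_perm_symm_list`). The second fact rests on symmetric coherence: two permutations of
distinct tensor factors with the same source and target lists are equal (`IsPerm.unique`), by
Yang–Baxter.

Conversely, in an algebra the nullary and binary operations with identity entries give a unit and a
multiplication on each `A_t`, and the unary operations give transition maps. All the laws come from
evaluating one operation `(e, f)` in two ways, by `listAct_comp`, `listAct_append` and their
consequence `listAct_cons`. These are instances of the composition axiom with identity permutations
(`listAct_join`).

The constructions are strictly inverse. By `listAct_eq` the operations `(e, f)` are iterated
products of transition maps, and equivariance reduces `(σ, f)` to this case, so the algebra is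
recovered (`ocAct_eq`). In the other direction, `monAct` at the binary and unary operations returns
the multiplication and the transition maps (`toFunctor_ofFunctor`). On morphisms both functors leave
the components unchanged. Naturality in `C` holds on the nose, since acting by `(σ, F(f))` through
`G` is acting by `(σ, f)` through `F ⋙ G` (`pullback_ofFunctor`). -/

namespace ColOp

noncomputable section

/-! ### Naturality of relabelling, concatenation and flattening of tensor products -/

section TensorNaturality

variable {V : Type u} [Category.{v} V] [MonoidalCategory V] {ι : Type*}

theorem tensorMap_relabel {κ : Type*} {X Y : κ → V} (φ : ∀ k, X k ⟶ Y k) (f : ι → κ)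
    (l : List ι) :
    tensorMap φ (l.map f) ≫ (tensorRelabel Y f l).hom =
      (tensorRelabel X f l).hom ≫ tensorMap (fun i => φ (f i)) l := by
  induction l with
  | nil => exact (Category.comp_id _).trans (Category.id_comp _).symm
  | cons i l ih =>
    change (φ (f i) ⊗ₘ tensorMap φ (l.map f)) ≫ (Y (f i) ◁ (tensorRelabel Y f l).hom) =
      (X (f i) ◁ (tensorRelabel X f l).hom) ≫ (φ (f i) ⊗ₘ tensorMap (fun i => φ (f i)) l)
    rw [← id_tensorHom, ← id_tensorHom, tensorHom_comp_tensorHom, tensorHom_comp_tensorHom, ih,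
      Category.comp_id, Category.id_comp]

theorem tensorAppend_natural {X Y : ι → V} (φ : ∀ i, X i ⟶ Y i) (l m : List ι) :
    (tensorMap φ l ⊗ₘ tensorMap φ m) ≫ tensorAppend Y l m =
      tensorAppend X l m ≫ tensorMap φ (l ++ m) := by
  induction l with
  | nil =>
    change (𝟙 _ ⊗ₘ _) ≫ (λ_ _).hom = (λ_ _).hom ≫ _
    simp
  | cons i l ih =>
    change ((φ i ⊗ₘ tensorMap φ l) ⊗ₘ tensorMap φ m) ≫ (α_ _ _ _).hom ≫ Y i ◁ tensorAppend Y l m =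
      ((α_ _ _ _).hom ≫ X i ◁ tensorAppend X l m) ≫ (φ i ⊗ₘ tensorMap φ (l ++ m))
    rw [associator_naturality_assoc, ← id_tensorHom, ← id_tensorHom, Category.assoc,
      tensorHom_comp_tensorHom, tensorHom_comp_tensorHom, ih, Category.comp_id, Category.id_comp]

theorem tensorJoin_natural {κ : Type*} {X Y : κ → V} (φ : ∀ k, X k ⟶ Y k) (g : ι → List κ)
    (l : List ι) :
    tensorMap (fun i => tensorMap φ (g i)) l ≫ tensorJoin Y g l =
      tensorJoin X g l ≫ tensorMap φ (l.flatMap g) := by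
  induction l with
  | nil => exact (Category.comp_id _).trans (Category.id_comp _).symm
  | cons i l ih =>
    change (tensorMap φ (g i) ⊗ₘ _) ≫ tensorList Y (g i) ◁ tensorJoin Y g l ≫ tensorAppend Y _ _ =
      (tensorList X (g i) ◁ tensorJoin X g l ≫ tensorAppend X _ _) ≫
        tensorMap φ (g i ++ l.flatMap g)
    rw [Category.assoc, ← tensorAppend_natural, ← id_tensorHom, ← id_tensorHom,
      tensorHom_comp_tensorHom_assoc, tensorHom_comp_tensorHom_assoc, ih, Category.comp_id,
      Category.id_comp]

end TensorNaturality

/-! ### Coherence for permutations of tensor factors -/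

section Coherence

variable {V : Type u} [Category.{v} V] [MonoidalCategory V] [SymmetricCategory V]

/-- The exchange of the first two factors of `A ⊗ B ⊗ R`. -/
def swapHead (A B R : V) : A ⊗ B ⊗ R ⟶ B ⊗ A ⊗ R :=
  (α_ A B R).inv ≫ (β_ A B).hom ▷ R ≫ (α_ B A R).hom

theorem swapHead_natural {A A' B B' R R' : V} (f : A ⟶ A') (g : B ⟶ B') (h : R ⟶ R') :
    (f ⊗ₘ g ⊗ₘ h) ≫ swapHead A' B' R' = swapHead A B R ≫ (g ⊗ₘ f ⊗ₘ h) := by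
  simp only [swapHead, Category.assoc]
  rw [associator_inv_naturality_assoc, ← tensorHom_id, ← tensorHom_id,
    tensorHom_comp_tensorHom_assoc, BraidedCategory.braiding_naturality, ← associator_naturality,
    tensorHom_comp_tensorHom_assoc, Category.comp_id, Category.id_comp]

theorem swapHead_natural_right (A B : V) {R R' : V} (h : R ⟶ R') :
    A ◁ B ◁ h ≫ swapHead A B R' = swapHead A B R ≫ B ◁ A ◁ h := by
  simpa using swapHead_natural (𝟙 A) (𝟙 B) h

@[simp]
theorem swapHead_swapHead (A B R : V) : swapHead A B R ≫ swapHead B A R = 𝟙 _ := by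
  simp [swapHead, ← comp_whiskerRight_assoc]

/-- The Yang–Baxter equation in the presence of a further factor `R`. It is the braid relation used
in the coherence theorem. -/
theorem swapHead_yang_baxter (A B C R : V) :
    swapHead A B (C ⊗ R) ≫ B ◁ swapHead A C R ≫ swapHead B C (A ⊗ R) =
      A ◁ swapHead B C R ≫ swapHead A C (B ⊗ R) ≫ C ◁ swapHead A B R := by
  have h := (BraidedCategory.yang_baxter A B C : _)
  -- Whisker the equation by `R` and rebracket at both ends; the rest is coherence without
  -- braidings.
  have h' : (α_ A B (C ⊗ R)).inv ≫ (α_ (A ⊗ B) C R).inv ≫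
      ((α_ A B C).hom ≫ (α_ A B C).inv ≫ (β_ A B).hom ▷ C ≫ (α_ B A C).hom ≫
      B ◁ (β_ A C).hom ≫ (α_ B C A).inv ≫ (β_ B C).hom ▷ A ≫ (α_ C B A).hom) ▷ R ≫
        (α_ _ _ _).hom ≫ _ ◁ (α_ _ _ _).hom =
      (α_ A B (C ⊗ R)).inv ≫ (α_ (A ⊗ B) C R).inv ≫
      ((α_ A B C).hom ≫ A ◁ (β_ B C).hom ≫ (α_ A C B).inv ≫ (β_ A C).hom ▷ B ≫
        (α_ C A B).hom ≫ C ◁ (β_ A B).hom) ▷ R ≫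
        (α_ _ _ _).hom ≫ _ ◁ (α_ _ _ _).hom := by
    rw [h]
  simp only [swapHead]
  refine Eq.trans ?_ (h'.trans ?_)
  · monoidal
  · monoidal

variable {ι : Type*}

/-- The relation that a morphism `⨂_l X ⟶ X_j ⊗ ⨂_r X` moves one occurrence of `j` to the front. -/
inductive IsExtract (X : ι → V) (j : ι) :
    ∀ {l r : List ι}, (tensorList X l ⟶ X j ⊗ tensorList X r) → Prop
  | head (l : List ι) : IsExtract X j (l := j :: l) (r := l) (𝟙 (X j ⊗ tensorList X l))
  | tail (i : ι) (h : i ≠ j) {l r : List ι} {e : tensorList X l ⟶ X j ⊗ tensorList X r} :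
      IsExtract X j e →
      IsExtract X j (l := i :: l) (r := i :: r) (X i ◁ e ≫ swapHead (X i) (X j) (tensorList X r))

/-- The relation that a morphism `⨂_l X ⟶ ⨂_{l'} X` is a permutation of tensor factors. -/
inductive IsPerm (X : ι → V) : ∀ {l l' : List ι}, (tensorList X l ⟶ tensorList X l') → Prop
  | id (l : List ι) : IsPerm X (𝟙 (tensorList X l))
  | comp {l l' l'' : List ι} {f : tensorList X l ⟶ tensorList X l'}
      {g : tensorList X l' ⟶ tensorList X l''} : IsPerm X f → IsPerm X g → IsPerm X (f ≫ g)
  | cons (i : ι) {l l' : List ι} {f : tensorList X l ⟶ tensorList X l'} :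
      IsPerm X f → IsPerm X (l := i :: l) (l' := i :: l') (X i ◁ f)
  | swap (i j : ι) (l : List ι) :
      IsPerm X (l := i :: j :: l) (l' := j :: i :: l) (swapHead (X i) (X j) (tensorList X l))

variable {X : ι → V}

theorem IsPerm.perm {l l' : List ι} {f : tensorList X l ⟶ tensorList X l'} (hf : IsPerm X f) :
    l.Perm l' := by
  induction hf with
  | id l => exact List.Perm.refl l
  | comp _ _ h h' => exact h.trans h'
  | cons i _ h => exact h.cons i
  | swap i j l => exact List.Perm.swap j i l

theorem IsPerm.eqToHom {l l' : List ι} (h : l = l') :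
    IsPerm X (eqToHom (congrArg (tensorList X) h)) := by
  subst h
  exact IsPerm.id l

theorem IsPerm.exists_inv {l l' : List ι} {f : tensorList X l ⟶ tensorList X l'}
    (hf : IsPerm X f) :
    ∃ g : tensorList X l' ⟶ tensorList X l, IsPerm X g ∧ f ≫ g = 𝟙 _ ∧ g ≫ f = 𝟙 _ := by
  induction hf with
  | id l => exact ⟨𝟙 _, IsPerm.id l, by simp, by simp⟩
  | comp _ _ h h' =>
    obtain ⟨g, hg, h1, h2⟩ := h
    obtain ⟨g', hg', h1', h2'⟩ := h'
    exact ⟨g' ≫ g, hg'.comp hg, by simp [reassoc_of% h1', h1], by simp [reassoc_of% h2, h2']⟩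
  | cons i _ h =>
    obtain ⟨g, hg, h1, h2⟩ := h
    exact ⟨_, hg.cons i, by simp [← MonoidalCategory.whiskerLeft_comp, h1],
      by simp [← MonoidalCategory.whiskerLeft_comp, h2]⟩
  | swap i j l => exact ⟨_, IsPerm.swap j i l, by simp, by simp⟩

theorem IsExtract.isPerm {j : ι} {l r : List ι} {e : tensorList X l ⟶ X j ⊗ tensorList X r}
    (he : IsExtract X j e) : IsPerm X (l' := j :: r) e := by
  induction he with
  | head l => exact IsPerm.id (j :: l)
  | tail i h _ ih => exact (ih.cons i).comp (IsPerm.swap i j _)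

theorem IsExtract.exists {j : ι} {l : List ι} (h : j ∈ l) :
    ∃ (r : List ι) (e : tensorList X l ⟶ X j ⊗ tensorList X r), IsExtract X j e := by
  induction l with
  | nil => exact absurd h List.not_mem_nil
  | cons i l ih =>
    by_cases hij : i = j
    · subst hij
      exact ⟨_, _, IsExtract.head l⟩
    · obtain ⟨r, e, he⟩ := ih ((List.mem_cons.1 h).resolve_left (Ne.symm hij))
      exact ⟨_, _, he.tail i hij⟩

/-- The condition `i ≠ j` in the constructor `tail` forces the first occurrence of `j` to be the one
that moves, so no choice is left. -/
theorem IsExtract.unique {j : ι} {l r r' : List ι} {e : tensorList X l ⟶ X j ⊗ tensorList X r}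
    {e' : tensorList X l ⟶ X j ⊗ tensorList X r'} (he : IsExtract X j e)
    (he' : IsExtract X j e') : r = r' ∧ HEq e e' := by
  induction he generalizing r' with
  | head l =>
    cases he' with
    | head => exact ⟨rfl, HEq.rfl⟩
    | tail _ h => exact absurd rfl h
  | tail i h _ ih =>
    cases he' with
    | head => exact absurd rfl h
    | tail _ _ h' =>
      obtain ⟨rfl, h⟩ := ih h'
      cases h
      exact ⟨rfl, HEq.rfl⟩

/-- Once `j` has been moved to the front on both sides, what remains is again a permutation. This is
checked on the generators and drives the induction in `IsPerm.unique`. -/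
theorem IsPerm.extract {l l' : List ι} {f : tensorList X l ⟶ tensorList X l'} (hf : IsPerm X f)
    (hl : l.Nodup) {j : ι} {r r' : List ι} {e : tensorList X l ⟶ X j ⊗ tensorList X r}
    {e' : tensorList X l' ⟶ X j ⊗ tensorList X r'} (he : IsExtract X j e)
    (he' : IsExtract X j e') :
    ∃ f' : tensorList X r ⟶ tensorList X r', IsPerm X f' ∧ f ≫ e' = e ≫ X j ◁ f' := by
  induction hf generalizing r r' with
  | id l =>
    obtain ⟨rfl, h⟩ := he.unique he'
    cases h
    exact ⟨_, IsPerm.id r, by simp⟩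
  | @comp l l' l'' f g hf hg ihf ihg =>
    obtain ⟨r₁, e₁, h₁⟩ := IsExtract.exists (X := X) (j := j) (l := l')
      (hg.perm.mem_iff.2 (he'.isPerm.perm.mem_iff.2 List.mem_cons_self))
    obtain ⟨f', hf', h⟩ := ihf hl he h₁
    obtain ⟨g', hg', h'⟩ := ihg (hf.perm.nodup hl) h₁ he'
    exact ⟨_, hf'.comp hg', by simp [h', reassoc_of% h]⟩
  | @cons i l l' f hf ih =>
    cases he' with
    | head =>
      cases he with
      | head => exact ⟨f, hf, by simp⟩
      | tail _ h => exact absurd rfl h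
    | tail _ hij h' =>
      cases he with
      | head => exact absurd rfl hij
      | tail _ _ h =>
        obtain ⟨f', hf', e⟩ := ih (List.nodup_cons.1 hl).2 h h'
        refine ⟨_, hf'.cons i, ?_⟩
        rw [Category.assoc, ← swapHead_natural_right, ← Category.assoc, ← Category.assoc,
          ← MonoidalCategory.whiskerLeft_comp, ← MonoidalCategory.whiskerLeft_comp, e]
  | swap i k l =>
    -- Distinctness is essential here: the braiding of an object with itself need not be the
    -- identity.
    have hik : i ≠ k := by
      rintro rfl
      simp at hl
    cases he' with
    | head =>
      cases he with
      | head => exact absurd rfl hik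
      | tail _ h h' =>
        cases h' with
        | head => exact ⟨_, IsPerm.id _, by simp⟩
        | tail _ h' => exact absurd rfl h'
    | tail _ hkj h' =>
      cases h' with
      | head =>
        cases he with
        | head => exact ⟨_, IsPerm.id _, by simp⟩
        | tail _ h => exact absurd rfl h
      | tail _ hij h' =>
        cases he with
        | head => exact absurd rfl hij
        | tail _ _ h =>
          cases h with
          | head => exact absurd rfl hkj
          | tail _ _ h =>
            obtain ⟨rfl, h⟩ := h.unique h'
            cases h
            -- Neither swapped factor is `j`, so `j` passes both of them; the two orders of doing
            -- this agree by Yang–Baxter.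
            refine ⟨_, IsPerm.swap i k _, ?_⟩
            simp only [MonoidalCategory.whiskerLeft_comp, Category.assoc]
            rw [← swapHead_yang_baxter, ← reassoc_of% (swapHead_natural_right (X i) (X k))]

theorem IsPerm.eq_id_of_nil {l l' : List ι} {f : tensorList X l ⟶ tensorList X l'}
    (hf : IsPerm X f) (hl : l = []) (hl' : l' = []) :
    f = CategoryTheory.eqToHom (by rw [hl, hl']) := by
  induction hf with
  | id l => rfl
  | comp hf _ ih ih' =>
    subst hl
    rw [ih rfl hf.perm.nil_eq.symm, ih' hf.perm.nil_eq.symm hl', eqToHom_trans]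
  | cons => simp at hl
  | swap => simp at hl

/-- Two permutations of tensor factors with the same effect on indices agree. -/
theorem IsPerm.unique {l l' : List ι} {f g : tensorList X l ⟶ tensorList X l'}
    (hf : IsPerm X f) (hg : IsPerm X g) (hl : l.Nodup) : f = g := by
  induction l' generalizing l with
  | nil =>
    have h := hf.perm.eq_nil
    rw [hf.eq_id_of_nil h rfl, hg.eq_id_of_nil h rfl]
  | cons j l' ih =>
    -- Both morphisms factor through the same extraction of the first target index `j`, and the
    -- induction applies to the remaining factors.
    obtain ⟨r, e, he⟩ := IsExtract.exists (X := X) (j := j) (l := l)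
      (hf.perm.mem_iff.2 List.mem_cons_self)
    obtain ⟨f', hf', h⟩ := hf.extract hl he (IsExtract.head l')
    obtain ⟨g', hg', h'⟩ := hg.extract hl he (IsExtract.head l')
    have hr := (List.nodup_cons.1 (he.isPerm.perm.nodup hl)).2
    rw [Category.comp_id] at h h'
    rw [h, h', ih hf' hg' hr]

theorem isExtract_tensorExtract [DecidableEq ι] (j : ι) (l : List ι) (h : j ∈ l) :
    IsExtract X j (tensorExtract X j l h) := by
  induction l with
  | nil => exact absurd h List.not_mem_nil
  | cons i l ih =>
    rw [tensorExtract]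
    split_ifs with hij
    · subst hij
      -- The remaining list is generalised so that the `eqToHom` produced by `List.erase` can be
      -- eliminated.
      have : ∀ r (h : l = r), IsExtract X i (l := i :: l) (r := r)
          (CategoryTheory.eqToHom (congrArg (fun r => X i ⊗ tensorList X r) h)) := by
        rintro r rfl
        exact IsExtract.head l
      exact this _ (List.erase_cons_head i l).symm
    · have h' := (ih ((List.mem_cons.1 h).resolve_left (Ne.symm hij))).tail i hij
      have : ∀ {r r' : List ι} (hr : r = r') {e : tensorList X (i :: l) ⟶ X j ⊗ tensorList X r},
          IsExtract X j e → IsExtract X j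
            (e ≫ CategoryTheory.eqToHom (congrArg (fun r => X j ⊗ tensorList X r) hr)) := by
        rintro r _ rfl e he
        simpa using he
      have h2 := this (List.erase_cons_tail (by simpa using hij)).symm h'
      simpa only [swapHead, Category.assoc] using h2

theorem isPerm_tensorPerm [DecidableEq ι] (l l' : List ι) (h : l.Perm l') :
    IsPerm X (tensorPerm X l l' h) := by
  induction l' generalizing l with
  | nil => exact IsPerm.eqToHom h.eq_nil
  | cons j l' ih => exact (isExtract_tensorExtract j l _).isPerm.comp ((ih _ _).cons j)

theorem IsPerm.eq_tensorPerm [DecidableEq ι] {l l' : List ι}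
    {f : tensorList X l ⟶ tensorList X l'} (hf : IsPerm X f) (hl : l.Nodup) :
    f = tensorPerm X l l' hf.perm :=
  hf.unique (isPerm_tensorPerm _ _ _) hl

theorem tensorPerm_comp [DecidableEq ι] {l l' l'' : List ι} (hl : l.Nodup) (h : l.Perm l')
    (h' : l'.Perm l'') :
    tensorPerm X l l' h ≫ tensorPerm X l' l'' h' = tensorPerm X l l'' (h.trans h') :=
  ((isPerm_tensorPerm l l' h).comp (isPerm_tensorPerm l' l'' h')).eq_tensorPerm hl

theorem tensorPerm_self [DecidableEq ι] {l : List ι} (hl : l.Nodup) (h : l.Perm l) :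
    tensorPerm X l l h = 𝟙 _ :=
  ((IsPerm.id l).eq_tensorPerm hl).symm

/-- `IsPerm` is a relation on morphisms for a fixed family, so the permutation on `Y` is built along
the derivation and only afterwards identified with `tensorPerm` by uniqueness. -/
theorem IsPerm.exists_tensorMap {Y : ι → V} (φ : ∀ i, X i ⟶ Y i) {l l' : List ι}
    {f : tensorList X l ⟶ tensorList X l'} (hf : IsPerm X f) :
    ∃ g : tensorList Y l ⟶ tensorList Y l', IsPerm Y g ∧
      tensorMap φ l ≫ g = f ≫ tensorMap φ l' := by
  induction hf with
  | id l => exact ⟨_, IsPerm.id l, by simp⟩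
  | comp _ _ h h' =>
    obtain ⟨g, hg, e⟩ := h
    obtain ⟨g', hg', e'⟩ := h'
    exact ⟨_, hg.comp hg', by rw [reassoc_of% e, e', Category.assoc]⟩
  | cons i _ h =>
    obtain ⟨g, hg, e⟩ := h
    refine ⟨_, hg.cons i, ?_⟩
    simp only [tensorMap]
    rw [← id_tensorHom, ← id_tensorHom, tensorHom_comp_tensorHom, tensorHom_comp_tensorHom, e,
      Category.comp_id, Category.id_comp]
  | swap i j l => exact ⟨_, IsPerm.swap i j l, swapHead_natural _ _ _⟩

theorem tensorMap_tensorPerm [DecidableEq ι] {Y : ι → V} (φ : ∀ i, X i ⟶ Y i) {l l' : List ι}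
    (hl : l.Nodup) (h : l.Perm l') :
    tensorMap φ l ≫ tensorPerm Y l l' h = tensorPerm X l l' h ≫ tensorMap φ l' := by
  obtain ⟨g, hg, e⟩ := (isPerm_tensorPerm l l' h).exists_tensorMap φ
  rw [← e, hg.eq_tensorPerm hl]

theorem IsPerm.relabel {κ : Type*} {X : κ → V} (f : ι → κ) {l l' : List ι}
    {g : tensorList (fun i => X (f i)) l ⟶ tensorList (fun i => X (f i)) l'}
    (hg : IsPerm (fun i => X (f i)) g) :
    IsPerm X ((tensorRelabel X f l).hom ≫ g ≫ (tensorRelabel X f l').inv) := by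
  induction hg with
  | id l => simpa using IsPerm.id (l.map f)
  | comp _ _ h h' => simpa using h.comp h'
  | cons i _ h =>
    have := h.cons (f i)
    simpa [tensorRelabel] using this
  | swap i j l =>
    have := IsPerm.swap (X := X) (f i) (f j) (l.map f)
    simp only [tensorRelabel, whiskerLeftIso_hom, whiskerLeftIso_inv]
    have h := swapHead_natural_right (X (f i)) (X (f j)) (tensorRelabel X f l).hom
    have h2 : X (f i) ◁ X (f j) ◁ (tensorRelabel X f l).hom ≫
        swapHead (X (f i)) (X (f j)) _ ≫ X (f j) ◁ X (f i) ◁ (tensorRelabel X f l).inv =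
        swapHead (X (f i)) (X (f j)) _ := by
      rw [reassoc_of% h, ← MonoidalCategory.whiskerLeft_comp, ← MonoidalCategory.whiskerLeft_comp]
      simp
    exact h2 ▸ this

/-- Distinctness is required after relabelling, because uniqueness is applied to the permutation
transported to `κ`. -/
theorem tensorRelabel_tensorPerm {κ : Type*} [DecidableEq ι] [DecidableEq κ] {X : κ → V}
    (f : ι → κ) {l l' : List ι} (hl : (l.map f).Nodup) (h : l.Perm l') :
    (tensorRelabel X f l).hom ≫ tensorPerm (fun i => X (f i)) l l' h =
      tensorPerm X (l.map f) (l'.map f) (h.map f) ≫ (tensorRelabel X f l').hom := by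
  have := (isPerm_tensorPerm (X := fun i => X (f i)) l l' h).relabel f
  rw [← this.eq_tensorPerm hl]
  simp

/-! ### Permutations of joined tensor products -/

/-- The generators of `IsPerm` contain only whiskering on the left. Whiskering on the right has to
be absorbed into the concatenated list, generator by generator. -/
theorem IsPerm.append_right {l l' : List ι} {f : tensorList X l ⟶ tensorList X l'}
    (hf : IsPerm X f) (m : List ι) :
    ∃ f' : tensorList X (l ++ m) ⟶ tensorList X (l' ++ m), IsPerm X f' ∧
      f ▷ tensorList X m ≫ tensorAppend X l' m = tensorAppend X l m ≫ f' := by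
  induction hf with
  | id l => exact ⟨_, IsPerm.id _, by simp⟩
  | comp _ _ h h' =>
    obtain ⟨g, hg, e⟩ := h
    obtain ⟨g', hg', e'⟩ := h'
    exact ⟨_, hg.comp hg', by rw [comp_whiskerRight_assoc, e', reassoc_of% e]⟩
  | cons i _ h =>
    obtain ⟨g, hg, e⟩ := h
    refine ⟨_, hg.cons i, ?_⟩
    change _ ≫ (α_ _ _ _).hom ≫ X i ◁ tensorAppend X _ m =
      ((α_ _ _ _).hom ≫ X i ◁ tensorAppend X _ m) ≫ _
    rw [associator_naturality_middle_assoc, ← MonoidalCategory.whiskerLeft_comp, e,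
      Category.assoc, MonoidalCategory.whiskerLeft_comp]
  | swap i j l =>
    refine ⟨_, IsPerm.swap i j _, ?_⟩
    change _ ≫ (α_ _ _ _).hom ≫ X j ◁ ((α_ _ _ _).hom ≫ X i ◁ tensorAppend X l m) =
      ((α_ _ _ _).hom ≫ X i ◁ ((α_ _ _ _).hom ≫ X j ◁ tensorAppend X l m)) ≫ _
    simp only [MonoidalCategory.whiskerLeft_comp, Category.assoc]
    have e := swapHead_natural_right (X i) (X j) (tensorAppend X l m)
    have e' : swapHead (X i) (X j) (tensorList X l) ▷ tensorList X m ≫ (α_ _ _ _).hom ≫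
        X j ◁ (α_ _ _ _).hom =
      (α_ _ _ _).hom ≫ X i ◁ (α_ _ _ _).hom ≫ swapHead (X i) (X j) _ := by
      simp only [swapHead]
      monoidal
    refine Eq.trans ?_ (congrArg (fun f => (α_ _ _ _).hom ≫ X i ◁ (α_ _ _ _).hom ≫ f) e).symm
    simpa using congrArg (· ≫ X j ◁ X i ◁ tensorAppend X l m) e'

theorem IsPerm.append_left {m m' : List ι} {f : tensorList X m ⟶ tensorList X m'}
    (hf : IsPerm X f) (l : List ι) :
    ∃ f' : tensorList X (l ++ m) ⟶ tensorList X (l ++ m'), IsPerm X f' ∧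
      tensorList X l ◁ f ≫ tensorAppend X l m' = tensorAppend X l m ≫ f' := by
  induction l with
  | nil => exact ⟨f, hf, leftUnitor_naturality f⟩
  | cons i l ih =>
    obtain ⟨g, hg, e⟩ := ih
    refine ⟨_, hg.cons i, ?_⟩
    change _ ≫ (α_ _ _ _).hom ≫ X i ◁ tensorAppend X l m' =
      ((α_ _ _ _).hom ≫ X i ◁ tensorAppend X l m) ≫ _
    rw [associator_naturality_right_assoc, ← MonoidalCategory.whiskerLeft_comp, e,
      Category.assoc, MonoidalCategory.whiskerLeft_comp]

/-- The two lists are equal but not definitionally so. Recording the comparison as a permutation is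
enough, because uniqueness later removes all choices. -/
theorem isPerm_tensorAppend_assoc (a b c : List ι) :
    ∃ f : tensorList X ((a ++ b) ++ c) ⟶ tensorList X (a ++ (b ++ c)), IsPerm X f ∧
      tensorAppend X a b ▷ tensorList X c ≫ tensorAppend X (a ++ b) c ≫ f =
        (α_ _ _ _).hom ≫ tensorList X a ◁ tensorAppend X b c ≫ tensorAppend X a (b ++ c) := by
  induction a with
  | nil =>
    refine ⟨_, IsPerm.id _, ?_⟩
    change (λ_ _).hom ▷ _ ≫ tensorAppend X b c ≫ 𝟙 _ =
      (α_ _ _ _).hom ≫ 𝟙_ V ◁ tensorAppend X b c ≫ (λ_ _).hom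
    simp
  | cons i a ih =>
    obtain ⟨f, hf, e⟩ := ih
    refine ⟨_, hf.cons i, ?_⟩
    change ((α_ _ _ _).hom ≫ X i ◁ tensorAppend X a b) ▷ _ ≫
      ((α_ _ _ _).hom ≫ X i ◁ tensorAppend X (a ++ b) c) ≫ X i ◁ f =
      (α_ _ _ _).hom ≫ (X i ⊗ tensorList X a) ◁ tensorAppend X b c ≫
        ((α_ _ _ _).hom ≫ X i ◁ tensorAppend X a (b ++ c))
    have e' := congrArg (fun f => X i ◁ f) e
    simp only [MonoidalCategory.whiskerLeft_comp] at e'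
    simp only [comp_whiskerRight, Category.assoc]
    rw [associator_naturality_middle_assoc, e']
    monoidal

/-- By the hexagon identity, moving one factor past a block is a chain of adjacent swaps. The right
unitor supplies the unit that ends the tensor product over `[i]`. -/
theorem isPerm_braiding_one (i : ι) (m : List ι) :
    ∃ f : tensorList X (i :: m) ⟶ tensorList X (m ++ [i]), IsPerm X f ∧
      (β_ (X i) (tensorList X m)).hom ≫ tensorList X m ◁ (ρ_ (X i)).inv ≫ tensorAppend X m [i] =
        f := by
  induction m with
  | nil =>
    refine ⟨_, IsPerm.id _, ?_⟩
    change (β_ (X i) (𝟙_ V)).hom ≫ _ ◁ (ρ_ (X i)).inv ≫ (λ_ _).hom = 𝟙 _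
    rw [braiding_tensorUnit_right]
    monoidal
  | cons j m ih =>
    obtain ⟨f, hf, e⟩ := ih
    refine ⟨_, (IsPerm.swap i j m).comp (hf.cons j), ?_⟩
    rw [← e]
    change (β_ (X i) (X j ⊗ tensorList X m)).hom ≫ (X j ⊗ tensorList X m) ◁ (ρ_ (X i)).inv ≫
      (α_ _ _ _).hom ≫ X j ◁ tensorAppend X m [i] = _
    rw [BraidedCategory.braiding_tensor_right_hom, swapHead]
    monoidal

/-- The other hexagon identity lets the factors of `l` pass `m` one at a time, starting with the
last. -/
theorem isPerm_braiding (l m : List ι) :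
    ∃ f : tensorList X (l ++ m) ⟶ tensorList X (m ++ l), IsPerm X f ∧
      (β_ (tensorList X l) (tensorList X m)).hom ≫ tensorAppend X m l =
        tensorAppend X l m ≫ f := by
  induction l with
  | nil =>
    have : ∀ m : List ι, ∃ f : tensorList X m ⟶ tensorList X (m ++ []), IsPerm X f ∧
        (ρ_ (tensorList X m)).inv ≫ tensorAppend X m [] = f := by
      intro m
      induction m with
      | nil =>
        refine ⟨_, IsPerm.id _, ?_⟩
        change (ρ_ (𝟙_ V)).inv ≫ (λ_ (𝟙_ V)).hom = 𝟙 _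
        simp [unitors_equal]
      | cons j m ih =>
        obtain ⟨f, hf, e⟩ := ih
        refine ⟨_, hf.cons j, ?_⟩
        rw [← e]
        change (ρ_ (X j ⊗ tensorList X m)).inv ≫ (α_ _ _ _).hom ≫ X j ◁ tensorAppend X m [] = _
        monoidal
    obtain ⟨f, hf, e⟩ := this m
    refine ⟨f, hf, ?_⟩
    rw [← e]
    change (β_ (𝟙_ V) (tensorList X m)).hom ≫ _ = (λ_ _).hom ≫ _
    simp
  | cons i l ih =>
    obtain ⟨f, hf, e⟩ := ih
    obtain ⟨g, hg, e'⟩ := isPerm_braiding_one (X := X) i m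
    obtain ⟨h, hh, e''⟩ := hg.append_right l
    obtain ⟨k, hk, e3⟩ := isPerm_tensorAppend_assoc (X := X) m [i] l
    refine ⟨_, ((hf.cons i).comp hh).comp hk, ?_⟩
    have e4 : X i ◁ tensorAppend X m l ≫ h =
        (α_ _ _ _).inv ≫ g ▷ tensorList X l ≫ tensorAppend X (m ++ [i]) l := by
      rw [e'', Iso.eq_inv_comp]
      exact (Category.assoc _ _ _).symm
    change _ = ((α_ _ _ _).hom ≫ X i ◁ tensorAppend X l m) ≫ (X i ◁ f ≫ h) ≫ k
    have e5 : (tensorList X m ◁ (ρ_ (X i)).inv ≫ tensorAppend X m [i]) ▷ tensorList X l ≫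
        tensorAppend X (m ++ [i]) l ≫ k = (α_ _ _ _).hom ≫ tensorAppend X m (i :: l) := by
      rw [comp_whiskerRight_assoc, e3]
      change _ ≫ _ ≫ tensorList X m ◁ ((α_ _ _ _).hom ≫ X i ◁ (λ_ _).hom) ≫ _ = _
      monoidal
    simp only [Category.assoc]
    rw [← MonoidalCategory.whiskerLeft_comp_assoc, ← e, MonoidalCategory.whiskerLeft_comp_assoc,
      reassoc_of% e4, ← e', comp_whiskerRight_assoc, e5,
      BraidedCategory.braiding_tensor_left_hom]
    simp only [Category.assoc]

/-- A permutation of blocks becomes a permutation of the individual factors after flattening. The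
only substantial case is an adjacent swap, which is a braiding of two blocks. -/
theorem IsPerm.join {κ : Type*} {X : κ → V} (g : ι → List κ) {l l' : List ι}
    {f : tensorList (fun i => tensorList X (g i)) l ⟶ tensorList (fun i => tensorList X (g i)) l'}
    (hf : IsPerm (fun i => tensorList X (g i)) f) :
    ∃ f' : tensorList X (l.flatMap g) ⟶ tensorList X (l'.flatMap g), IsPerm X f' ∧
      f ≫ tensorJoin X g l' = tensorJoin X g l ≫ f' := by
  induction hf with
  | id l => exact ⟨_, IsPerm.id _, by simp⟩
  | comp _ _ h h' =>
    obtain ⟨g, hg, e⟩ := h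
    obtain ⟨g', hg', e'⟩ := h'
    exact ⟨_, hg.comp hg', by rw [Category.assoc, e', reassoc_of% e]⟩
  | cons i _ h =>
    obtain ⟨k, hk, e⟩ := h
    obtain ⟨k', hk', e'⟩ := hk.append_left (g i)
    refine ⟨k', hk', ?_⟩
    simp only [tensorJoin, Category.assoc]
    rw [← e', ← MonoidalCategory.whiskerLeft_comp_assoc, ← MonoidalCategory.whiskerLeft_comp_assoc,
      e]
  | swap i j l =>
    obtain ⟨b, hb, eb⟩ := isPerm_braiding (X := X) (g i) (g j)
    obtain ⟨b', hb', eb'⟩ := hb.append_right (l.flatMap g)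
    obtain ⟨k, hk, ek⟩ := isPerm_tensorAppend_assoc (X := X) (g j) (g i) (l.flatMap g)
    obtain ⟨m, hm, em⟩ := isPerm_tensorAppend_assoc (X := X) (g i) (g j) (l.flatMap g)
    -- The first two blocks have to be grouped together before they are braided, which is the
    -- inverse of the reassociation `m`.
    obtain ⟨m', hm', e1, e2⟩ := hm.exists_inv
    refine ⟨m' ≫ b' ≫ k, hm'.comp (hb'.comp hk), ?_⟩
    simp only [tensorJoin, Category.assoc, MonoidalCategory.whiskerLeft_comp]
    have h1 : tensorList X (g i) ◁ tensorAppend X (g j) (l.flatMap g) ≫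
        tensorAppend X (g i) (g j ++ l.flatMap g) ≫ m' ≫ b' ≫ k =
        swapHead _ _ _ ≫ tensorList X (g j) ◁ tensorAppend X (g i) (l.flatMap g) ≫
          tensorAppend X (g j) (g i ++ l.flatMap g) := by
      rw [swapHead, Category.assoc, Category.assoc, ← ek, ← comp_whiskerRight_assoc, eb,
        comp_whiskerRight_assoc, reassoc_of% eb', ← cancel_epi (α_ _ _ _).hom,
        ← reassoc_of% em, reassoc_of% e1, Iso.hom_inv_id_assoc]
    refine Eq.trans ?_ (congrArg (fun f => tensorList X (g i) ◁ tensorList X (g j) ◁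
      tensorJoin X g l ≫ f) h1).symm
    exact ((reassoc_of% (swapHead_natural_right (tensorList X (g i)) (tensorList X (g j))
      (tensorJoin X g l))) _).symm

/-- The companion of `IsPerm.join`: here the reordering takes place within each block. -/
theorem IsPerm.tensorMap_join {κ : Type*} {X : κ → V} {g g' : ι → List κ}
    {f : ∀ i, tensorList X (g i) ⟶ tensorList X (g' i)} (hf : ∀ i, IsPerm X (f i)) (l : List ι) :
    ∃ f' : tensorList X (l.flatMap g) ⟶ tensorList X (l.flatMap g'), IsPerm X f' ∧
      tensorMap f l ≫ tensorJoin X g' l = tensorJoin X g l ≫ f' := by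
  induction l with
  | nil => exact ⟨_, IsPerm.id [], (Category.comp_id _).trans (Category.comp_id _).symm⟩
  | cons i l ih =>
    obtain ⟨h, hh, e⟩ := ih
    obtain ⟨h', hh', e'⟩ := hh.append_left (g' i)
    obtain ⟨k, hk, e''⟩ := (hf i).append_right (l.flatMap g)
    refine ⟨k ≫ h', hk.comp hh', ?_⟩
    simp only [tensorJoin, tensorMap, Category.assoc]
    rw [MonoidalCategory.tensorHom_def, Category.assoc, ← MonoidalCategory.whiskerLeft_comp_assoc,
      e, MonoidalCategory.whiskerLeft_comp_assoc, e', ← whisker_exchange_assoc,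
      reassoc_of% e'']

end Coherence

/-! ### Iterated multiplication in a monoid -/

section MulList

variable {V : Type u} [Category.{v} V] [MonoidalCategory V] {ι κ : Type*}

/-- The iterated multiplication `T ⊗ ⋯ ⊗ T ⟶ T` of a monoid `T`. -/
def mulList (T : V) [MonObj T] : ∀ l : List ι, tensorList (fun _ => T) l ⟶ T
  | [] => MonObj.one
  | _ :: l => T ◁ mulList T l ≫ MonObj.mul

variable (T : V) [MonObj T]

theorem mulList_comp {S T : V} [MonObj S] [MonObj T] (f : S ⟶ T) [IsMonHom f] (l : List ι) :
    mulList S l ≫ f = tensorMap (fun _ => f) l ≫ mulList T l := by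
  induction l with
  | nil => exact (IsMonHom.one_hom f).trans (Category.id_comp _).symm
  | cons i l ih =>
    simp only [mulList, tensorMap, Category.assoc]
    rw [IsMonHom.mul_hom, ← id_tensorHom, ← id_tensorHom, tensorHom_comp_tensorHom_assoc,
      tensorHom_comp_tensorHom_assoc, ih, Category.id_comp, Category.comp_id]

theorem relabel_mulList (f : ι → κ) (l : List ι) :
    (tensorRelabel (fun _ => T) f l).hom ≫ mulList T l = mulList T (l.map f) := by
  induction l with
  | nil => exact Category.id_comp _
  | cons i l ih =>
    change T ◁ (tensorRelabel (fun _ => T) f l).hom ≫ T ◁ mulList T l ≫ MonObj.mul =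
      T ◁ mulList T (l.map f) ≫ MonObj.mul
    rw [← ih, MonoidalCategory.whiskerLeft_comp_assoc]

theorem append_mulList (l m : List ι) :
    tensorAppend (fun _ => T) l m ≫ mulList T (l ++ m) =
      (mulList T l ⊗ₘ mulList T m) ≫ MonObj.mul := by
  induction l with
  | nil => exact (MonObj.one_mul_hom _).symm
  | cons i l ih =>
    change ((α_ _ _ _).hom ≫ T ◁ tensorAppend (fun _ => T) l m) ≫
        T ◁ mulList T (l ++ m) ≫ MonObj.mul =
      ((T ◁ mulList T l ≫ MonObj.mul) ⊗ₘ mulList T m) ≫ MonObj.mul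
    rw [Category.assoc, ← MonoidalCategory.whiskerLeft_comp_assoc, ih]
    rw [MonoidalCategory.whiskerLeft_comp_assoc, MonObj.mul_assoc_flip, ← id_tensorHom,
      ← associator_naturality_assoc, Iso.hom_inv_id_assoc, ← tensorHom_id, ← id_tensorHom,
      tensorHom_comp_tensorHom_assoc, Category.comp_id]

/-- Generalised associativity: `append_mulList` handles one block at a time. No commutativity is
involved, since the order of the factors is kept. -/
theorem join_mulList (g : ι → List κ) (l : List ι) :
    tensorJoin (fun _ => T) g l ≫ mulList T (l.flatMap g) =
      tensorMap (fun i => mulList T (g i)) l ≫ mulList T l := by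
  induction l with
  | nil => rfl
  | cons i l ih =>
    change (tensorList (fun _ => T) (g i) ◁ tensorJoin (fun _ => T) g l ≫
      tensorAppend (fun _ => T) (g i) (l.flatMap g)) ≫ mulList T (g i ++ l.flatMap g) =
      (mulList T (g i) ⊗ₘ tensorMap (fun i => mulList T (g i)) l) ≫ T ◁ mulList T l ≫ MonObj.mul
    rw [Category.assoc, append_mulList, ← id_tensorHom, ← id_tensorHom,
      tensorHom_comp_tensorHom_assoc, tensorHom_comp_tensorHom_assoc, ih, Category.id_comp,
      Category.comp_id]

theorem eqToHom_mulList {l l' : List ι} (h : l = l') :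
    eqToHom (congrArg (tensorList fun _ => T) h) ≫ mulList T l' = mulList T l := by
  subst h
  exact Category.id_comp _

/-- Reordering the factors within the blocks, multiplying each block, reordering the blocks and
multiplying them amounts to reordering all factors and multiplying them. -/
theorem tensorPerm_mulList_join [SymmetricCategory V] {κ : ι → Type*} [DecidableEq ι]
    [∀ i, DecidableEq (κ i)] {l l' : List ι} (hl : l.Nodup) (h : l.Perm l')
    {g g' : ∀ i, List (κ i)} (hg : ∀ i, (g i).Nodup) (h' : ∀ i, (g i).Perm (g' i))
    (h'' : (l.flatMap fun i => (g i).map (Sigma.mk i)).Perm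
      (l'.flatMap fun i => (g' i).map (Sigma.mk i))) :
    tensorMap (fun i => tensorPerm (fun _ => T) (g i) (g' i) (h' i) ≫ mulList T (g' i)) l ≫
        tensorPerm (fun _ => T) l l' h ≫ mulList T l' =
      tensorMap (fun i => (tensorRelabel (fun _ : Σ i, κ i => T) (Sigma.mk i) (g i)).inv) l ≫
        tensorJoin (fun _ : Σ i, κ i => T) (fun i => (g i).map (Sigma.mk i)) l ≫
        tensorPerm (fun _ : Σ i, κ i => T) _ _ h'' ≫ mulList T _ := by
  have hn : ∀ i, ((g i).map (Sigma.mk i)).Nodup := fun i => (hg i).map sigma_mk_injective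
  -- The factors of block `i` receive the labels `⟨i, x⟩`, so that labels from different blocks are
  -- distinct.
  have e1 : ∀ i, tensorPerm (fun _ => T) (g i) (g' i) (h' i) ≫ mulList T (g' i) =
      (tensorRelabel (fun _ : Σ i, κ i => T) (Sigma.mk i) (g i)).inv ≫
        tensorPerm (fun _ : Σ i, κ i => T) _ _ ((h' i).map (Sigma.mk i)) ≫
          mulList T ((g' i).map (Sigma.mk i)) := by
    intro i
    rw [Iso.eq_inv_comp, ← Category.assoc,
      tensorRelabel_tensorPerm (X := fun _ : Σ i, κ i => T) _ (hn i), Category.assoc,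
      relabel_mulList]
  simp only [e1]
  rw [tensorMap_comp, tensorMap_comp]
  simp only [Category.assoc]
  rw [← Category.assoc (tensorMap (fun i => mulList T _) l), tensorMap_tensorPerm _ hl,
    Category.assoc, ← join_mulList]
  -- The inner and the outer reordering both become permutations of the flattened list. By
  -- uniqueness their composite is the single reordering along `h''`.
  obtain ⟨f, hf, e⟩ := IsPerm.tensorMap_join
    (fun i => isPerm_tensorPerm (X := fun _ : Σ i, κ i => T) _ _ ((h' i).map (Sigma.mk i))) l
  obtain ⟨f', hf', e'⟩ := (isPerm_tensorPerm
    (X := fun i => tensorList (fun _ : Σ i, κ i => T) ((g' i).map (Sigma.mk i))) l l' h).join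
      (X := fun _ : Σ i, κ i => T) (fun i => (g' i).map (Sigma.mk i))
  rw [reassoc_of% e', reassoc_of% e, ← Category.assoc f f', (hf.comp hf').eq_tensorPerm]
  -- There remains the distinctness of the flattened list, which uniqueness requires.
  rw [List.nodup_flatMap]
  refine ⟨fun i _ => hn i, hl.imp fun {i j} h => ?_⟩
  simp only [Function.onFun, List.disjoint_left, List.mem_map]
  rintro _ ⟨x, _, rfl⟩ ⟨y, _, hy⟩
  exact h (congrArg Sigma.fst hy).symm

end MulList

/-! ### Algebras over a base change in terms of elements -/

section PointLemmas

variable {M : Type u} [Category.{v} M] [MonoidalCategory M]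

theorem point_tensor_comp {C D E T : M} (q : 𝟙_ M ⟶ C) (f : D ⟶ E) (g : C ⊗ E ⟶ T) :
    (q ⊗ₘ f) ≫ g = (λ_ D).hom ≫ f ≫ (λ_ E).inv ≫ q ▷ E ≫ g := by
  rw [← leftUnitor_naturality_assoc, Iso.hom_inv_id_assoc, MonoidalCategory.tensorHom_def',
    Category.assoc]

theorem point_whisker_comp {A C D E T : M} {p : 𝟙_ M ⟶ A} {φ : A ⟶ C} {q : 𝟙_ M ⟶ C}
    (h : p ≫ φ = q) (f : D ⟶ E) (g : C ⊗ E ⟶ T) :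
    p ▷ D ≫ (φ ⊗ₘ f) ≫ g = (λ_ D).hom ≫ f ≫ (λ_ E).inv ≫ q ▷ E ≫ g := by
  rw [← point_tensor_comp, ← h, ← tensorHom_id, tensorHom_comp_tensorHom_assoc, Category.id_comp]

/-- The points `p` and `q` occupy different factors, so `q` can be inserted before `p`; it then
turns `z` into `z'`. -/
theorem points_whisker_assoc {A B D S T : M} {p : 𝟙_ M ⟶ A} {q : 𝟙_ M ⟶ B} {z : B ⊗ D ⟶ S}
    {z' : D ⟶ S} (h : q ▷ D ≫ z = (λ_ D).hom ≫ z') (g : A ⊗ S ⟶ T) :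
    ((λ_ (𝟙_ M)).inv ≫ (p ⊗ₘ q)) ▷ D ≫ (α_ A B D).hom ≫ A ◁ z ≫ g =
      (λ_ D).hom ≫ z' ≫ (λ_ S).inv ≫ p ▷ S ≫ g := by
  have e : ((λ_ (𝟙_ M)).inv ≫ (p ⊗ₘ q)) ▷ D ≫ (α_ A B D).hom ≫ A ◁ z =
      (λ_ (𝟙_ M)).inv ▷ D ≫ (α_ _ _ _).hom ≫ 𝟙_ M ◁ (q ▷ D ≫ z) ≫ p ▷ S := by
    rw [whisker_exchange]
    simp only [MonoidalCategory.whiskerLeft_comp, comp_whiskerRight, MonoidalCategory.tensorHom_def,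
      Category.assoc]
    monoidal
  rw [reassoc_of% e, h]
  simp

/-- This extracts from an associativity axiom its form for single operations: `r` is the composite
of `p` and `q`, and `z'` is the joint action of the operations in `q`. -/
theorem points_assoc {A B C D E S T : M} {p : 𝟙_ M ⟶ A} {q : 𝟙_ M ⟶ B} {r : 𝟙_ M ⟶ C}
    {γ : A ⊗ B ⟶ C} {f : D ⟶ E} {g : C ⊗ E ⟶ T} {z : B ⊗ D ⟶ S} {g' : A ⊗ S ⟶ T} {z' : D ⟶ S}
    (h : (λ_ (𝟙_ M)).inv ≫ (p ⊗ₘ q) ≫ γ = r) (h' : q ▷ D ≫ z = (λ_ D).hom ≫ z')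
    (H : (α_ A B D).inv ≫ (γ ⊗ₘ f) ≫ g = A ◁ z ≫ g') :
    f ≫ (λ_ E).inv ≫ r ▷ E ≫ g = z' ≫ (λ_ S).inv ≫ p ▷ S ≫ g' := by
  rw [← cancel_epi (λ_ D).hom, ← points_whisker_assoc h' g', ← H, Iso.hom_inv_id_assoc,
    point_whisker_comp ((Category.assoc _ _ _).trans h)]

/-- The converse of `points_assoc`: compatibility for single operations gives the axiom tested at
the points `p` and `q`. -/
theorem points_assoc_of_comp {A B C D E S T : M} {p : 𝟙_ M ⟶ A} {q : 𝟙_ M ⟶ B} {r : 𝟙_ M ⟶ C}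
    {γ : A ⊗ B ⟶ C} {f : D ⟶ E} {g : C ⊗ E ⟶ T} {z : B ⊗ D ⟶ S} {g' : A ⊗ S ⟶ T} {z' : D ⟶ S}
    (h : (λ_ (𝟙_ M)).inv ≫ (p ⊗ₘ q) ≫ γ = r) (h' : q ▷ D ≫ z = (λ_ D).hom ≫ z')
    {k : E ⟶ T} {k' : S ⟶ T} (hk : r ▷ E ≫ g = (λ_ E).hom ≫ k)
    (hk' : p ▷ S ≫ g' = (λ_ S).hom ≫ k') (H : f ≫ k = z' ≫ k') :
    ((λ_ (𝟙_ M)).inv ≫ (p ⊗ₘ q)) ▷ D ≫ (γ ⊗ₘ f) ≫ g =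
      ((λ_ (𝟙_ M)).inv ≫ (p ⊗ₘ q)) ▷ D ≫ (α_ A B D).hom ≫ A ◁ z ≫ g' := by
  rw [points_whisker_assoc h', point_whisker_comp ((Category.assoc _ _ _).trans h), hk, hk',
    Iso.inv_hom_id_assoc, Iso.inv_hom_id_assoc, H]

/-- Separation is defined with the points in the right-hand factor; the braiding carries it to the
left-hand one, where operations stand in the structure maps. -/
theorem SeparatingPoints.hom_ext_whiskerRight [SymmetricCategory M] {S : Type*} {X Y T : M}
    {p : S → (𝟙_ M ⟶ X)} (hp : SeparatingPoints p) {g h : X ⊗ Y ⟶ T}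
    (H : ∀ s, p s ▷ Y ≫ g = p s ▷ Y ≫ h) : g = h := by
  rw [← cancel_epi (β_ Y X).hom]
  refine hp _ _ _ _ fun s => ?_
  rw [BraidedCategory.braiding_naturality_right_assoc,
    BraidedCategory.braiding_naturality_right_assoc, H]

/-- Restricted to points, the interchanges in `tensorZip` only braid unit objects, and these
braidings are trivial. -/
theorem tensorPoint_whiskerRight_zip [SymmetricCategory M] {ι : Type*} {X Y : ι → M}
    (p : ∀ i, 𝟙_ M ⟶ X i) (l : List ι) :
    tensorPoint p l ▷ tensorList Y l ≫ tensorZip X Y l =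
      (λ_ (tensorList Y l)).hom ≫ tensorMap (fun i => (λ_ (Y i)).inv ≫ p i ▷ Y i) l := by
  induction l with
  | nil =>
    change 𝟙 (𝟙_ M) ▷ 𝟙_ M ≫ (λ_ (𝟙_ M)).hom = (λ_ (𝟙_ M)).hom ≫ 𝟙 _
    simp
  | cons i l ih =>
    simp only [tensorPoint, tensorZip, tensorMap]
    have h : (λ_ (𝟙_ M)).inv ▷ (Y i ⊗ tensorList Y l) ≫
        tensorμ (𝟙_ M) (𝟙_ M) (Y i) (tensorList Y l) =
        (λ_ _).hom ≫ ((λ_ (Y i)).inv ⊗ₘ (λ_ (tensorList Y l)).inv) := by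
      simp only [tensorμ, braiding_tensorUnit_left]
      monoidal
    rw [comp_whiskerRight_assoc, tensorμ_natural_left_assoc, reassoc_of% h, ← id_tensorHom,
      tensorHom_comp_tensorHom, tensorHom_comp_tensorHom, ih, Category.comp_id,
      Iso.inv_hom_id_assoc]

theorem tensorPoint_zip_map [SymmetricCategory M] {ι : Type*} {X Y Z : ι → M}
    {p : ∀ i, 𝟙_ M ⟶ X i} {f : ∀ i, X i ⊗ Y i ⟶ Z i} {k : ∀ i, Y i ⟶ Z i}
    (h : ∀ i, p i ▷ Y i ≫ f i = (λ_ (Y i)).hom ≫ k i) (l : List ι) :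
    tensorPoint p l ▷ tensorList Y l ≫ tensorZip X Y l ≫ tensorMap f l =
      (λ_ (tensorList Y l)).hom ≫ tensorMap k l := by
  rw [reassoc_of% (tensorPoint_whiskerRight_zip (Y := Y) p l), ← tensorMap_comp]
  simp only [Category.assoc, h, Iso.inv_hom_id_assoc]

end PointLemmas

/-! ### Algebras over a base change as actions of single operations -/

section PointwiseAlgebra

variable {M : Type u} [Category.{v} M] [MonoidalCategory M] [SymmetricCategory M]
  [MonoidalClosed M] [HasCoproducts.{v} M] {K : Type w} {O : SetOperad.{v} K}

namespace OperadAlgebra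

/-- The action of an operation `o ∈ O(t; a)` on an algebra over `O ⊗ I`. -/
def opAct (A : OperadAlgebra (O.baseChange : ColoredOperad K M)) {t : K} {a : Profile K}
    (o : (O.obj t).obj a) : tensorFin (fun i => A.carrier (a.color i)) ⟶ A.carrier t :=
  (λ_ _).inv ≫ pt o ▷ _ ≫ A.act t a

variable (A : OperadAlgebra (O.baseChange : ColoredOperad K M))

theorem pt_act {t : K} {a : Profile K} (o : (O.obj t).obj a) :
    pt o ▷ _ ≫ A.act t a = (λ_ _).hom ≫ A.opAct o :=
  (Iso.hom_inv_id_assoc _ _).symm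

theorem opAct_map {t : K} {a : Profile K} (σ : Equiv.Perm (Fin a.len)) (o : (O.obj t).obj a) :
    tensorFinPerm σ (fun i => A.carrier (a.color i)) ≫
      A.opAct ((O.obj t).map (a.toPermute σ) o) = A.opAct o := by
  rw [← cancel_epi (λ_ _).hom, ← pt_act, ← A.equivariance t a σ]
  exact (point_whisker_comp (pt_map (M := M) ((O.obj t).map (a.toPermute σ)) o) _
    (A.act t (a.permute σ))).symm

theorem pt_zip_act {a : Profile K} {b : Fin a.len → Profile K}
    (p : ∀ i, (O.obj (a.color i)).obj (b i)) :
    tensorPoint (fun i => pt (M := M) (p i)) (List.finRange a.len) ▷ _ ≫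
        tensorZip _ _ _ ≫ tensorMap (fun i => A.act (a.color i) (b i)) _ =
      (λ_ _).hom ≫ tensorMap (fun i => A.opAct (p i)) _ :=
  tensorPoint_zip_map (fun i => A.pt_act (p i)) _

theorem opAct_γ {t : K} {a : Profile K} {b : Fin a.len → Profile K} (o : (O.obj t).obj a)
    (p : ∀ i, (O.obj (a.color i)).obj (b i)) :
    tensorFlat b (fun i j => A.carrier ((b i).color j)) ≫ A.opAct (O.γ o p) =
      tensorMap (fun i => A.opAct (p i)) _ ≫ A.opAct o :=
  points_assoc (O.pt_baseγ (M := M) t a b o p) (A.pt_zip_act p) (A.assoc t a b)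

theorem opAct_one (t : K) : tensorFinOne (fun _ => A.carrier t) ≫ A.opAct (O.one t) = 𝟙 _ := by
  rw [← cancel_epi (λ_ _).hom, Category.comp_id]
  exact (point_tensor_comp _ _ _).symm.trans (A.unit t)

theorem pt_braiding_distDesc {S : Type v} {Y T : M} (op : S → (Y ⟶ T)) (s : S) :
    pt (M := M) s ▷ Y ≫ (β_ _ _).hom ≫ distDesc op = (λ_ _).hom ≫ op s := by
  rw [BraidedCategory.braiding_naturality_left_assoc]
  refine (congrArg ((β_ _ _).hom ≫ ·) (ι_distDesc op s)).trans ?_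
  simp

/-- The algebra over `O ⊗ I` given by the actions of the operations. -/
def ofOp (carrier : K → M)
    (op : ∀ {t : K} {a : Profile K}, (O.obj t).obj a →
      (tensorFin (fun i => carrier (a.color i)) ⟶ carrier t))
    (op_map : ∀ {t : K} {a : Profile K} (σ : Equiv.Perm (Fin a.len)) (o : (O.obj t).obj a),
      tensorFinPerm σ (fun i => carrier (a.color i)) ≫
        op ((O.obj t).map (a.toPermute σ) o) = op o)
    (op_γ : ∀ {t : K} {a : Profile K} {b : Fin a.len → Profile K} (o : (O.obj t).obj a)
      (p : ∀ i, (O.obj (a.color i)).obj (b i)),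
      tensorFlat b (fun i j => carrier ((b i).color j)) ≫ op (O.γ o p) =
        tensorMap (fun i => op (p i)) _ ≫ op o)
    (op_one : ∀ t : K, tensorFinOne (fun _ => carrier t) ≫ op (O.one t) = 𝟙 _) :
    OperadAlgebra (O.baseChange : ColoredOperad K M) :=
  { carrier := carrier
    -- `distDesc` expects the copower on the right, hence the braiding.
    act := fun t a => (β_ _ _).hom ≫ distDesc op
    equivariance := fun t a σ => by
      refine (separatingPoints_pt _).hom_ext_whiskerRight fun o => ?_
      refine (point_whisker_comp (pt_map (M := M) ((O.obj t).map (a.toPermute σ)) o) _ _).trans ?_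
      refine Eq.trans ?_ (pt_braiding_distDesc op o).symm
      rw [← op_map σ o]
      refine congrArg (fun f => (λ_ _).hom ≫ tensorFinPerm σ _ ≫ f) ?_
      rw [Iso.inv_comp_eq]
      exact pt_braiding_distDesc _ _
    assoc := fun t a b => by
      rw [Iso.inv_comp_eq]
      -- Only the objects of operations are tested at points; the factors taken from the carriers
      -- stay untouched.
      refine ((separatingPoints_pt _).tensor
        (separatingPoints_tensorFin fun i => separatingPoints_pt _)).hom_ext_whiskerRight ?_
      rintro ⟨o, p⟩
      exact points_assoc_of_comp (O.pt_baseγ (M := M) t a b o p)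
        (tensorPoint_zip_map (fun i => pt_braiding_distDesc op (p i)) _)
        (pt_braiding_distDesc _ _) (pt_braiding_distDesc _ _) (op_γ o p)
    unit := fun t => by
      refine (point_tensor_comp _ _ _).trans ?_
      refine (congrArg (fun f => (λ_ _).hom ≫ f) (Eq.trans ?_ (op_one t))).trans
        (Category.comp_id _)
      refine congrArg (fun f => tensorFinOne _ ≫ f) ?_
      rw [Iso.inv_comp_eq]
      exact pt_braiding_distDesc _ _ }

theorem opAct_ofOp (carrier : K → M)
    (op : ∀ {t : K} {a : Profile K}, (O.obj t).obj a →
      (tensorFin (fun i => carrier (a.color i)) ⟶ carrier t)) (h₁ h₂ h₃) {t : K} {a : Profile K}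
    (o : (O.obj t).obj a) : (ofOp carrier op h₁ h₂ h₃).opAct o = op o := by
  exact (Iso.inv_comp_eq _).2 (pt_braiding_distDesc _ _)

/-- Points separate, so the actions of single operations determine the structure maps. -/
theorem ext_of_opAct {A B : OperadAlgebra (O.baseChange : ColoredOperad K M)}
    (h : A.carrier = B.carrier)
    (h' : ∀ {t : K} {a : Profile K} (o : (O.obj t).obj a), HEq (A.opAct o) (B.opAct o)) :
    A = B := by
  refine ext_of_act h fun t a => ?_
  -- These relations are recorded before the algebras are taken apart to identify their carriers.
  have hA := fun o => A.pt_act (t := t) (a := a) o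
  have hB := fun o => B.pt_act (t := t) (a := a) o
  obtain ⟨c, x, _, _, _⟩ := A
  obtain ⟨c', y, _, _, _⟩ := B
  obtain rfl : c = c' := h
  refine heq_of_eq ((separatingPoints_pt _).hom_ext_whiskerRight fun o => ?_)
  refine (hA o).trans (Eq.trans ?_ (hB o).symm)
  exact congrArg ((λ_ _).hom ≫ ·) (eq_of_heq (h' o))

theorem comm_of_opAct {A B : OperadAlgebra (O.baseChange : ColoredOperad K M)}
    {f : ∀ t, A.carrier t ⟶ B.carrier t}
    (h : ∀ {t : K} {a : Profile K} (o : (O.obj t).obj a),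
      tensorMap (fun i => f (a.color i)) _ ≫ B.opAct o = A.opAct o ≫ f t) (t : K)
    (a : Profile K) :
    ((O.baseChange (M := M)).obj t).obj a ◁ tensorMap (fun i => f (a.color i)) _ ≫ B.act t a =
      A.act t a ≫ f t := by
  refine (separatingPoints_pt _).hom_ext_whiskerRight fun o => ?_
  refine Eq.trans ?_ ((congrArg (· ≫ f t) (A.pt_act o)).symm.trans (Category.assoc _ _ _))
  rw [Category.assoc, ← h, ← leftUnitor_naturality_assoc]
  refine (whisker_exchange_assoc _ _ _).symm.trans ?_
  exact congrArg (_ ≫ ·) (B.pt_act o)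

theorem Hom.opAct_comm {A B : OperadAlgebra (O.baseChange : ColoredOperad K M)} (f : Hom A B)
    {t : K} {a : Profile K} (o : (O.obj t).obj a) :
    tensorMap (fun i => f.app (a.color i)) _ ≫ B.opAct o = A.opAct o ≫ f.app t := by
  rw [← cancel_epi (λ_ _).hom, ← leftUnitor_naturality_assoc, ← Category.assoc (λ_ _).hom,
    ← pt_act, ← pt_act]
  refine (whisker_exchange_assoc _ _ _).trans ((congrArg (_ ≫ ·) (f.comm t a)).trans ?_)
  exact (Category.assoc _ _ _).symm

end OperadAlgebra

end PointwiseAlgebra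

/-! ### The algebra of a functor with values in monoids -/

section MonAlgebra

/-- After the multiplication the target list no longer occurs in the codomain, so equal lists can be
exchanged without an `eqToHom`. -/
theorem tensorPerm_mulList_congr {V : Type u} [Category.{v} V] [MonoidalCategory V]
    [SymmetricCategory V] {ι : Type*} [DecidableEq ι] (T : V) [MonObj T] {l l' l'' : List ι}
    (h : l.Perm l') (h' : l.Perm l'') (e : l' = l'') :
    tensorPerm (fun _ => T) l l' h ≫ mulList T l' =
      tensorPerm (fun _ => T) l l'' h' ≫ mulList T l'' := by
  subst e
  rfl

theorem eqToHom_tensorPerm {V : Type u} [Category.{v} V] [MonoidalCategory V]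
    [SymmetricCategory V] {ι : Type*} [DecidableEq ι] (X : ι → V) {l₀ l l' : List ι}
    (e : l₀ = l) (h : l.Perm l') :
    eqToHom (congrArg (tensorList X) e) ≫ tensorPerm X l l' h = tensorPerm X l₀ l' (e ▸ h) := by
  subst e
  exact Category.id_comp _

theorem tensorFlat_natural {V : Type u} [Category.{v} V] [MonoidalCategory V] {K : Type*} {m : ℕ}
    (b : Fin m → Profile K) {W W' : ∀ i, Fin (b i).len → V} (φ : ∀ i j, W i j ⟶ W' i j) :
    tensorMap (fun i => tensorMap (φ i) _) _ ≫ tensorFlat b W' =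
      tensorFlat b W ≫
        tensorMap (fun q => φ ((Profile.slot b).symm q).1 ((Profile.slot b).symm q).2) _ := by
  let ψ : ∀ y : Σ i, Fin (b i).len, W y.1 y.2 ⟶ W' y.1 y.2 := fun y => φ y.1 y.2
  have h1 : ∀ i, tensorMap (φ i) (List.finRange (b i).len) ≫
      (tensorRelabel (fun y : Σ i, Fin (b i).len => W' y.1 y.2) (Sigma.mk i) _).inv =
      (tensorRelabel (fun y : Σ i, Fin (b i).len => W y.1 y.2) (Sigma.mk i) _).inv ≫
        tensorMap ψ _ := fun i => by
    rw [Iso.eq_inv_comp, ← Category.assoc, Iso.comp_inv_eq]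
    exact (tensorMap_relabel ψ (Sigma.mk i) _).symm
  have h2 : ∀ {l l' : List (Σ i, Fin (b i).len)} (e : l = l'), tensorMap ψ l ≫
      eqToHom (congrArg (tensorList fun y : Σ i, Fin (b i).len => W' y.1 y.2) e) =
      eqToHom (congrArg (tensorList fun y : Σ i, Fin (b i).len => W y.1 y.2) e) ≫
        tensorMap ψ l' := by
    rintro l _ rfl
    simp
  have h3 := tensorJoin_natural ψ (fun i => (List.finRange (b i).len).map (Sigma.mk i))
    (List.finRange m)
  have h4 := tensorMap_relabel ψ (Profile.slot b).symm (List.finRange (Profile.concat b).len)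
  rw [tensorFlat, tensorFlat, ← Category.assoc, ← tensorMap_comp]
  simp only [h1]
  rw [tensorMap_comp]
  simp only [Category.assoc]
  rw [reassoc_of% h3, reassoc_of% (h2 (flatMap_finRange_eq b)), h4]

variable {C : Type w} [Category.{v} C]

/-- Both lists have the same entries without repetition, and both are strictly increasing for the
order that the composite permutation induces on slots. Hence they are equal. -/
theorem OCOp.comp_perm_symm_list {t : C} {a : Profile C} {b : Fin a.len → Profile C}
    (o : OCOp a t) (p : ∀ i, OCOp (b i) (a.color i)) :
    ((List.finRange a.len).map o.perm.symm).flatMap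
        (fun i => ((List.finRange (b i).len).map (p i).perm.symm).map (Sigma.mk i)) =
      ((List.finRange (Profile.concat b).len).map (comp o p).perm.symm).map
        (Profile.slot b).symm := by
  refine List.Perm.eq_of_pairwise (le := fun x y =>
    (comp o p).perm (Profile.slot b x) < (comp o p).perm (Profile.slot b y)) ?_ ?_ ?_ ?_
  · intro x y _ _ h h'
    exact absurd h' h.asymm
  · rw [List.pairwise_flatMap]
    refine ⟨fun i _ => ?_, ?_⟩
    · rw [List.pairwise_map, List.pairwise_map]
      refine (List.pairwise_lt_finRange _).imp fun {x y} h => ?_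
      rw [comp_perm_lt_iff]
      exact Or.inr ⟨rfl, by simpa using h⟩
    · rw [List.pairwise_map]
      refine (List.pairwise_lt_finRange _).imp fun {i j} h => ?_
      simp only [List.mem_map]
      rintro _ ⟨x, _, rfl⟩ _ ⟨y, _, rfl⟩
      rw [comp_perm_lt_iff]
      exact Or.inl (by simpa using h)
  · rw [List.pairwise_map, List.pairwise_map]
    refine (List.pairwise_lt_finRange _).imp fun {x y} h => ?_
    simpa using h
  · rw [List.perm_ext_iff_of_nodup]
    · rintro ⟨i, x⟩
      simp only [List.mem_flatMap, List.mem_finRange, List.mem_map, true_and]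
      refine ⟨fun _ => ⟨Profile.slot b ⟨i, x⟩, ⟨(comp o p).perm (Profile.slot b ⟨i, x⟩), by simp⟩,
        by simp⟩, fun _ => ⟨i, ⟨o.perm i, by simp⟩, x, ⟨(p i).perm x, by simp⟩, rfl⟩⟩
    · rw [List.nodup_flatMap]
      refine ⟨fun i _ => ((List.nodup_finRange _).map (Equiv.injective _)).map
        sigma_mk_injective, ?_⟩
      refine ((List.nodup_finRange _).map (Equiv.injective _)).imp fun {i j} h => ?_
      simp only [Function.onFun, List.disjoint_left, List.mem_map]
      rintro _ ⟨x, _, rfl⟩ ⟨y, _, hy⟩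
      exact h (congrArg Sigma.fst hy).symm
    · exact ((List.nodup_finRange _).map (Equiv.injective _)).map (Equiv.injective _)

variable {M : Type u} [Category.{v} M] [MonoidalCategory M] [SymmetricCategory M]

/-- The action `x_1 ⊗ ⋯ ⊗ x_n ↦ f_{σ⁻¹(1)} x_{σ⁻¹(1)} ⋯ f_{σ⁻¹(n)} x_{σ⁻¹(n)}` of an operation
`(σ, f)` of `O_C` on a functor from `C` to monoids. -/
def monAct (F : C ⥤ Mon M) {t : C} {a : Profile C} (o : OCOp a t) :
    tensorFin (fun i => (F.obj (a.color i)).X) ⟶ (F.obj t).X :=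
  tensorMap (fun i => (F.map (o.hom i)).hom) _ ≫
    tensorPerm (fun _ => (F.obj t).X) _ _ (finRange_perm_map o.perm.symm) ≫
      mulList (F.obj t).X _

variable (F : C ⥤ Mon M)

/-- All reorderings merge into one by coherence, so only the resulting order of the factors has to
be compared. -/
theorem monAct_act {t : C} {a : Profile C} (σ : Equiv.Perm (Fin a.len)) (o : OCOp a t) :
    tensorFinPerm σ (fun i => (F.obj (a.color i)).X) ≫ monAct F (o.act (a.toPermute σ)) =
      monAct F o := by
  have e : ∀ j, (o.act (a.toPermute σ)).hom j = o.hom (σ j) := fun j => Category.id_comp _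
  have h := tensorMap_relabel (X := fun i => (F.obj (a.color i)).X) (Y := fun _ => (F.obj t).X)
    (fun i => (F.map (o.hom i)).hom) σ (List.finRange a.len)
  have hn := (List.nodup_finRange a.len).map σ.injective
  -- The permuted operation carries `o.perm ∘ σ`; applying `σ` to its inverse gives `o.perm⁻¹`.
  have hl : ((List.finRange a.len).map (o.act (a.toPermute σ)).perm.symm).map σ =
      (List.finRange a.len).map o.perm.symm := by
    rw [List.map_map]
    exact List.map_congr_left fun i _ => σ.apply_symm_apply _
  rw [monAct, monAct, tensorFinPerm]
  simp only [e, Category.assoc]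
  rw [← reassoc_of% h]
  rw [← Category.assoc (tensorRelabel _ _ _).hom,
    tensorRelabel_tensorPerm (X := fun _ => (F.obj t).X) σ hn, Category.assoc]
  rw [relabel_mulList, ← Category.assoc (tensorMap _ _), tensorMap_tensorPerm _ hn, Category.assoc,
    ← Category.assoc, tensorPerm_comp (List.nodup_finRange _), ← Category.assoc,
    ← tensorMap_tensorPerm _ (List.nodup_finRange _), Category.assoc]
  exact congrArg (_ ≫ ·) (tensorPerm_mulList_congr _ _ _ hl)

/-- `F.map g` is a homomorphism of monoids, so it moves through the product onto each factor, where
functoriality merges it with `F.map (o.hom i)`. -/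
theorem monAct_map {s t : C} {a : Profile C} (o : OCOp a s) (g : s ⟶ t) :
    monAct F o ≫ (F.map g).hom =
      tensorMap (fun i => (F.map (o.hom i ≫ g)).hom) _ ≫
        tensorPerm (fun _ => (F.obj t).X) _ _ (finRange_perm_map o.perm.symm) ≫
          mulList (F.obj t).X _ := by
  have e : (fun i => (F.map (o.hom i ≫ g)).hom) =
      fun i => (F.map (o.hom i)).hom ≫ (F.map g).hom := by
    funext i
    rw [F.map_comp]
    rfl
  rw [monAct, e, tensorMap_comp, Category.assoc, Category.assoc, mulList_comp,
    ← Category.assoc (tensorPerm _ _ _ _), ← tensorMap_tensorPerm _ (List.nodup_finRange _)]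
  simp only [Category.assoc]

theorem monAct_comp {t : C} {a : Profile C} {b : Fin a.len → Profile C}
    (o : OCOp a t) (p : ∀ i, OCOp (b i) (a.color i)) :
    tensorFlat b (fun i j => (F.obj ((b i).color j)).X) ≫ monAct F (OCOp.comp o p) =
      tensorMap (fun i => monAct F (p i)) _ ≫ monAct F o := by
  have h := tensorFlat_natural b (W := fun i j => (F.obj ((b i).color j)).X)
    (W' := fun _ _ => (F.obj t).X) fun i j => (F.map ((p i).hom j ≫ o.hom i)).hom
  have hp : ((List.finRange a.len).flatMap
      fun i => (List.finRange (b i).len).map (Sigma.mk i)).Perm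
      (((List.finRange a.len).map o.perm.symm).flatMap
        fun i => ((List.finRange (b i).len).map (p i).perm.symm).map (Sigma.mk i)) := by
    rw [OCOp.comp_perm_symm_list, flatMap_finRange_eq]
    exact (finRange_perm_map (OCOp.comp o p).perm.symm).map _
  have hc := tensorPerm_mulList_join (F.obj t).X (List.nodup_finRange a.len)
    (finRange_perm_map o.perm.symm) (fun i => List.nodup_finRange (b i).len)
    (fun i => finRange_perm_map (p i).perm.symm) hp
  have hs : (List.map (Profile.slot b).symm (List.finRange (Profile.concat b).len)).Nodup :=
    (List.nodup_finRange _).map (Equiv.injective _)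
  have hr := tensorRelabel_tensorPerm (X := fun _ => (F.obj t).X) (Profile.slot b).symm hs
    (finRange_perm_map (OCOp.comp o p).perm.symm)
  -- The outer maps `F.map (o.hom i)` are moved inside the inner products. All factors then lie in
  -- `F.obj t`, and what is left concerns one monoid.
  have hrhs : tensorMap (fun i => monAct F (p i)) _ ≫ monAct F o =
      tensorMap (fun i => tensorMap (fun j => (F.map ((p i).hom j ≫ o.hom i)).hom)
        (List.finRange (b i).len)) (List.finRange a.len) ≫
      tensorMap (fun i => tensorPerm (fun _ => (F.obj t).X) _ _
        (finRange_perm_map (p i).perm.symm) ≫ mulList (F.obj t).X _) _ ≫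
      tensorPerm (fun _ => (F.obj t).X) _ _ (finRange_perm_map o.perm.symm) ≫
          mulList (F.obj t).X _ := by
    rw [monAct, ← Category.assoc, ← tensorMap_comp]
    simp only [monAct_map]
    rw [tensorMap_comp, Category.assoc]
  rw [hrhs, hc]
  refine (reassoc_of% h.symm) _ |>.trans ?_
  -- Both sides begin with the maps of the composite morphisms; it remains to compare two ways of
  -- reordering and multiplying in the monoid at `t`.
  refine congrArg (_ ≫ ·) ?_
  rw [tensorFlat]
  simp only [Category.assoc]
  rw [reassoc_of% hr, relabel_mulList, ← Category.assoc (eqToHom _),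
    eqToHom_tensorPerm _ (flatMap_finRange_eq b)]
  refine congrArg (fun f => _ ≫ _ ≫ f) ?_
  exact tensorPerm_mulList_congr _ _ _ (OCOp.comp_perm_symm_list o p).symm

theorem monAct_one (t : C) :
    tensorFinOne (fun _ => (F.obj t).X) ≫ monAct F (OCOp.one t) = 𝟙 _ := by
  have h : tensorPerm (fun _ => (F.obj t).X) (List.finRange 1)
      ((List.finRange 1).map (Equiv.refl (Fin 1)).symm) (finRange_perm_map _) = 𝟙 _ :=
    tensorPerm_self (List.nodup_finRange 1) _
  have h' : ((F.map (𝟙 t)).hom ⊗ₘ 𝟙 (𝟙_ M)) = 𝟙 ((F.obj t).X ⊗ 𝟙_ M) := by simp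
  -- For a single factor the tensor product is `T ⊗ 𝟙` and the iterated product is multiplication by
  -- the unit, both by definition.
  have e := congrArg₂ (fun f g => (ρ_ (F.obj t).X).inv ≫ f ≫ g ≫
    (F.obj t).X ◁ MonObj.one ≫ MonObj.mul) h' h
  refine e.trans ?_
  rw [Iso.inv_comp_eq, Category.comp_id, MonObj.mul_one]
  exact (Category.id_comp _).trans (Category.id_comp _)

/-- The operation `(e, f)` of `O_C`. -/
abbrev OCOp.ofHom {t : C} {n : ℕ} {c : Fin n → C} (f : ∀ i, c i ⟶ t) : OCOp ⟨n, c⟩ t :=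
  ⟨Equiv.refl _, f⟩

theorem monAct_ofHom {t : C} {n : ℕ} {c : Fin n → C}
    (f : ∀ i, c i ⟶ t) :
    monAct F (OCOp.ofHom f) =
      tensorMap (fun i => (F.map (f i)).hom) _ ≫ mulList (F.obj t).X (List.finRange n) := by
  have e : (List.finRange n).map (Equiv.refl (Fin n)).symm = List.finRange n := by simp
  refine congrArg (_ ≫ ·) ((tensorPerm_mulList_congr _ _ (List.Perm.refl _) e).trans ?_)
  rw [tensorPerm_self (List.nodup_finRange _), Category.id_comp]

variable {F} in
theorem monAct_natural {G : C ⥤ Mon M} (α : F ⟶ G) {t : C} {a : Profile C} (o : OCOp a t) :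
    tensorMap (fun i => (α.app (a.color i)).hom) _ ≫ monAct G o =
      monAct F o ≫ (α.app t).hom := by
  have e : ∀ i, (α.app (a.color i)).hom ≫ (G.map (o.hom i)).hom =
      (F.map (o.hom i)).hom ≫ (α.app t).hom := fun i =>
    congrArg Mon.Hom.hom (α.naturality (o.hom i)).symm
  rw [monAct, monAct, ← Category.assoc, ← tensorMap_comp]
  simp only [e, Category.assoc]
  rw [tensorMap_comp, mulList_comp, ← Category.assoc (tensorPerm _ _ _ _),
    ← tensorMap_tensorPerm _ (List.nodup_finRange _)]
  simp only [Category.assoc]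

end MonAlgebra

/-! ### Equality of functors with values in monoids -/

section MonFunctor

variable {C : Type w} [Category.{v} C] {M : Type u} [Category.{v} M] [MonoidalCategory M]

/-- The units need no hypothesis: a multiplication has at most one two-sided unit, which is what
`MonObj.ext` expresses. -/
theorem mon_functor_ext {F G : C ⥤ Mon M} (h : ∀ t, (F.obj t).X = (G.obj t).X)
    (h₁ : ∀ t, HEq (MonObj.mul (X := (F.obj t).X)) (MonObj.mul (X := (G.obj t).X)))
    (h₂ : ∀ {s t : C} (f : s ⟶ t), HEq (F.map f).hom (G.map f).hom) : F = G := by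
  have e : ∀ {X Y : Mon M}, X.X = Y.X →
      HEq (MonObj.mul (X := X.X)) (MonObj.mul (X := Y.X)) → X = Y := by
    rintro ⟨X, _⟩ ⟨Y, _⟩ (rfl : X = Y) h
    exact congrArg (fun m => @Mon.mk _ _ _ X m) (MonObj.ext _ _ (eq_of_heq h))
  have e' : ∀ {X X' Y Y' : Mon M} (f : X ⟶ Y) (f' : X' ⟶ Y'), X = X' → Y = Y' →
      HEq f.hom f'.hom → HEq f f' := by
    rintro X _ Y _ f f' rfl rfl h
    exact heq_of_eq (Mon.Hom.ext (eq_of_heq h))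
  exact Functor.hext (fun t => e (h t) (h₁ t)) fun s t f =>
    e' _ _ (e (h s) (h₁ s)) (e (h t) (h₁ t)) (h₂ f)

end MonFunctor

/-! ### Tensor products over lists with the same entries -/

section Same

variable {V : Type u} [Category.{v} V] [MonoidalCategory V] {ι κ κ' : Type*}

/-- The relation that a morphism `⨂_l X ⟶ ⨂_{l'} Y` is the identity, factor by factor. -/
inductive IsSame (X : ι → V) (Y : κ → V) :
    ∀ {l : List ι} {l' : List κ}, (tensorList X l ⟶ tensorList Y l') → Prop
  | nil : IsSame X Y (l := []) (l' := []) (𝟙 (𝟙_ V))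
  | cons {i : ι} {k : κ} (h : X i = Y k) {l : List ι} {l' : List κ}
      {f : tensorList X l ⟶ tensorList Y l'} : IsSame X Y f →
      IsSame X Y (l := i :: l) (l' := k :: l') (eqToHom h ⊗ₘ f)

variable {X : ι → V} {Y : κ → V} {Z : κ' → V}

/-- Each factor is compared by the `eqToHom` of a proof of an equality of objects, and all such
proofs are equal. Bookkeeping isomorphisms can thus be identified without computing them. -/
theorem IsSame.unique {l : List ι} {l' : List κ} {f g : tensorList X l ⟶ tensorList Y l'}
    (hf : IsSame X Y f) (hg : IsSame X Y g) : f = g := by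
  induction hf with
  | nil =>
    cases hg
    rfl
  | cons h _ ih =>
    cases hg with
    | cons _ hg => rw [ih hg]

theorem IsSame.refl (l : List ι) : IsSame X X (𝟙 (tensorList X l)) := by
  induction l with
  | nil => exact IsSame.nil
  | cons i l ih => simpa using IsSame.cons (rfl : X i = X i) ih

theorem IsSame.eqToHom {l l' : List ι} (h : l = l') :
    IsSame X X (eqToHom (congrArg (tensorList X) h)) := by
  subst h
  exact IsSame.refl l

theorem IsSame.comp {l : List ι} {l' : List κ} {l'' : List κ'}
    {f : tensorList X l ⟶ tensorList Y l'} {g : tensorList Y l' ⟶ tensorList Z l''}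
    (hf : IsSame X Y f) (hg : IsSame Y Z g) : IsSame X Z (f ≫ g) := by
  induction hf generalizing l'' with
  | nil =>
    cases hg
    simpa using IsSame.nil
  | cons h _ ih =>
    cases hg with
    | cons h' hg => simpa using IsSame.cons (h.trans h') (ih hg)

theorem IsSame.relabel_hom (f : ι → κ) (l : List ι) :
    IsSame Y (fun i => Y (f i)) (tensorRelabel Y f l).hom := by
  induction l with
  | nil => exact IsSame.nil
  | cons i l ih =>
    simpa [tensorRelabel] using
      IsSame.cons (X := Y) (Y := fun i => Y (f i)) (i := f i) (k := i) rfl ih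

theorem IsSame.relabel_inv (f : ι → κ) (l : List ι) :
    IsSame (fun i => Y (f i)) Y (tensorRelabel Y f l).inv := by
  induction l with
  | nil => exact IsSame.nil
  | cons i l ih =>
    simpa [tensorRelabel] using
      IsSame.cons (X := fun i => Y (f i)) (Y := Y) (i := i) (k := f i) rfl ih

theorem IsSame.append {l m : List ι} {l' m' : List κ} {f : tensorList X l ⟶ tensorList Y l'}
    {g : tensorList X m ⟶ tensorList Y m'} (hf : IsSame X Y f) (hg : IsSame X Y g) :
    ∃ k : tensorList X (l ++ m) ⟶ tensorList Y (l' ++ m'), IsSame X Y k ∧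
      (f ⊗ₘ g) ≫ tensorAppend Y l' m' = tensorAppend X l m ≫ k := by
  induction hf with
  | nil =>
    refine ⟨g, hg, ?_⟩
    change (𝟙 (𝟙_ V) ⊗ₘ g) ≫ (λ_ _).hom = (λ_ _).hom ≫ g
    simp
  | @cons i j h l l' f _ ih =>
    obtain ⟨k, hk, e⟩ := ih
    refine ⟨_, hk.cons h, ?_⟩
    change ((CategoryTheory.eqToHom h ⊗ₘ f) ⊗ₘ g) ≫ (α_ _ _ _).hom ≫ Y j ◁ tensorAppend Y l' m' =
      ((α_ _ _ _).hom ≫ X i ◁ tensorAppend X l m) ≫ (CategoryTheory.eqToHom h ⊗ₘ k)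
    rw [associator_naturality_assoc, ← id_tensorHom, ← id_tensorHom, Category.assoc,
      tensorHom_comp_tensorHom, tensorHom_comp_tensorHom, e, Category.comp_id, Category.id_comp]

theorem IsSame.join {X : κ → V} {Y : κ' → V} {g : ι → List κ} {g' : ι → List κ'}
    {f : ∀ i, tensorList X (g i) ⟶ tensorList Y (g' i)} (hf : ∀ i, IsSame X Y (f i))
    (l : List ι) :
    ∃ k : tensorList X (l.flatMap g) ⟶ tensorList Y (l.flatMap g'), IsSame X Y k ∧
      tensorMap f l ≫ tensorJoin Y g' l = tensorJoin X g l ≫ k := by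
  induction l with
  | nil => exact ⟨_, IsSame.nil, rfl⟩
  | cons i l ih =>
    obtain ⟨k, hk, e⟩ := ih
    obtain ⟨k', hk', e'⟩ := (hf i).append hk
    refine ⟨k', hk', ?_⟩
    change (f i ⊗ₘ tensorMap f l) ≫ tensorList Y (g' i) ◁ tensorJoin Y g' l ≫ tensorAppend Y _ _ =
      (tensorList X (g i) ◁ tensorJoin X g l ≫ tensorAppend X _ _) ≫ k'
    rw [Category.assoc, ← e', ← id_tensorHom, ← id_tensorHom, tensorHom_comp_tensorHom_assoc,
      tensorHom_comp_tensorHom_assoc, e, Category.id_comp, Category.comp_id]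

theorem isSame_append_nil (X : ι → V) (l : List ι) :
    IsSame X X ((ρ_ (tensorList X l)).inv ≫ tensorAppend X l []) := by
  induction l with
  | nil =>
    have : (ρ_ (𝟙_ V)).inv ≫ (λ_ (𝟙_ V)).hom = 𝟙 _ := by simp [unitors_equal]
    have h := IsSame.nil (X := X) (Y := X)
    rw [← this] at h
    exact h
  | cons i l ih =>
    have : (ρ_ (X i ⊗ tensorList X l)).inv ≫ (α_ _ _ _).hom ≫ X i ◁ tensorAppend X l [] =
        eqToHom rfl ⊗ₘ ((ρ_ (tensorList X l)).inv ≫ tensorAppend X l []) := by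
      simp
    have h := IsSame.cons (rfl : X i = X i) ih
    rw [← this] at h
    exact h

/-- Flattening one or two blocks leaves a trailing empty list; this turns it into a right unitor. -/
theorem append_nil_eq (X : ι → V) (l : List ι) :
    tensorAppend X l [] =
      (ρ_ _).hom ≫ eqToHom (congrArg (tensorList X) (List.append_nil l).symm) := by
  rw [← Iso.inv_comp_eq]
  exact (isSame_append_nil X l).unique (IsSame.eqToHom (List.append_nil l).symm)

end Same

/-! ### The functor with values in monoids of an algebra -/

section AlgebraFunctor

variable {C : Type w} [Category.{v} C] {M : Type u} [Category.{v} M] [MonoidalCategory M]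
  [SymmetricCategory M] [MonoidalClosed M] [HasCoproducts.{v} M]

namespace OperadAlgebra

variable (A : OperadAlgebra ((OC C).baseChange : ColoredOperad C M))

/-- The action of an operation of `O_C` on an `O_C`-algebra. -/
def ocAct {t : C} {a : Profile C} (o : OCOp a t) :
    tensorFin (fun i => A.carrier (a.color i)) ⟶ A.carrier t :=
  A.opAct (O := OC C) o

theorem ocAct_act {t : C} {a : Profile C} (σ : Equiv.Perm (Fin a.len)) (o : OCOp a t) :
    tensorFinPerm σ (fun i => A.carrier (a.color i)) ≫ A.ocAct (o.act (a.toPermute σ)) =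
      A.ocAct o :=
  A.opAct_map (O := OC C) σ o

theorem ocAct_comp {t : C} {a : Profile C} {b : Fin a.len → Profile C} (o : OCOp a t)
    (p : ∀ i, OCOp (b i) (a.color i)) :
    tensorFlat b (fun i j => A.carrier ((b i).color j)) ≫ A.ocAct (OCOp.comp o p) =
      tensorMap (fun i => A.ocAct (p i)) _ ≫ A.ocAct o :=
  A.opAct_γ (O := OC C) o p

theorem ocAct_one (t : C) :
    tensorFinOne (fun _ => A.carrier t) ≫ A.ocAct (OCOp.one t) = 𝟙 _ :=
  A.opAct_one (O := OC C) t

end OperadAlgebra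

/-- Slots are enumerated lexicographically, and with identity permutations the composite permutation
orders them in the same way. -/
theorem OCOp.comp_ofHom {t : C} {m : ℕ} {s : Fin m → C} {n : Fin m → ℕ}
    {c : ∀ i, Fin (n i) → C} (g : ∀ i, s i ⟶ t) (f : ∀ i j, c i j ⟶ s i) :
    OCOp.comp (b := fun i => ⟨n i, c i⟩) (OCOp.ofHom g) (fun i => OCOp.ofHom (f i)) =
      OCOp.ofHom (fun q => f ((Profile.slot fun i => ⟨n i, c i⟩).symm q).1
        ((Profile.slot fun i => ⟨n i, c i⟩).symm q).2 ≫ g _) := by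
  refine ext_of_lt_iff (fun i j => ?_) fun i => rfl
  obtain ⟨x, rfl⟩ := (Profile.slot _).surjective i
  obtain ⟨y, rfl⟩ := (Profile.slot _).surjective j
  exact (comp_perm_lt_iff _ _ _ _).trans (Profile.slot_lt_iff _ _ _).symm

namespace OperadAlgebra

variable (A : OperadAlgebra ((OC C).baseChange : ColoredOperad C M)) {ι κ : Type*}

/-- The action of `(e, f)` on a tensor product over a list. -/
def listAct (l : List ι) {c : ι → C} {t : C} (f : ∀ i, c i ⟶ t) :
    tensorList (fun i => A.carrier (c i)) l ⟶ A.carrier t :=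
  eqToHom (congrArg (tensorList fun i => A.carrier (c i)) (by simp)) ≫
    (tensorRelabel (fun i => A.carrier (c i)) l.get (List.finRange l.length)).hom ≫
      A.ocAct (OCOp.ofHom fun i => f (l.get i))

variable {A}

/-- The enumeration by `l.get` in `listAct` is immaterial: an enumeration `φ` of `l` is forced to
agree with it, and so is the comparison `k`. -/
theorem listAct_of_isSame {l : List ι} {c : ι → C} {t : C} (f : ∀ i, c i ⟶ t) {n : ℕ}
    {φ : Fin n → ι} (h : l = (List.finRange n).map φ)
    {k : tensorList (fun i => A.carrier (c i)) l ⟶ tensorFin fun i => A.carrier (c (φ i))}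
    (hk : IsSame _ _ k) : k ≫ A.ocAct (OCOp.ofHom fun i => f (φ i)) = A.listAct l f := by
  have hn : n = l.length := by simp [h]
  subst hn
  have hφ : φ = l.get := by
    funext i
    have := congrArg (fun l => l[(i : ℕ)]?) h
    simpa using this.symm
  subst hφ
  rw [listAct, ← Category.assoc]
  congr 1
  exact hk.unique ((IsSame.eqToHom h).comp (IsSame.relabel_hom _ _))

theorem listAct_finRange {n : ℕ} {c : Fin n → C} {t : C} (f : ∀ i, c i ⟶ t) :
    A.listAct (List.finRange n) f = A.ocAct (OCOp.ofHom f) := by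
  rw [← listAct_of_isSame f (φ := fun i => i) (by simp) (IsSame.refl _), Category.id_comp]

theorem listAct_map (φ : ι → κ) (l : List ι) {c : κ → C} {t : C} (f : ∀ i, c i ⟶ t) :
    A.listAct (l.map φ) f = (tensorRelabel _ φ l).hom ≫ A.listAct l (fun i => f (φ i)) := by
  have h : (List.finRange l.length).map (fun i => φ (l.get i)) = l.map φ := by
    refine (List.map_map (f := l.get) (g := φ)).symm.trans ?_
    simp
  have h' : l = (List.finRange l.length).map l.get := by simp
  rw [listAct.eq_def A l, ← Category.assoc, ← Category.assoc]
  exact (listAct_of_isSame f h.symm (((IsSame.relabel_hom _ _).comp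
    (IsSame.eqToHom h')).comp (IsSame.relabel_hom (Y := fun i => A.carrier (c (φ i))) _ _))).symm

theorem listAct_eqToHom {l l' : List ι} (h : l = l') {c : ι → C} {t : C} (f : ∀ i, c i ⟶ t) :
    eqToHom (congrArg (tensorList _) h) ≫ A.listAct l' f = A.listAct l f := by
  subst h
  exact Category.id_comp _

/-- The composition axiom for the outer operation `(e, (g, …, g))`, rewritten over lists. The cases
of one and two blocks yield all that is needed about the monoids. -/
theorem listAct_join {m : ℕ} (ls : Fin m → List ι) {c : ι → C} {s t : C} (f : ∀ i, c i ⟶ s)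
    (g : s ⟶ t) :
    tensorMap (fun i => A.listAct (ls i) f) _ ≫
        A.listAct (List.finRange m) (c := fun _ => s) (fun _ => g) =
      tensorJoin (fun i => A.carrier (c i)) ls _ ≫
        A.listAct ((List.finRange m).flatMap ls) (fun i => f i ≫ g) := by
  let b : Fin m → Profile C := fun i => ⟨(ls i).length, fun j => c ((ls i).get j)⟩
  let ψ : (Σ i, Fin (b i).len) → ι := fun y => (ls y.1).get y.2
  have h := A.ocAct_comp (a := ⟨m, fun _ => s⟩) (b := b) (OCOp.ofHom fun _ => g)
    (fun i => OCOp.ofHom fun j => f ((ls i).get j))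
  have hm : (List.finRange m).flatMap ls =
      (List.finRange (Profile.concat b).len).map fun q => ψ ((Profile.slot b).symm q) := by
    have := congrArg (List.map ψ) (flatMap_finRange_eq b)
    rw [List.map_flatMap, List.map_map] at this
    rw [← Function.comp_def ψ, ← this]
    congr 1
    funext i
    rw [List.map_map]
    exact (show ls i = (List.finRange (ls i).length).map (ls i).get by simp)
  have hS := fun i => ((IsSame.eqToHom (X := fun i => A.carrier (c i))
      (show ls i = (List.finRange (ls i).length).map (ls i).get by simp)).comp
    (IsSame.relabel_hom _ _))
  -- The relabellings at the start of `tensorFlat` are moved past the flattening; they leave a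
  -- factorwise identity `k`, which `listAct_of_isSame` absorbs.
  obtain ⟨k, hk, e⟩ := IsSame.join (fun i => (hS i).comp (IsSame.relabel_inv
    (Y := fun y => A.carrier (c (ψ y))) (Sigma.mk i) (List.finRange (b i).len))) (List.finRange m)
  rw [← listAct_of_isSame (fun i => f i ≫ g) hm (hk.comp ((IsSame.eqToHom
    (flatMap_finRange_eq b)).comp (IsSame.relabel_hom (Profile.slot b).symm _))),
    listAct_finRange]
  rw [OCOp.comp_ofHom] at h
  rw [tensorMap_comp] at e
  rw [Category.assoc, ← reassoc_of% e]
  simp only [Category.assoc (eqToHom _)]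
  have h1 : ∀ i, A.listAct (ls i) f = _ ≫ _ := fun i =>
    (listAct_of_isSame f (show ls i = (List.finRange (ls i).length).map (ls i).get by simp)
      (hS i)).symm
  simp only [h1]
  rw [tensorMap_comp, Category.assoc]
  refine congrArg (_ ≫ ·) (h.symm.trans ?_)
  exact (Category.assoc _ _ _).trans (congrArg (_ ≫ ·) ((Category.assoc _ _ _).trans
    (congrArg (_ ≫ ·) (Category.assoc _ _ _))))

end OperadAlgebra

end AlgebraFunctor

/-! ### The monoids of an algebra -/

section AlgebraMonoids

variable {C : Type w} [Category.{v} C] {M : Type u} [Category.{v} M] [MonoidalCategory M]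
  [SymmetricCategory M] [MonoidalClosed M] [HasCoproducts.{v} M]

namespace OperadAlgebra

variable (A : OperadAlgebra ((OC C).baseChange : ColoredOperad C M)) {ι : Type*}

/-- The action of the unary operation `(e, f)`. -/
def mapHom {s t : C} (f : s ⟶ t) : A.carrier s ⟶ A.carrier t :=
  (ρ_ _).inv ≫ A.listAct [()] (c := fun _ => s) fun _ => f

/-- The action of the nullary operation. -/
def unitHom (t : C) : 𝟙_ M ⟶ A.carrier t :=
  A.listAct ([] : List Empty) (c := fun _ => t) fun _ => 𝟙 t

/-- The action of the binary operation `(e, (id, id))`. -/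
def mulHom (t : C) : A.carrier t ⊗ A.carrier t ⟶ A.carrier t :=
  A.carrier t ◁ (ρ_ _).inv ≫ A.listAct [false, true] (c := fun _ => t) fun _ => 𝟙 t

theorem listAct_nil {c : ι → C} {t : C} (f : ∀ i, c i ⟶ t) :
    A.listAct [] f = A.unitHom t := by
  have h := listAct_map (A := A) (Empty.elim : Empty → ι) [] f
  -- Families indexed by `Empty` are unique, so the nullary operation depends on nothing but `t`.
  have h' : ∀ (c' : Empty → C) (f' : ∀ i, c' i ⟶ t), A.listAct [] f' = A.unitHom t := by
    intro c' f'
    obtain rfl : c' = fun _ => t := funext fun i => i.elim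
    obtain rfl : f' = fun _ => 𝟙 t := funext fun i => i.elim
    rfl
  exact h.trans ((Category.id_comp _).trans (h' _ _))

theorem listAct_singleton (i : ι) {c : ι → C} {t : C} (f : ∀ i, c i ⟶ t) :
    A.listAct [i] f = (ρ_ _).hom ≫ A.mapHom (f i) := by
  have h := listAct_map (A := A) (fun _ : Unit => i) [()] f
  refine h.trans ?_
  rw [mapHom, Iso.hom_inv_id_assoc]
  have e : (tensorRelabel (fun i => A.carrier (c i)) (fun _ : Unit => i) [()]).hom = 𝟙 _ :=
    MonoidalCategory.whiskerLeft_id _ _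
  exact (congrArg (· ≫ _) e).trans (Category.id_comp _)

theorem listAct_pair (i j : ι) {t : C} :
    A.listAct [i, j] (c := fun _ => t) (fun _ => 𝟙 t) =
      A.carrier t ◁ (ρ_ _).hom ≫ A.mulHom t := by
  have h := listAct_map (A := A) (fun b : Bool => cond b j i) [false, true] (c := fun _ => t)
    fun _ => 𝟙 t
  refine h.trans ?_
  rw [mulHom, ← MonoidalCategory.whiskerLeft_comp_assoc, Iso.hom_inv_id]
  refine congrArg (· ≫ _) ?_
  exact congrArg (A.carrier t ◁ ·) (MonoidalCategory.whiskerLeft_id _ _)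

/-- The operadic unit is the unary operation `(e, id_t)`, so this is the unit axiom. -/
theorem mapHom_id (t : C) : A.mapHom (𝟙 t) = 𝟙 _ := by
  rw [← A.ocAct_one t, ← cancel_epi (ρ_ (A.carrier t)).hom, ← listAct_singleton A (0 : Fin 1)
    (c := fun _ => t) fun _ => 𝟙 t]
  refine (listAct_finRange (n := 1) (c := fun _ => t) fun _ => 𝟙 t).trans ?_
  exact (Iso.hom_inv_id_assoc _ _).symm

/-- The case of one block, with outer operation `(e, g)`. -/
theorem listAct_comp (l : List ι) {c : ι → C} {s t : C} (f : ∀ i, c i ⟶ s) (g : s ⟶ t) :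
    A.listAct l f ≫ A.mapHom g = A.listAct l fun i => f i ≫ g := by
  have h := listAct_join (A := A) (fun _ : Fin 1 => l) f g
  change (A.listAct l f ⊗ₘ 𝟙 (𝟙_ M)) ≫ A.listAct [(0 : Fin 1)] (c := fun _ => s) (fun _ => g) =
    (tensorList (fun i => A.carrier (c i)) l ◁ 𝟙 (𝟙_ M) ≫
      tensorAppend (fun i => A.carrier (c i)) l []) ≫
      A.listAct (l ++ []) fun i => f i ≫ g at h
  rw [listAct_singleton, append_nil_eq, MonoidalCategory.whiskerLeft_id, Category.id_comp,
    Category.assoc, listAct_eqToHom (List.append_nil l).symm, tensorHom_id,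
    rightUnitor_naturality_assoc] at h
  exact (cancel_epi _).1 h

/-- The case of two blocks, with outer operation `(e, (id, id))`. -/
theorem listAct_append (l l' : List ι) {c : ι → C} {t : C} (f : ∀ i, c i ⟶ t) :
    (A.listAct l f ⊗ₘ A.listAct l' f) ≫ A.mulHom t =
      tensorAppend _ l l' ≫ A.listAct (l ++ l') f := by
  have h := listAct_join (A := A) ![l, l'] f (𝟙 t)
  simp only [Category.comp_id] at h
  change (A.listAct l f ⊗ₘ (A.listAct l' f ⊗ₘ 𝟙 (𝟙_ M))) ≫
      A.listAct [(0 : Fin 2), 1] (c := fun _ => t) (fun _ => 𝟙 t) =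
    (tensorList (fun i => A.carrier (c i)) l ◁ (tensorList (fun i => A.carrier (c i)) l' ◁
      𝟙 (𝟙_ M) ≫ tensorAppend (fun i => A.carrier (c i)) l' []) ≫
      tensorAppend (fun i => A.carrier (c i)) l (l' ++ [])) ≫
      A.listAct (l ++ (l' ++ [])) f at h
  -- This carries the identification of `l' ++ []` with `l'` through the outer concatenation.
  have e : ∀ {m m' : List ι} (e : m = m'), tensorList (fun i => A.carrier (c i)) l ◁
      eqToHom (congrArg (tensorList fun i => A.carrier (c i)) e) ≫
        tensorAppend (fun i => A.carrier (c i)) l m' ≫ A.listAct (l ++ m') f =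
      tensorAppend (fun i => A.carrier (c i)) l m ≫ A.listAct (l ++ m) f := by
    rintro m _ rfl
    simp
  rw [listAct_pair, append_nil_eq, MonoidalCategory.whiskerLeft_id, Category.id_comp,
    MonoidalCategory.whiskerLeft_comp, Category.assoc, Category.assoc,
    e (List.append_nil l').symm] at h
  rw [← cancel_epi (tensorList (fun i => A.carrier (c i)) l ◁ (ρ_ _).hom), ← h,
    ← id_tensorHom, ← id_tensorHom, tensorHom_comp_tensorHom_assoc,
    tensorHom_comp_tensorHom_assoc, Category.id_comp, Category.comp_id, tensorHom_id,
    rightUnitor_naturality]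

theorem mapHom_comp {r s t : C} (f : r ⟶ s) (g : s ⟶ t) :
    A.mapHom (f ≫ g) = A.mapHom f ≫ A.mapHom g := by
  rw [mapHom, mapHom, Category.assoc, listAct_comp]

theorem unitHom_mapHom {s t : C} (g : s ⟶ t) : A.unitHom s ≫ A.mapHom g = A.unitHom t := by
  rw [unitHom, listAct_comp, listAct_nil]

theorem listAct_cons (i : ι) (l : List ι) {c : ι → C} {t : C} (f : ∀ i, c i ⟶ t) :
    A.listAct (i :: l) f = (A.mapHom (f i) ⊗ₘ A.listAct l f) ≫ A.mulHom t := by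
  have h := A.listAct_append [i] l f
  have e : tensorAppend (fun i => A.carrier (c i)) [i] l = (ρ_ _).hom ▷ _ :=
    triangle (A.carrier (c i)) (tensorList (fun i => A.carrier (c i)) l)
  rw [listAct_singleton, e, ← tensorHom_id] at h
  rw [← cancel_epi ((ρ_ (A.carrier (c i))).hom ⊗ₘ 𝟙 (tensorList (fun i => A.carrier (c i)) l)),
    tensorHom_comp_tensorHom_assoc, Category.id_comp]
  exact h.symm

/-- Both sides are the action of `(e, (g, g))`, decomposed with `g` after the product or before it.
-/
theorem mulHom_mapHom {s t : C} (g : s ⟶ t) :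
    A.mulHom s ≫ A.mapHom g = (A.mapHom g ⊗ₘ A.mapHom g) ≫ A.mulHom t := by
  have h := A.listAct_cons false [true] (c := fun _ => s) fun _ => g
  rw [listAct_singleton] at h
  rw [mulHom, Category.assoc, listAct_comp]
  simp only [Category.id_comp]
  rw [h, ← id_tensorHom]
  exact (tensorHom_comp_tensorHom_assoc _ _ _ _ _).trans (by simp)

theorem unitHom_mulHom (t : C) : A.unitHom t ▷ A.carrier t ≫ A.mulHom t = (λ_ _).hom := by
  have h := A.listAct_append [] [()] (c := fun _ => t) fun _ => 𝟙 t
  rw [listAct_singleton, listAct_nil, mapHom_id] at h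
  change _ = (λ_ _).hom ≫ A.listAct [()] _ at h
  rw [listAct_singleton, mapHom_id] at h
  rw [← cancel_epi (𝟙_ M ◁ (ρ_ (A.carrier t)).hom), whisker_exchange_assoc,
    leftUnitor_naturality]
  refine Eq.trans ?_ (h.trans (congrArg ((λ_ _).hom ≫ ·) (Category.comp_id _)))
  rw [Category.comp_id, MonoidalCategory.tensorHom_def, Category.assoc]

theorem mulHom_unitHom (t : C) : A.carrier t ◁ A.unitHom t ≫ A.mulHom t = (ρ_ _).hom := by
  have h := A.listAct_cons () [] (c := fun _ => t) fun _ => 𝟙 t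
  rw [listAct_singleton, listAct_nil, mapHom_id, Category.comp_id] at h
  rw [h, ← id_tensorHom]

/-- Both bracketings are the ternary operation `(e, (id, id, id))`, split as two factors and one, or
as one and two. The rest removes trailing units. -/
theorem mulHom_assoc (t : C) :
    A.mulHom t ▷ A.carrier t ≫ A.mulHom t =
      (α_ _ _ _).hom ≫ A.carrier t ◁ A.mulHom t ≫ A.mulHom t := by
  have h := A.listAct_append [(), ()] [()] (c := fun _ => t) fun _ => 𝟙 t
  have h' := A.listAct_cons () [(), ()] (c := fun _ => t) fun _ => 𝟙 t
  have e : tensorAppend (fun _ : Unit => A.carrier t) [(), ()] [()] =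
      (α_ (A.carrier t) (A.carrier t ⊗ 𝟙_ M) (A.carrier t ⊗ 𝟙_ M)).hom ≫
        A.carrier t ◁ (ρ_ (A.carrier t)).hom ▷ (A.carrier t ⊗ 𝟙_ M) :=
    congrArg (fun f => (α_ _ _ _).hom ≫ A.carrier t ◁ f) (triangle (A.carrier t) _)
  rw [listAct_pair, mapHom_id] at h'
  rw [listAct_singleton, listAct_pair, mapHom_id, e] at h
  replace h := h.trans (congrArg (_ ≫ ·) h')
  rw [← cancel_epi ((A.carrier t ◁ (ρ_ _).hom) ⊗ₘ (ρ_ (A.carrier t)).hom)]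
  simp only [Category.comp_id, Category.assoc, id_tensorHom] at h
  refine Eq.trans ?_ (h.trans ?_)
  · rw [← tensorHom_id, tensorHom_comp_tensorHom_assoc, Category.comp_id]
  · simp only [MonoidalCategory.tensorHom_def, MonoidalCategory.whiskerLeft_comp, Category.assoc]
    rw [associator_naturality_right_assoc, associator_naturality_middle_assoc]

instance monObj (t : C) : MonObj (A.carrier t) where
  one := A.unitHom t
  mul := A.mulHom t
  one_mul := A.unitHom_mulHom t
  mul_one := A.mulHom_unitHom t
  mul_assoc := A.mulHom_assoc t

/-- The functor with values in monoids given by an `O_C`-algebra. -/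
def toFunctor : C ⥤ Mon M where
  obj t := ⟨A.carrier t⟩
  map f := { hom := A.mapHom f, isMonHom_hom := ⟨A.unitHom_mapHom f, A.mulHom_mapHom f⟩ }
  map_id t := Mon.Hom.ext (A.mapHom_id t)
  map_comp f g := Mon.Hom.ext (A.mapHom_comp f g)

theorem listAct_eq (l : List ι) {c : ι → C} {t : C} (f : ∀ i, c i ⟶ t) :
    A.listAct l f = tensorMap (fun i => A.mapHom (f i)) l ≫ mulList (A.carrier t) l := by
  induction l with
  | nil => exact (A.listAct_nil f).trans (Category.id_comp _).symm
  | cons i l ih =>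
    rw [listAct_cons, ih]
    change _ = (A.mapHom (f i) ⊗ₘ tensorMap _ l) ≫ _ ◁ mulList _ l ≫ A.mulHom t
    rw [← id_tensorHom, tensorHom_comp_tensorHom_assoc, Category.comp_id]

/-- Acting on `(σ, f)` by `σ⁻¹` makes its permutation trivial. By equivariance of both sides it is
enough to treat operations `(e, f)`, where `listAct_eq` applies. -/
theorem ocAct_eq {t : C} {a : Profile C} (o : OCOp a t) :
    A.ocAct o = monAct A.toFunctor o := by
  rw [← ocAct_act A o.perm.symm o, ← monAct_act A.toFunctor o.perm.symm o]
  refine congrArg (tensorFinPerm o.perm.symm _ ≫ ·) ?_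
  have e : o.act (a.toPermute o.perm.symm) = OCOp.ofHom fun i => o.hom (o.perm.symm i) := by
    refine OCOp.ext_of_lt_iff (fun i j => ?_) fun i => Category.id_comp _
    rw [OCOp.act_perm_lt_iff]
    simp [Profile.toPermute]
  rw [e, monAct_ofHom]
  exact (listAct_finRange _).symm.trans (A.listAct_eq _ _)

end OperadAlgebra

end AlgebraMonoids

/-! ### The isomorphism of categories -/

section MonIso

variable {C : Type w} [Category.{v} C] {M : Type u} [Category.{v} M] [MonoidalCategory M]
  [SymmetricCategory M] [MonoidalClosed M] [HasCoproducts.{v} M]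

namespace OperadAlgebra

/-- The `O_C`-algebra given by a functor with values in monoids. -/
def ofFunctor (F : C ⥤ Mon M) : OperadAlgebra ((OC C).baseChange : ColoredOperad C M) :=
  ofOp (O := OC C) (fun t => (F.obj t).X) (fun o => monAct F o) (fun σ o => monAct_act F σ o)
    (fun o p => monAct_comp F o p) (monAct_one F)

theorem ocAct_ofFunctor (F : C ⥤ Mon M) {t : C} {a : Profile C} (o : OCOp a t) :
    (ofFunctor F).ocAct o = monAct F o :=
  opAct_ofOp (O := OC C) _ _ _ _ _ o

theorem ofFunctor_toFunctor (A : OperadAlgebra ((OC C).baseChange : ColoredOperad C M)) :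
    ofFunctor A.toFunctor = A :=
  ext_of_opAct rfl fun o => heq_of_eq ((ocAct_ofFunctor A.toFunctor o).trans (A.ocAct_eq o).symm)

/-- The functor from functors with values in monoids to `O_C`-algebras. -/
def fromMon (C : Type w) [Category.{v} C] (M : Type u) [Category.{v} M] [MonoidalCategory M]
    [SymmetricCategory M] [MonoidalClosed M] [HasCoproducts.{v} M] :
    (C ⥤ Mon M) ⥤ OperadAlgebra ((OC C).baseChange : ColoredOperad C M) where
  obj := ofFunctor
  map {F G} α :=
    { app := fun t => (α.app t).hom
      comm := comm_of_opAct (O := OC C) (A := ofFunctor F) (B := ofFunctor G)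
          (f := fun t => (α.app t).hom) fun o => by
        refine (congrArg (_ ≫ ·) (ocAct_ofFunctor G o)).trans ((monAct_natural α o).trans ?_)
        exact congrArg (· ≫ _) (ocAct_ofFunctor F o).symm }
  map_id _ := rfl
  map_comp _ _ := rfl

theorem listAct_natural {A B : OperadAlgebra ((OC C).baseChange : ColoredOperad C M)} (g : A ⟶ B)
    {ι : Type*} (l : List ι) {c : ι → C} {t : C} (f : ∀ i, c i ⟶ t) :
    tensorMap (fun i => g.app (c i)) l ≫ B.listAct l f = A.listAct l f ≫ g.app t := by
  have h : ∀ {m : List ι} (e : l = m), tensorMap (fun i => g.app (c i)) l ≫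
      eqToHom (congrArg (tensorList fun i => B.carrier (c i)) e) =
      eqToHom (congrArg (tensorList fun i => A.carrier (c i)) e) ≫
        tensorMap (fun i => g.app (c i)) m := by
    rintro _ rfl
    simp
  have h' := tensorMap_relabel (fun i => g.app (c i)) l.get (List.finRange l.length)
  rw [listAct, listAct, reassoc_of% (h (by simp : l = (List.finRange l.length).map l.get)),
    reassoc_of% h', Category.assoc, Category.assoc]
  exact congrArg (fun f => _ ≫ _ ≫ f) (Hom.opAct_comm (O := OC C) g (t := t)
    (a := ⟨l.length, fun i => c (l.get i)⟩) (OCOp.ofHom fun i => f (l.get i)))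

theorem mapHom_natural {A B : OperadAlgebra ((OC C).baseChange : ColoredOperad C M)} (g : A ⟶ B)
    {s t : C} (f : s ⟶ t) : A.mapHom f ≫ g.app t = g.app s ≫ B.mapHom f := by
  rw [mapHom, mapHom, Category.assoc, ← listAct_natural]
  have h : tensorMap (fun _ : Unit => g.app s) [()] = g.app s ⊗ₘ 𝟙 (𝟙_ M) := rfl
  rw [h, tensorHom_id, rightUnitor_inv_naturality_assoc]

theorem unitHom_natural {A B : OperadAlgebra ((OC C).baseChange : ColoredOperad C M)} (g : A ⟶ B)
    (t : C) : A.unitHom t ≫ g.app t = B.unitHom t := by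
  rw [unitHom, ← listAct_natural]
  exact Category.id_comp _

theorem mulHom_natural {A B : OperadAlgebra ((OC C).baseChange : ColoredOperad C M)} (g : A ⟶ B)
    (t : C) : A.mulHom t ≫ g.app t = (g.app t ⊗ₘ g.app t) ≫ B.mulHom t := by
  rw [mulHom, mulHom, Category.assoc, ← listAct_natural]
  have h : tensorMap (fun _ : Bool => g.app t) [false, true] =
    g.app t ⊗ₘ (g.app t ⊗ₘ 𝟙 (𝟙_ M)) := rfl
  rw [h, ← id_tensorHom, ← id_tensorHom, tensorHom_comp_tensorHom_assoc,
    tensorHom_comp_tensorHom_assoc]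
  simp

/-- The functor from `O_C`-algebras to functors with values in monoids. -/
def toMon (C : Type w) [Category.{v} C] (M : Type u) [Category.{v} M] [MonoidalCategory M]
    [SymmetricCategory M] [MonoidalClosed M] [HasCoproducts.{v} M] :
    OperadAlgebra ((OC C).baseChange : ColoredOperad C M) ⥤ (C ⥤ Mon M) where
  obj A := A.toFunctor
  map g :=
    { app := fun t =>
        { hom := g.app t
          isMonHom_hom := ⟨unitHom_natural g t, mulHom_natural g t⟩ }
      naturality := fun _ _ f => Mon.Hom.ext (mapHom_natural g f) }

theorem listAct_ofFunctor (F : C ⥤ Mon M) {ι : Type*} (l : List ι) {c : ι → C} {t : C}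
    (f : ∀ i, c i ⟶ t) :
    (ofFunctor F).listAct l f = tensorMap (fun i => (F.map (f i)).hom) l ≫
      mulList (F.obj t).X l := by
  have h : ∀ {m : List ι} (e : l = m), tensorMap (fun i => (F.map (f i)).hom) l ≫
      eqToHom (congrArg (tensorList fun i => (F.obj t).X) e) =
      eqToHom (congrArg (tensorList fun i => (F.obj (c i)).X) e) ≫
        tensorMap (fun i => (F.map (f i)).hom) m := by
    rintro _ rfl
    simp
  have e : l = (List.finRange l.length).map l.get := by simp
  have h' := tensorMap_relabel (fun i => (F.map (f i)).hom) l.get (List.finRange l.length)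
  rw [← eqToHom_mulList _ e, ← relabel_mulList, reassoc_of% (h e), reassoc_of% h', listAct,
    ocAct_ofFunctor, monAct_ofHom]
  rfl

theorem mapHom_ofFunctor (F : C ⥤ Mon M) {s t : C} (f : s ⟶ t) :
    (ofFunctor F).mapHom f = (F.map f).hom := by
  refine (Iso.inv_comp_eq _).2 ((listAct_ofFunctor F _ _).trans ?_)
  change ((F.map f).hom ⊗ₘ 𝟙 (𝟙_ M)) ≫ (F.obj t).X ◁ MonObj.one ≫ MonObj.mul = _
  rw [MonObj.mul_one, tensorHom_id, rightUnitor_naturality]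
  rfl

theorem mulHom_ofFunctor (F : C ⥤ Mon M) (t : C) :
    (ofFunctor F).mulHom t = MonObj.mul (X := (F.obj t).X) := by
  refine ((whiskerLeftIso (F.obj t).X (ρ_ (F.obj t).X)).inv_comp_eq).2
    ((listAct_ofFunctor F _ _).trans ?_)
  change ((F.map (𝟙 t)).hom ⊗ₘ ((F.map (𝟙 t)).hom ⊗ₘ 𝟙 (𝟙_ M))) ≫
    (F.obj t).X ◁ ((F.obj t).X ◁ MonObj.one ≫ MonObj.mul) ≫ MonObj.mul = _
  rw [MonObj.mul_one, F.map_id, Mon.id_hom', id_tensorHom, id_tensorHom,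
    MonoidalCategory.whiskerLeft_id, MonoidalCategory.whiskerLeft_id, Category.id_comp]
  rfl

/-- Carriers agree by definition; `mon_functor_ext` leaves only products and transition maps to
compare. -/
theorem toFunctor_ofFunctor (F : C ⥤ Mon M) : (ofFunctor F).toFunctor = F :=
  mon_functor_ext (fun _ => rfl) (fun t => heq_of_eq (mulHom_ofFunctor F t))
    fun f => heq_of_eq (mapHom_ofFunctor F f)

end OperadAlgebra

open OperadAlgebra

theorem eq_conj_eqToHom {V : Type u} [Category.{v} V] {X X' Y Y' : V} {f : X ⟶ Y} {g : X' ⟶ Y'}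
    (hX : X = X') (hY : Y = Y') (h : HEq f g) : f = eqToHom hX ≫ g ≫ eqToHom hY.symm :=
  (conj_eqToHom_iff_heq f g hX hY).2 h

theorem fromMon_toMon : fromMon C M ⋙ toMon C M = 𝟭 _ := by
  -- The source and target functors are only propositionally equal, so transformations are compared
  -- heterogeneously, through their components.
  have e : ∀ {F F' G G' : C ⥤ Mon M} (α : F ⟶ G) (α' : F' ⟶ G'), F = F' → G = G' →
      (∀ t, HEq (α.app t).hom (α'.app t).hom) → HEq α α' := by
    rintro F _ G _ α α' rfl rfl h
    exact heq_of_eq (NatTrans.ext (funext fun t => Mon.Hom.ext (eq_of_heq (h t))))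
  exact Functor.hext toFunctor_ofFunctor fun F G α =>
    e ((toMon C M).map ((fromMon C M).map α)) α (toFunctor_ofFunctor F) (toFunctor_ofFunctor G)
      fun _ => HEq.rfl

theorem toMon_fromMon : toMon C M ⋙ fromMon C M = 𝟭 _ :=
  OperadAlgebra.functor_ext ofFunctor_toFunctor fun f t =>
    eq_conj_eqToHom (f := f.app t) (g := f.app t) rfl rfl HEq.rfl

variable (M) in
/-- The isomorphism of categories between functors with values in monoids and `O_C`-algebras. -/
def monIso (C : Type w) [Category.{v} C] :
    Cat.of (C ⥤ Mon M) ≅ Cat.of (OperadAlgebra ((OC C).baseChange : ColoredOperad C M)) where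
  hom := (fromMon C M).toCatHom
  inv := (toMon C M).toCatHom
  hom_inv_id := congrArg Functor.toCatHom fromMon_toMon
  inv_hom_id := congrArg Functor.toCatHom toMon_fromMon

theorem opAct_pullback {K L : Type w} {O : SetOperad.{v} K} {P : SetOperad.{v} L}
    (F : SetOperad.Hom O P) (A : OperadAlgebra (P.baseChange : ColoredOperad L M)) {t : K}
    {a : Profile K} (o : (O.obj t).obj a) :
    ((F.baseChange M).pullback.obj A).opAct o = A.opAct (F.app t a o) := by
  refine congrArg ((λ_ _).inv ≫ ·) ?_
  refine (Category.assoc _ _ _).symm.trans (congrArg (· ≫ A.act (F.color t) _) ?_)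
  exact (comp_whiskerRight _ _ _).symm.trans (congrArg (· ▷ _) (pt_map (↾F.app t a) o))

/-- The actions of `(σ, F(f))` through `G` and of `(σ, f)` through `F ⋙ G` are the same morphism by
definition. -/
theorem pullback_ofFunctor {D : Type w} [Category.{v} D] (F : C ⥤ D) (G : D ⥤ Mon M) :
    ((OC.map F).baseChange M).pullback.obj (ofFunctor G) = ofFunctor (F ⋙ G) :=
  ext_of_opAct (O := OC C) rfl fun o => heq_of_eq <|
    (opAct_pullback (OC.map F) (ofFunctor G) o).trans <|
      (ocAct_ofFunctor G (OCOp.mapFunctor F o)).trans (ocAct_ofFunctor (F ⋙ G) o).symm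

end MonIso

/-- The isomorphisms between `O_C`-algebras and functors with values in monoids are natural. -/
def algIsoMon (M : Type u) [Category.{v} M] [MonoidalCategory M] [SymmetricCategory M]
    [MonoidalClosed M] [HasCoproducts.{v} M] :
    (ocFunctor M).op ⋙ algFunctor M ≅ monFunctor M :=
  -- The isomorphism is built starting from functors, because `pullback_ofFunctor` gives the
  -- naturality square there as a strict equality; it is then inverted.
  (NatIso.ofComponents (F := monFunctor M) (G := (ocFunctor M).op ⋙ algFunctor M)
    (fun C => monIso M C.unop) fun F =>
      Cat.ext (OperadAlgebra.functor_ext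
        (fun G => (pullback_ofFunctor F.unop.toFunctor G).symm) fun α t =>
          eq_conj_eqToHom (f := (α.app (F.unop.toFunctor.obj t)).hom)
            (g := (α.app (F.unop.toFunctor.obj t)).hom) rfl rfl HEq.rfl)).symm

end

end ColOp

theorem theorem4p17 (M : Type u) [Category.{v} M] [MonoidalCategory M] [SymmetricCategory M]
    [MonoidalClosed M] [HasLimits M] [HasColimits M] :
    Nonempty ((ColOp.ocFunctor M).op ⋙ ColOp.algFunctor M ≅ ColOp.monFunctor M) :=
  ⟨ColOp.algIsoMon M⟩
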